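/- Let $M$ be a closed (compact, without boundary) smooth 3-manifold and let $f:M\to M$ be a partially hyperbolic $C^1$ diffeomorphism: there are a continuous Riemannian metric $\|\cdot\|$ and a $Df$-invariant splitting $TM=E^s\oplus E^c\oplus E^u$ into three continuous line bundles such that, for every $x\in M$ and all unit vectors $v_s\in E^s_x$, $v_c\in E^c_x$, $v_u\in E^u_x$, $$\|Df(x)v_s\|<\|Df(x)v_c\|<\|Df(x)v_u\|,\qquad \|Df(x)v_s\|<1<\|Df(x)v_u\|.$$ A $cu$-torus is a $C^1$ embedded surface $T\subset M$ homeomorphic to the 2-torus with $T_xT=E^c_x\oplus E^u_x$ for all $x\in T$. A stable tubular neighbourhood of radius $\delta>0$ of $T$ is an open set $U\supset T$ that is the image of an open embedding $\Phi$ of the disc bundle $\{(x,v): x\in T,\ v\in E^s_x,\ \|v\|<\delta\}$ such that, for every $x\in T$ and every unit vector $v\in E^s_x$, the curve $t\mapsto\Phi(x,tv)$, $|t|<\delta$, is a unit speed $C^1$ curve tangent to $E^s$ that starts at $x$ with velocity $v$. (Thus $U$ is the disjoint union of the local stable leaves of size $\delta$ through the points of $T$.) Suppose that $T$ is a $cu$-torus.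 Then there is a $\delta_0>0$ such that for every $0<\delta<\delta_0$ there are a stable tubular neighbourhood $U$ of radius $\delta$ of $T$ and an integer $n\ge 1$ with $$f^{n}(\overline U)\subset U,$$ and the nested intersection $$T_0=\bigcap_{k=0}^{\infty} f^{kn}(U)$$ is a $cu$-torus with $f^{n}(T_0)=T_0$. In particular $f$ has a periodic $cu$-torus, and this torus is an attractor of $f^n$ with trapping region $U$. -/

import Mathlib

open Set
open scoped Manifold ContDiff

section PartialHyperbolicity

variable {M : Type*} [TopologicalSpace M] [ChartedSpace (EuclideanSpace ℝ (Fin 3)) M]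

/-- A field of subspaces of the tangent spaces of a 3-manifold (a "distribution"). -/
abbrev PlaneField (M : Type*) [TopologicalSpace M]
    [ChartedSpace (EuclideanSpace ℝ (Fin 3)) M] :=
  ∀ x : M, Submodule ℝ (TangentSpace (𝓡 3) x)

/-- A continuous Riemannian metric on the tangent bundle of a 3-manifold. -/
abbrev RiemMetric (M : Type*) [TopologicalSpace M]
    [ChartedSpace (EuclideanSpace ℝ (Fin 3)) M] [IsManifold (𝓡 3) ∞ M] :=
  Bundle.ContinuousRiemannianMetric (EuclideanSpace ℝ (Fin 3))
    (fun x : M => TangentSpace (𝓡 3) x)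

/-- The norm of a tangent vector with respect to a Riemannian metric. -/
noncomputable def RiemMetric.len [IsManifold (𝓡 3) ∞ M] (g : RiemMetric M) (x : M)
    (v : TangentSpace (𝓡 3) x) : ℝ :=
  Real.sqrt (g.inner x v v)

/-- `E` is a continuous rank-one subbundle of the tangent bundle: locally it is spanned by a
continuous nowhere vanishing vector field. -/
def IsContinuousLineField [IsManifold (𝓡 3) ∞ M] (E : PlaneField M) : Prop :=
  ∀ x : M, ∃ V : Set M, IsOpen V ∧ x ∈ V ∧ ∃ X : ∀ y : M, TangentSpace (𝓡 3) y,
    ContinuousOn (fun y => (⟨y, X y⟩ : TangentBundle (𝓡 3) M)) V ∧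
      ∀ y ∈ V, X y ≠ 0 ∧ E y = Submodule.span ℝ {X y}

/-- The distribution `E` is invariant under the derivative of `f`. -/
def IsInvariantField (f : M → M) (E : PlaneField M) : Prop :=
  ∀ x : M, (E x).map (mfderiv (𝓡 3) (𝓡 3) f x).toLinearMap = E (f x)

/-- The diffeomorphism `f` of a 3-manifold is partially hyperbolic with stable, center and
unstable bundles `Es`, `Ec`, `Eu`, as measured by the Riemannian metric `g`. The three bundles are
nontrivial, so in dimension three each of them is a line bundle; three lines that
span a 3-dimensional space are automatically in direct sum. -/
structure IsPartiallyHyperbolic [IsManifold (𝓡 3) ∞ M] (f : M ≃ₘ^1⟮𝓡 3, 𝓡 3⟯ M)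
    (g : RiemMetric M) (Es Ec Eu : PlaneField M) : Prop where
  stable_lineField : IsContinuousLineField Es
  center_lineField : IsContinuousLineField Ec
  unstable_lineField : IsContinuousLineField Eu
  splitting : ∀ x : M, Es x ⊔ Ec x ⊔ Eu x = ⊤
  stable_invariant : IsInvariantField f Es
  center_invariant : IsInvariantField f Ec
  unstable_invariant : IsInvariantField f Eu
  domination : ∀ x : M, ∀ vs ∈ Es x, ∀ vc ∈ Ec x, ∀ vu ∈ Eu x,
    g.len x vs = 1 → g.len x vc = 1 → g.len x vu = 1 →
      g.len (f x) (mfderiv (𝓡 3) (𝓡 3) f x vs) < g.len (f x) (mfderiv (𝓡 3) (𝓡 3) f x vc) ∧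
      g.len (f x) (mfderiv (𝓡 3) (𝓡 3) f x vc) < g.len (f x) (mfderiv (𝓡 3) (𝓡 3) f x vu) ∧
      g.len (f x) (mfderiv (𝓡 3) (𝓡 3) f x vs) < 1 ∧
      1 < g.len (f x) (mfderiv (𝓡 3) (𝓡 3) f x vu)

/-- `T` is an embedded `C¹` surface with `T_y T = P y` for all `y ∈ T`, where `P` is a field of
tangent 2-planes: near each of its points `T` is a level set `{h = 0}` of a real `C¹`
function whose differential at the points `y` of `T` has kernel `P y` (so it is nonzero). -/
def IsSurfaceTangentTo (P : PlaneField M) (T : Set M) : Prop :=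
  ∀ x ∈ T, ∃ V : Set M, IsOpen V ∧ x ∈ V ∧ ∃ h : M → ℝ,
    ContMDiffOn (𝓡 3) 𝓘(ℝ, ℝ) 1 h V ∧
    T ∩ V = {y ∈ V | h y = 0} ∧
    ∀ y ∈ T ∩ V, LinearMap.ker (mfderiv (𝓡 3) 𝓘(ℝ, ℝ) h y).toLinearMap = P y

/-- A `cu`-torus: an embedded 2-torus tangent to `Ec ⊕ Eu`. -/
def IsCuTorus (Ec Eu : PlaneField M) (T : Set M) : Prop :=
  Nonempty (T ≃ₜ Circle × Circle) ∧ IsSurfaceTangentTo (fun x => Ec x ⊔ Eu x) T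

/-- The curve `c`, defined for `|t| < δ`, is a unit speed `C¹` curve tangent to the line
field `E`. -/
def IsUnitSpeedTangentCurve [IsManifold (𝓡 3) ∞ M] (g : RiemMetric M) (E : PlaneField M)
    (δ : ℝ) (c : ℝ → M) : Prop :=
  ContMDiffOn 𝓘(ℝ, ℝ) (𝓡 3) 1 c (Ioo (-δ) δ) ∧
    ∀ t ∈ Ioo (-δ) δ,
      mfderiv 𝓘(ℝ, ℝ) (𝓡 3) c t (1 : ℝ) ∈ E (c t) ∧
      g.len (c t) (mfderiv 𝓘(ℝ, ℝ) (𝓡 3) c t (1 : ℝ)) = 1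

/-- The set of vectors of length `< δ` in the restriction of the bundle `E` to `T`. -/
def discBundle [IsManifold (𝓡 3) ∞ M] (g : RiemMetric M) (E : PlaneField M) (T : Set M)
    (δ : ℝ) : Set (TangentBundle (𝓡 3) M) :=
  {p | p.1 ∈ T ∧ p.2 ∈ E p.1 ∧ g.len p.1 p.2 < δ}

/-- `U` is the stable tubular neighbourhood of radius `δ` of `T`: it is the image of an open
embedding `Φ` of the disc bundle of radius `δ` of `Es|_T`, and for each unit vector
`v ∈ Es x`, `x ∈ T`, the fibre `t ↦ Φ (x, t v)`, `|t| < δ`, is the local stable leaf through `x`: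
the unit speed curve tangent to `Es` that starts at `x` with velocity `v`. -/
def IsStableTubularNhd [IsManifold (𝓡 3) ∞ M] (g : RiemMetric M) (Es : PlaneField M)
    (T : Set M) (δ : ℝ) (U : Set M) : Prop :=
  ∃ Φ : TangentBundle (𝓡 3) M → M,
    Topology.IsOpenEmbedding ((discBundle g Es T δ).domRestrict Φ) ∧
    Φ '' discBundle g Es T δ = U ∧
    ∀ x ∈ T, ∀ v : TangentSpace (𝓡 3) x, v ∈ Es x → g.len x v = 1 →
      IsUnitSpeedTangentCurve g Es δ (fun t : ℝ => Φ ⟨x, t • v⟩) ∧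
      tangentMap 𝓘(ℝ, ℝ) (𝓡 3) (fun t : ℝ => Φ ⟨x, t • v⟩) ⟨0, (1 : ℝ)⟩ = ⟨x, v⟩

end PartialHyperbolicity

/-! The stable bundle is only continuous, so uniqueness of its integral curves and continuity of the
projection along them need an argument, and it must come from the dynamics. Everything is expressed
through one relation, `StableRel`: two points lie in a common set whose images under `f^[n]`, seen
through an embedding `e` of the manifold in a Euclidean space, have diameter at most `l` times any
bound for the products of the stable rates over that set. Short arcs tangent to the stable field
have this property (`stableRel_of_isSolutionOn`), concatenation adds the constants, and iteration
only improves them.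

Rigidity. Suppose that the difference of two stably related points lies in the center-unstable cone.
Domination keeps it in the cone, and its center-unstable part decays strictly more slowly than the
diameter bound permits, so the points coincide (`exists_stableRel_separation`). Consequently the
integral curves of the stable field are unique and depend continuously on the initial point
(`separatesSolutions`, `exists_flow`), and a closed surface tangent to the center-unstable field
contains no two distinct points that are stably related with a small constant
(`exists_separation_surface`). Hence short stable leaves through the torus are disjoint and fill a
tubular neighbourhood with a continuous projection (`exists_isStableTubularNhd`).

Uniform transversality. By a viability theorem (`exists_viable_solution`), a closed surface tangent
to the center-unstable field can be followed over curves in a box, on a scale that does not depend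
on the surface. So each point within a fixed distance of such a surface is joined to it by a short
stable arc (`exists_uniform_hits`). The same distance serves for all preimages of the torus under
iterates of `f`.

Recurrence. For a finite cover by small balls there are only finitely many patterns in which these
preimages can meet the balls. Two preimages whose exponents `i` and `i + n` differ by a large `n`
have the same pattern, so every point of either is stably related to a point of the other. Pushing
forward, `f^[n]` brings the torus so close to itself that the closure of the tubular neighbourhood
is mapped into the neighbourhood, and stable fibres are mapped into stable fibres, inducing a
bijection of the torus. Contraction leaves exactly one point of the nested intersection on each
fibre, and the projection is a homeomorphism from the intersection to the torus
(`exists_attractor`).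

Smoothness. The intersection is a limit of images of the torus. Tangent steps of uniform size
survive the limit, and rigidity makes the limit locally a graph, whose defining function has a
continuous differential (`isSurfaceTangentTo_limit`). -/

open Filter Topology

/-! ### Stably related points and their separation by domination -/

section StableRelation

variable {M F : Type*} [NormedAddCommGroup F]

/-- The product of `lam` along the first `n` points of the orbit of `x`. -/
def orbitProd (f : M → M) (lam : M → ℝ) (n : ℕ) (x : M) : ℝ :=
  ∏ i ∈ Finset.range n, lam (f^[i] x)

lemma orbitProd_add (f : M → M) (lam : M → ℝ) (m n : ℕ) (x : M) :
    orbitProd f lam (m + n) x = orbitProd f lam m x * orbitProd f lam n (f^[m] x) := by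
  simp only [orbitProd, Finset.prod_range_add]
  congr 1
  refine Finset.prod_congr rfl fun i _ => ?_
  rw [add_comm, Function.iterate_add_apply]

lemma orbitProd_pos {f : M → M} {lam : M → ℝ} (h0 : ∀ x, 0 < lam x) (n : ℕ) (x : M) :
    0 < orbitProd f lam n x := Finset.prod_pos fun _ _ => h0 _

lemma orbitProd_le_pow {f : M → M} {lam : M → ℝ} {κ : ℝ} (h0 : ∀ x, 0 < lam x)
    (hκ : ∀ x, lam x ≤ κ) (n : ℕ) (x : M) : orbitProd f lam n x ≤ κ ^ n := by
  have := Finset.prod_le_prod (s := Finset.range n) (fun i _ => (h0 (f^[i] x)).le)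
    (fun i _ => hκ (f^[i] x))
  simpa [orbitProd] using this

/-- Two points lie in a common set whose iterates shrink, as measured by `e`, at least as fast as
the products of `lam` along its orbits, starting from diameter `l`. -/
def StableRel (e : M → F) (f : M → M) (lam : M → ℝ) (l : ℝ) (x y : M) : Prop :=
  ∃ A : Set M, x ∈ A ∧ y ∈ A ∧ ∀ (n : ℕ) (K : ℝ), (∀ z ∈ A, orbitProd f lam n z ≤ K) →
    ∀ z ∈ A, ∀ z' ∈ A, ‖e (f^[n] z) - e (f^[n] z')‖ ≤ l * K

namespace StableRel

variable {e : M → F} {f : M → M} {lam : M → ℝ} {l l' κ : ℝ} {x y z : M}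

lemma symm (h : StableRel e f lam l x y) : StableRel e f lam l y x := by
  obtain ⟨A, hx, hy, h⟩ := h
  exact ⟨A, hy, hx, h⟩

lemma mono (h0 : ∀ x, 0 < lam x) (h : StableRel e f lam l x y) (hl : l ≤ l') :
    StableRel e f lam l' x y := by
  obtain ⟨A, hx, hy, h⟩ := h
  refine ⟨A, hx, hy, fun n K hK z hz z' hz' => (h n K hK z hz z' hz').trans ?_⟩
  have : 0 ≤ K := (orbitProd_pos h0 n x).le.trans (hK x hx)
  gcongr

/-- The union of the two witnessing sets works: a bound `K` for the products over the union serves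
both sets, and the common point `y` carries the triangle inequality. -/
lemma trans (h0 : ∀ x, 0 < lam x) (hl : 0 ≤ l) (hl' : 0 ≤ l') (h : StableRel e f lam l x y)
    (h' : StableRel e f lam l' y z) : StableRel e f lam (l + l') x z := by
  obtain ⟨A, hx, hy, h⟩ := h
  obtain ⟨B, hy', hz, h'⟩ := h'
  refine ⟨A ∪ B, Or.inl hx, Or.inr hz, fun n K hK => ?_⟩
  have hA := h n K fun w hw => hK w (Or.inl hw)
  have hB := h' n K fun w hw => hK w (Or.inr hw)
  have hK0 : 0 ≤ K := (orbitProd_pos h0 n x).le.trans (hK x (Or.inl hx))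
  have h1 : 0 ≤ l * K := by positivity
  have h2 : 0 ≤ l' * K := by positivity
  rw [add_mul]
  rintro u (hu | hu) v (hv | hv)
  · linarith [hA u hu v hv]
  · linarith [hA u hu y hy, hB y hy' v hv,
      norm_sub_le_norm_sub_add_norm_sub (e (f^[n] u)) (e (f^[n] y)) (e (f^[n] v))]
  · linarith [hB u hu y hy', hA y hy v hv,
      norm_sub_le_norm_sub_add_norm_sub (e (f^[n] u)) (e (f^[n] y)) (e (f^[n] v))]
  · linarith [hB u hu v hv]

/-- The image of the witnessing set works, since by `orbitProd_add` the first `m` factors of each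
product can be absorbed into `κ ^ m`. -/
lemma iterate (h0 : ∀ x, 0 < lam x) (hκ : ∀ x, lam x ≤ κ)
    (h : StableRel e f lam l x y) (m : ℕ) :
    StableRel e f lam (l * κ ^ m) (f^[m] x) (f^[m] y) := by
  obtain ⟨A, hx, hy, h⟩ := h
  refine ⟨f^[m] '' A, mem_image_of_mem _ hx, mem_image_of_mem _ hy, fun n K hK => ?_⟩
  have := h (m + n) (κ ^ m * K) fun z hz => by
    rw [orbitProd_add]
    exact mul_le_mul (orbitProd_le_pow h0 hκ m z) (hK _ (mem_image_of_mem _ hz))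
      (orbitProd_pos h0 _ _).le (pow_nonneg ((h0 x).le.trans (hκ x)) m)
  rintro _ ⟨z, hz, rfl⟩ _ ⟨z', hz', rfl⟩
  rw [← Function.iterate_add_apply, ← Function.iterate_add_apply, add_comm n m, mul_assoc]
  exact this z hz z' hz'

lemma iterate_le (h0 : ∀ x, 0 < lam x) (hκ : ∀ x, lam x ≤ κ) (hκ1 : κ ≤ 1) (hl : 0 ≤ l)
    (h : StableRel e f lam l x y) (m : ℕ) : StableRel e f lam l (f^[m] x) (f^[m] y) :=
  (h.iterate h0 hκ m).mono h0
    (mul_le_of_le_one_right hl (pow_le_one₀ ((h0 x).le.trans (hκ x)) hκ1))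

lemma norm_iterate_le (h0 : ∀ x, 0 < lam x) (hκ : ∀ x, lam x ≤ κ)
    (h : StableRel e f lam l x y) (n : ℕ) : ‖e (f^[n] x) - e (f^[n] y)‖ ≤ l * κ ^ n := by
  obtain ⟨A, hx, hy, h⟩ := h
  exact h n _ (fun z _ => orbitProd_le_pow h0 hκ n z) x hx y hy

end StableRel

variable [TopologicalSpace M] [CompactSpace M]

/-- On a compact space, a property of pairs that holds near the diagonal holds uniformly. -/
lemma exists_uniform_near_diagonal {e : M → F} (he : Continuous e) (hinj : Function.Injective e)
    {P : M → M → Prop} (h : ∀ x, ∀ᶠ p : M × M in 𝓝 (x, x), P p.1 p.2) :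
    ∃ ε > 0, ∀ x y, ‖e x - e y‖ < ε → P x y := by
  set O : Set (M × M) := interior {p | P p.1 p.2}
  have hO : IsCompact Oᶜ := isOpen_interior.isClosed_compl.isCompact
  rcases Oᶜ.eq_empty_or_nonempty with h0 | h0
  · refine ⟨1, one_pos, fun x y _ => ?_⟩
    have : (x, y) ∈ O := by
      rw [compl_empty_iff] at h0; rw [h0]; trivial
    exact (interior_subset this : (x, y) ∈ {p : M × M | P p.1 p.2})
  -- The bad set is compact and misses the diagonal, so by injectivity of `e` the distance of the
  -- images has a positive minimum on it.
  · obtain ⟨q, hq, hmin⟩ := hO.exists_isMinOn h0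
      (f := fun p : M × M => ‖e p.1 - e p.2‖) (by fun_prop)
    refine ⟨‖e q.1 - e q.2‖, ?_, fun x y hxy => ?_⟩
    · rw [gt_iff_lt, norm_pos_iff, sub_ne_zero]
      intro he
      apply hq
      have h1 : q = (q.1, q.1) := Prod.ext rfl (hinj he).symm
      rw [h1]
      exact mem_interior_iff_mem_nhds.2 (h q.1)
    · by_contra hP
      have : (x, y) ∈ Oᶜ := fun hm =>
        hP (interior_subset hm : (x, y) ∈ {p : M × M | P p.1 p.2})
      exact absurd (hmin this) (not_le.2 hxy)

/-- Constants that exist near each point of the diagonal can be chosen uniformly. -/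
lemma exists_uniform_const {P : ℝ → M × M → Prop} (hmono : ∀ c c' p, c' ≤ c → P c p → P c' p)
    (h : ∀ x, ∃ c > 0, ∀ᶠ p : M × M in 𝓝 (x, x), P c p) :
    ∃ c > 0, ∀ x, ∀ᶠ p : M × M in 𝓝 (x, x), P c p := by
  have := isCompact_univ.induction_on (X := M)
    (p := fun S => ∃ c > 0, ∀ x ∈ S, ∀ᶠ p : M × M in 𝓝 (x, x), P c p)
    ⟨1, one_pos, by simp⟩
    (fun s t hst ⟨c, hc, ht⟩ => ⟨c, hc, fun x hx => ht x (hst hx)⟩)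
    (fun s t ⟨c, hc, hs⟩ ⟨c', hc', ht⟩ => ⟨min c c', lt_min hc hc', fun x hx => by
      rcases hx with hx | hx
      · exact (hs x hx).mono fun p hp => hmono _ _ _ (min_le_left _ _) hp
      · exact (ht x hx).mono fun p hp => hmono _ _ _ (min_le_right _ _) hp⟩)
    (fun x _ => by
      obtain ⟨c, hc, hx⟩ := h x
      have h1 : Tendsto (fun y : M => (y, y)) (𝓝 x) (𝓝 (x, x)) :=
        (continuous_id.prodMk continuous_id).tendsto x
      exact ⟨_, mem_nhdsWithin_of_mem_nhds (h1.eventually hx.eventually_nhds), c, hc,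
        fun y hy => hy⟩)
  simpa using this

/-- Points that are stably related, and whose difference lies in the center-unstable cone,
coincide. -/
theorem exists_stableRel_separation {e : M → F} (he : Continuous e)
    (hinj : Function.Injective e) {f : M → M} {lam mu : M → ℝ}
    {κ : ℝ} (h0 : ∀ x, 0 < lam x) (hκ : ∀ x, lam x ≤ κ) (hκ1 : κ ≤ 1) (hlam : Continuous lam)
    (hmu : Continuous mu) (hlm : ∀ x, lam x < mu x) {a b : M → M → ℝ}
    (hab : ∀ x, ∃ c > 0, ∀ᶠ p : M × M in 𝓝 (x, x),
      c * ‖e p.1 - e p.2‖ ≤ a p.1 p.2 + b p.1 p.2 ∧ c * b p.1 p.2 ≤ ‖e p.1 - e p.2‖)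
    (hb0 : ∀ x y, 0 ≤ b x y)
    (hcone : ∀ x, ∀ η > 0, ∀ᶠ p : M × M in 𝓝 (x, x),
      a (f p.1) (f p.2) ≤ lam p.1 * a p.1 p.2 + η * ‖e p.1 - e p.2‖ ∧
      mu p.1 * b p.1 p.2 - η * ‖e p.1 - e p.2‖ ≤ b (f p.1) (f p.2)) :
    ∃ ε > 0, ∀ x y, StableRel e f lam ε x y → a x y ≤ b x y → x = y := by
  rcases isEmpty_or_nonempty M with hM | hM
  · exact ⟨1, one_pos, fun x => isEmptyElim x⟩
  -- One third of the gap is spent on the linearisation error, one on the variation of `lam` over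
  -- the witnessing set, and one remains as the difference of the two rates.
  obtain ⟨g, hg, hgap⟩ : ∃ g > 0, ∀ x, lam x + 3 * g ≤ mu x := by
    obtain ⟨q, -, hq⟩ := isCompact_univ.exists_isMinOn univ_nonempty
      (f := fun x => mu x - lam x) (by fun_prop)
    refine ⟨(mu q - lam q) / 3, by linarith [hlm q], fun x => ?_⟩
    have : mu q - lam q ≤ mu x - lam x := hq (mem_univ x)
    linarith
  obtain ⟨c, hc, hab⟩ := exists_uniform_const
    (P := fun c p => c * ‖e p.1 - e p.2‖ ≤ a p.1 p.2 + b p.1 p.2 ∧ c * b p.1 p.2 ≤ ‖e p.1 - e p.2‖)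
    (fun c c' p hcc h => ⟨(mul_le_mul_of_nonneg_right hcc (norm_nonneg _)).trans h.1,
      (mul_le_mul_of_nonneg_right hcc (hb0 _ _)).trans h.2⟩) hab
  have hvar : ∀ x, ∀ᶠ p : M × M in 𝓝 (x, x), lam p.2 - lam p.1 < g := fun x =>
    ((hlam.comp continuous_snd).sub (hlam.comp continuous_fst)).continuousAt.eventually_lt
      (continuousAt_const (y := g)) (by simpa using hg)
  obtain ⟨ε, hε, hloc⟩ := exists_uniform_near_diagonal he hinj
    (P := fun x y => (c * ‖e x - e y‖ ≤ a x y + b x y ∧ c * b x y ≤ ‖e x - e y‖) ∧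
      (a (f x) (f y) ≤ lam x * a x y + g * c / 2 * ‖e x - e y‖ ∧
        mu x * b x y - g * c / 2 * ‖e x - e y‖ ≤ b (f x) (f y)) ∧ lam y - lam x < g)
    (fun x => (hab x).and ((hcone x (g * c / 2) (by positivity)).and (hvar x)))
  refine ⟨ε / 2, by positivity, fun x y hxy hle => ?_⟩
  have hκ0 : 0 < κ := (h0 x).trans_le (hκ x)
  have hsmall : ∀ n : ℕ, ε / 2 * κ ^ n < ε := fun n => by
    have : κ ^ n ≤ 1 := pow_le_one₀ hκ0.le hκ1
    nlinarith
  have hD : ∀ n, ‖e (f^[n] x) - e (f^[n] y)‖ < ε := fun n =>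
    (hxy.norm_iterate_le h0 hκ n).trans_lt (hsmall n)
  -- The cone condition is forward invariant. Inside the cone the distance is at most `2 * b / c`,
  -- so the error `g * c / 2 * ‖e u - e v‖` costs at most `g * b`.
  have key : ∀ n, a (f^[n] x) (f^[n] y) ≤ b (f^[n] x) (f^[n] y) ∧
      (∏ i ∈ Finset.range n, (lam (f^[i] x) + 2 * g)) * b x y ≤ b (f^[n] x) (f^[n] y) := by
    intro n
    induction n with
    | zero => simpa using hle
    | succ n ih =>
      obtain ⟨⟨h1, -⟩, ⟨h3, h4⟩, -⟩ := hloc _ _ (hD n)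
      rw [Function.iterate_succ_apply', Function.iterate_succ_apply', Finset.prod_range_succ]
      set u := f^[n] x
      set v := f^[n] y
      have h5 : g * c / 2 * ‖e u - e v‖ ≤ g * b u v := by
        nlinarith [ih.1]
      have h6 : lam u * a u v ≤ lam u * b u v := mul_le_mul_of_nonneg_left ih.1 (h0 u).le
      have h7 : (lam u + 3 * g) * b u v ≤ mu u * b u v :=
        mul_le_mul_of_nonneg_right (hgap u) (hb0 _ _)
      have h8 := mul_nonneg hg.le (hb0 u v)
      have h9 := mul_le_mul_of_nonneg_left ih.2 (show 0 ≤ lam u + 2 * g by linarith [h0 u])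
      constructor <;> nlinarith
  -- The witnessing set stays `ε`-small along the orbit, so `lam` at its points exceeds `lam` along
  -- the orbit of `x` by less than `g`. The product along this single orbit, with `g` added to each
  -- factor, is therefore an admissible bound.
  have hDn : ∀ n, ‖e (f^[n] x) - e (f^[n] y)‖ ≤
      ε / 2 * ∏ i ∈ Finset.range n, (lam (f^[i] x) + g) := by
    intro n
    obtain ⟨A, hx, hy, hA⟩ := hxy
    refine hA n _ (fun z hz => Finset.prod_le_prod (fun i _ => (h0 _).le) fun i _ => ?_) x hx y hy
    have : ‖e (f^[i] x) - e (f^[i] z)‖ < ε :=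
      (StableRel.norm_iterate_le h0 hκ ⟨A, hx, hz, hA⟩ i).trans_lt (hsmall i)
    linarith [(hloc _ _ this).2.2]
  -- The quotient `(s + g) / (s + 2 * g)` increases with `s`, so its value at `κ` bounds every
  -- factor.
  set q := (κ + g) / (κ + 2 * g)
  have hq1 : q < 1 := by rw [div_lt_one (by positivity)]; linarith
  have hq0 : 0 ≤ q := by positivity
  have hprod : ∀ n, ∏ i ∈ Finset.range n, (lam (f^[i] x) + g) ≤
      q ^ n * ∏ i ∈ Finset.range n, (lam (f^[i] x) + 2 * g) := by
    intro n
    have : q ^ n = ∏ i ∈ Finset.range n, q := by simp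
    rw [this, ← Finset.prod_mul_distrib]
    refine Finset.prod_le_prod (fun i _ => by linarith [h0 (f^[i] x)]) fun i _ => ?_
    rw [div_mul_eq_mul_div, le_div_iff₀ (by positivity)]
    nlinarith [hκ (f^[i] x), h0 (f^[i] x)]
  -- The growth of `b` and the decay of the distance are compared after division by the common
  -- product; the bound tends to zero, which forces `b x y ≤ 0`.
  have hbn : ∀ n : ℕ, c * b x y ≤ ε / 2 * q ^ n := by
    intro n
    have hP : 0 < ∏ i ∈ Finset.range n, (lam (f^[i] x) + 2 * g) :=
      Finset.prod_pos fun i _ => by linarith [h0 (f^[i] x)]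
    have h1 := (hloc _ _ (hD n)).1.2
    have h2 := mul_le_mul_of_nonneg_left (key n).2 hc.le
    have h3 := mul_le_mul_of_nonneg_left (hprod n) (show 0 ≤ ε / 2 by positivity)
    have h4 := hDn n
    refine le_of_mul_le_mul_right ?_ hP
    nlinarith
  have hlim : Tendsto (fun n : ℕ => ε / 2 * q ^ n) atTop (𝓝 0) := by
    simpa using (tendsto_pow_atTop_nhds_zero_of_lt_one hq0 hq1).const_mul (ε / 2)
  have hb : c * b x y ≤ 0 := ge_of_tendsto' hlim hbn
  have hb' : b x y ≤ 0 := by nlinarith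
  have h1 := (hloc _ _ (hD 0)).1.1
  simp only [Function.iterate_zero, id] at h1
  have h2 : ‖e x - e y‖ ≤ 0 := by
    have : c * ‖e x - e y‖ ≤ 0 := by linarith
    exact nonpos_of_mul_nonpos_right this hc
  exact hinj (sub_eq_zero.1 (norm_le_zero_iff.1 h2))

end StableRelation

/-! ### Recurrence of preimages and the attracting set -/

section Attractor

variable {M F : Type*} [NormedAddCommGroup F] [TopologicalSpace M] [CompactSpace M]

/-- If the preimages of a compact set `T` under the iterates of `f` have uniform stable
neighbourhoods, then arbitrarily large preimages `f⁻ⁱ T`, `f⁻ʲ T` are stably related. -/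
lemma exists_stableRel_preimages [Nonempty M] {e : M → F} (he : Continuous e)
    {f : M → M} {lam : M → ℝ} {T : Set M} {l ε : ℝ} (hε : 0 < ε)
    (hits : ∀ k : ℕ, ∀ y z, f^[k] z ∈ T → ‖e y - e z‖ < ε → ∃ q, f^[k] q ∈ T ∧
      StableRel e f lam l y q) (N : ℕ) :
    ∃ i n : ℕ, N ≤ n ∧
      (∀ y, f^[i] y ∈ T → ∃ q, f^[i + n] q ∈ T ∧ StableRel e f lam l y q) ∧
      (∀ y, f^[i + n] y ∈ T → ∃ q, f^[i] q ∈ T ∧ StableRel e f lam l y q) := by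
  obtain ⟨t, -, ht⟩ := isCompact_univ.elim_nhds_subcover (X := M)
    (fun c => {y | ‖e y - e c‖ < ε / 2}) fun c _ =>
      (isOpen_lt (by fun_prop) continuous_const).mem_nhds (by simpa using hε)
  have htc : ∀ y, ∃ c ∈ t, ‖e y - e c‖ < ε / 2 := by
    intro y
    simpa using ht (mem_univ y)
  -- The pattern of the `k`-th preimage of `T`: the balls of the finite cover that it meets. There
  -- are finitely many patterns.
  let cls : ℕ → Set t := fun k => {c | ∃ z, f^[k] z ∈ T ∧ ‖e z - e c‖ < ε / 2}
  have hcls : ∀ k k', cls k = cls k' → ∀ y, f^[k] y ∈ T → ∃ q, f^[k'] q ∈ T ∧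
      StableRel e f lam l y q := by
    intro k k' hk y hy
    obtain ⟨c, hc, hyc⟩ := htc y
    have : (⟨c, hc⟩ : t) ∈ cls k' := hk ▸ ⟨y, hy, hyc⟩
    obtain ⟨z, hz, hzc⟩ := this
    refine hits k' y z hz ?_
    have := norm_sub_le_norm_sub_add_norm_sub (e y) (e c) (e z)
    rw [norm_sub_rev (e c)] at this
    change ‖e z - e c‖ < ε / 2 at hzc
    linarith
  -- Only multiples of `N` are sampled, so two different exponents differ by at least `N`.
  obtain ⟨k, k', hne, heq⟩ := Finite.exists_ne_map_eq_of_infinite (fun k => cls (N * k))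
  wlog hlt : k < k' generalizing k k'
  · exact this k' k hne.symm heq.symm (lt_of_le_of_ne (not_lt.1 hlt) hne.symm)
  have h1 : N * k + N * (k' - k) = N * k' := by rw [← mul_add, Nat.add_sub_cancel' hlt.le]
  refine ⟨N * k, N * (k' - k), Nat.le_mul_of_pos_right _ (by omega), ?_, ?_⟩
  · rw [h1]; exact hcls _ _ heq
  · rw [h1]; exact hcls _ _ heq.symm

/-- The attractor inside a tubular neighbourhood `U` of `T` with projection `π` along sets of
stably related points. -/
theorem exists_attractor [T2Space M] {e : M → F} (he : Continuous e) (hinj : Function.Injective e)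
    (f : M ≃ₜ M) {lam : M → ℝ} {κ : ℝ} (h0 : ∀ x, 0 < lam x) (hκ : ∀ x, lam x ≤ κ)
    (hκ1 : κ < 1) {T : Set M} (hT : IsCompact T) (hTne : T.Nonempty) {l l₀ : ℝ} (hl : 0 < l)
    (hl₀ : 0 ≤ l₀) (hl₀l : l₀ ≤ l)
    (hsep : ∀ x ∈ T, ∀ y ∈ T, StableRel e f lam (4 * l) x y → x = y)
    {ε : ℝ} (hε : 0 < ε)
    (hits : ∀ k : ℕ, ∀ y z, f^[k] z ∈ T → ‖e y - e z‖ < ε → ∃ q, f^[k] q ∈ T ∧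
      StableRel e f lam l y q)
    {U : Set M} (hU : IsOpen U) (hTU : T ⊆ U) {π : M → M} (hπT : ∀ y ∈ U, π y ∈ T)
    (hπ : ∀ y ∈ U, StableRel e f lam l₀ (π y) y) (hπc : ContinuousOn π U) :
    ∃ n : ℕ, 0 < n ∧ f^[n] '' closure U ⊆ U ∧ ∃ T₀ : Set M, T₀ = ⋂ k : ℕ, f^[k * n] '' U ∧
      Nonempty (T₀ ≃ₜ T) ∧ f^[n] '' T₀ = T₀ ∧ IsCompact T₀ ∧
      (∀ y ∈ T₀, ∀ y' ∈ T₀, StableRel e f lam l y y' → y = y') ∧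
      (∀ y ∈ T₀, ∀ k : ℕ, ∃ x ∈ T, ‖e (f^[k * n] x) - e y‖ ≤ l₀ * κ ^ k) := by
  have : Nonempty M := ⟨hTne.some⟩
  have hκ0 : 0 < κ := (h0 hTne.some).trans_le (hκ _)
  -- `η` is a collar width: every point within `η` of `T` lies in `U`.
  obtain ⟨η, hη, hηU⟩ := exists_uniform_near_diagonal he hinj
    (P := fun x y => x ∈ T → y ∈ U) (fun x => by
      by_cases hx : x ∈ T
      · exact (continuousAt_snd.eventually (hU.mem_nhds (hTU hx))).mono fun p hp _ => hp
      · exact ((continuousAt_fst (p := (x, x))).eventually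
          (hT.isClosed.isOpen_compl.mem_nhds (show (x, x).1 ∈ Tᶜ from hx))).mono
          fun p hp h => absurd h hp)
  obtain ⟨N, hNη⟩ := exists_pow_lt_of_lt_one (show 0 < η / (4 * l) by positivity) hκ1
  obtain ⟨i, n, hn, hP1, hP2⟩ := exists_stableRel_preimages he hε hits (N + 1)
  have hκn : κ ^ n ≤ κ ^ N := pow_le_pow_of_le_one hκ0.le hκ1.le (by omega)
  have hκn1 : κ ^ n ≤ 1 := pow_le_one₀ hκ0.le hκ1.le
  have hηn : 4 * l * κ ^ n < η := by
    rw [lt_div_iff₀ (by positivity)] at hNη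
    nlinarith
  -- The holonomy correspondence: partners are images of stably related points of the two preimages
  -- of `T`. On `T` it is a bijection, and `hfib` identifies the partner of `π y` with `π (f^[n]
  -- y)`.
  let P : M → M → Prop := fun x x' =>
    ∃ p q, f^[i] p = x ∧ f^[i + n] q = x' ∧ StableRel e f lam l p q
  have hsurj : ∀ (k : ℕ) (x : M), ∃ p, f^[k] p = x := fun k => f.surjective.iterate k
  have hPex : ∀ x ∈ T, ∃ x' ∈ T, P x x' := by
    intro x hx
    obtain ⟨p, rfl⟩ := hsurj i x
    obtain ⟨q, hq, h⟩ := hP1 p hx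
    exact ⟨_, hq, p, q, rfl, rfl, h⟩
  have hPsurj : ∀ x' ∈ T, ∃ x ∈ T, P x x' := by
    intro x hx
    obtain ⟨p, rfl⟩ := hsurj (i + n) x
    obtain ⟨q, hq, h⟩ := hP2 p hx
    exact ⟨_, hq, q, p, rfl, rfl, h.symm⟩
  have hPinj : ∀ x ∈ T, ∀ y ∈ T, ∀ z, P x z → P y z → x = y := by
    rintro x hx y hy z ⟨p, q, rfl, rfl, h⟩ ⟨p', q', rfl, hq, h'⟩
    obtain rfl : q' = q := (f.injective.iterate (i + n)) hq
    exact hsep _ hx _ hy (((h.trans h0 hl.le hl.le h'.symm).iterate_le h0 hκ hκ1.le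
      (by positivity) i).mono h0 (by linarith))
  have hPrel : ∀ x x', P x x' → StableRel e f lam (l * κ ^ n) (f^[n] x) x' := by
    rintro x x' ⟨p, q, rfl, rfl, h⟩
    rw [← Function.iterate_add_apply, add_comm n i]
    refine (h.iterate h0 hκ (i + n)).mono h0 ?_
    have : κ ^ (i + n) ≤ κ ^ n := pow_le_pow_of_le_one hκ0.le hκ1.le (by omega)
    gcongr
  -- A point of the closure is replaced by a nearby point `y'` of `U`. The approximation, the fibre
  -- through `y'` and the holonomy each contribute at most `l * κ ^ n`, so the total stays below the
  -- collar width.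
  have htrap : ∀ y ∈ closure U, f^[n] y ∈ U := by
    intro y hy
    have hcont : Continuous fun y => e (f^[n] y) := he.comp (f.continuous.iterate n)
    have hnear : {y' | ‖e (f^[n] y) - e (f^[n] y')‖ < l * κ ^ n} ∈ 𝓝 y :=
      (isOpen_lt (by fun_prop) continuous_const).mem_nhds (by simp; positivity)
    obtain ⟨y', hy', hyU⟩ := mem_closure_iff_nhds.1 hy _ hnear
    obtain ⟨x', hx', hP⟩ := hPex _ (hπT y' hyU)
    have h1 := (hπ y' hyU).norm_iterate_le h0 hκ n
    have h2 := (hPrel _ _ hP).norm_iterate_le h0 hκ 0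
    have h3 := norm_sub_le_norm_sub_add_norm_sub (e x') (e (f^[n] (π y'))) (e (f^[n] y))
    have h4 := norm_sub_le_norm_sub_add_norm_sub (e (f^[n] (π y'))) (e (f^[n] y')) (e (f^[n] y))
    simp only [Function.iterate_zero, id, pow_zero, mul_one] at h2
    rw [norm_sub_rev] at h2
    rw [norm_sub_rev (e (f^[n] y'))] at h4
    change ‖e (f^[n] y) - e (f^[n] y')‖ < l * κ ^ n at hy'
    have h5 : l₀ * κ ^ n ≤ l * κ ^ n := by gcongr
    have h6 : 0 < l * κ ^ n := by positivity
    exact hηU x' _ (by linarith) hx'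
  have hπfix : ∀ x ∈ T, π x = x := fun x hx =>
    hsep _ (hπT x (hTU hx)) _ hx ((hπ x (hTU hx)).mono h0 (by linarith))
  set G : M → M := f^[n] with hG
  have hGU : ∀ y ∈ U, G y ∈ U := fun y hy => htrap y (subset_closure hy)
  have hGinj : Function.Injective G := f.injective.iterate n
  have hGcont : Continuous G := f.continuous.iterate n
  have hGk : ∀ k : ℕ, f^[k * n] = G^[k] := fun k => by rw [mul_comm, Function.iterate_mul]
  -- The chain `π (G y)`, `G y`, `G (π y)`, `x'` consists of stably related neighbours with total
  -- constant at most `3 * l`, and its two ends lie on `T`.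
  have hfib : ∀ y ∈ U, ∀ x' ∈ T, P (π y) x' → π (G y) = x' := by
    intro y hy x' hx' hP
    refine hsep _ (hπT _ (hGU y hy)) _ hx' ?_
    refine (((hπ _ (hGU y hy)).trans h0 hl₀ hl₀
      ((hπ y hy).iterate_le h0 hκ hκ1.le hl₀ n).symm).trans h0 (by positivity)
      (by positivity) (hPrel _ _ hP)).mono h0 ?_
    have : l * κ ^ n ≤ l := mul_le_of_le_one_right hl.le hκn1
    linarith
  have hGkU : ∀ (k : ℕ), ∀ y ∈ U, G^[k] y ∈ U := by
    intro k
    induction k with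
    | zero => exact fun y hy => hy
    | succ k ih => exact fun y hy => by rw [Function.iterate_succ_apply']; exact hGU _ (ih y hy)
  have hback : ∀ y ∈ U, ∀ y' ∈ U, π (G y) = π (G y') → π y = π y' := by
    intro y hy y' hy' h
    obtain ⟨x, hx, hP⟩ := hPex _ (hπT y hy)
    obtain ⟨x', hx', hP'⟩ := hPex _ (hπT y' hy')
    rw [hfib y hy x hx hP, hfib y' hy' x' hx' hP'] at h
    subst h
    exact hPinj _ (hπT y hy) _ (hπT y' hy') _ hP hP'
  have hforw : ∀ y ∈ U, ∀ y' ∈ U, π y = π y' → π (G y) = π (G y') := by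
    intro y hy y' hy' h
    obtain ⟨x, hx, hP⟩ := hPex _ (hπT y hy)
    rw [hfib y hy x hx hP, hfib y' hy' x hx (h ▸ hP)]
  have hbackk : ∀ k : ℕ, ∀ y ∈ U, ∀ y' ∈ U, π (G^[k] y) = π (G^[k] y') → π y = π y' := by
    intro k
    induction k with
    | zero => exact fun _ _ _ _ h => h
    | succ k ih =>
      intro y hy y' hy' h
      rw [Function.iterate_succ_apply', Function.iterate_succ_apply'] at h
      exact ih y hy y' hy' (hback _ (hGkU k y hy) _ (hGkU k y' hy') h)
  have hforwk : ∀ k : ℕ, ∀ y ∈ U, ∀ y' ∈ U, π y = π y' → π (G^[k] y) = π (G^[k] y') := by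
    intro k
    induction k with
    | zero => exact fun _ _ _ _ h => h
    | succ k ih =>
      intro y hy y' hy' h
      rw [Function.iterate_succ_apply', Function.iterate_succ_apply']
      exact hforw _ (hGkU k y hy) _ (hGkU k y' hy') (ih y hy y' hy' h)
  have hpre : ∀ k : ℕ, ∀ x ∈ T, ∃ z ∈ T, π (G^[k] z) = x := by
    intro k
    induction k with
    | zero => exact fun x hx => ⟨x, hx, hπfix x hx⟩
    | succ k ih =>
      intro x hx
      obtain ⟨w, hw, hwx⟩ := ih x hx
      obtain ⟨z, hz, hP⟩ := hPsurj w hw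
      refine ⟨z, hz, ?_⟩
      have h1 : π (G z) = w := hfib z (hTU hz) w hw (by rwa [hπfix z hz])
      rw [Function.iterate_succ_apply, ← hwx]
      exact hforwk k _ (hGU z (hTU hz)) _ (hTU hw) (by rw [h1, hπfix w hw])
  set T₀ : Set M := ⋂ k : ℕ, f^[k * n] '' U with hT₀
  simp only [hGk] at hT₀
  have hT₀mem : ∀ y, y ∈ T₀ ↔ ∀ k : ℕ, ∃ z ∈ U, G^[k] z = y := fun y => by
    rw [hT₀]; simp [mem_iInter]
  have hT₀U : T₀ ⊆ U := fun y hy => by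
    obtain ⟨z, hz, rfl⟩ := (hT₀mem y).1 hy 0
    exact hz
  -- The closure may replace `U` because one further step of `G` brings it back into `U`. This
  -- exhibits `T₀` as an intersection of compact sets.
  have hT₀cl : T₀ = ⋂ k : ℕ, G^[k] '' closure U := by
    ext y
    rw [hT₀mem, mem_iInter]
    refine ⟨fun h k => ?_, fun h k => ?_⟩
    · obtain ⟨z, hz, rfl⟩ := h k
      exact ⟨z, subset_closure hz, rfl⟩
    · obtain ⟨z, hz, rfl⟩ := h (k + 1)
      exact ⟨G z, htrap z hz, by rw [← Function.iterate_succ_apply]⟩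
  have hT₀comp : IsCompact T₀ := by
    refine IsClosed.isCompact ?_
    rw [hT₀cl]
    exact isClosed_iInter fun k =>
      (isClosed_closure.isCompact.image (hGcont.iterate k)).isClosed
  -- Preimages under `G^[k]` of two points of `T₀` on one fibre again share a fibre, because `G`
  -- separates fibres; contraction from there gives the bound for every `k`.
  have hπinj : ∀ y ∈ T₀, ∀ y' ∈ T₀, π y = π y' → y = y' := by
    intro y hy y' hy' h
    have hbd : ∀ k : ℕ, ‖e y - e y'‖ ≤ 2 * l * κ ^ k := by
      intro k
      obtain ⟨z, hz, rfl⟩ := (hT₀mem y).1 hy k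
      obtain ⟨z', hz', rfl⟩ := (hT₀mem y').1 hy' k
      have h1 := hbackk k z hz z' hz' h
      have h2 := ((hπ z hz).symm.trans h0 hl₀ hl₀ (h1 ▸ hπ z' hz')).norm_iterate_le h0 hκ (k * n)
      rw [hGk] at h2
      refine h2.trans ?_
      have : κ ^ (k * n) ≤ κ ^ k :=
        pow_le_pow_of_le_one hκ0.le hκ1.le (Nat.le_mul_of_pos_right _ (by omega))
      have h3 : 0 ≤ κ ^ (k * n) := by positivity
      nlinarith
    have hlim : Tendsto (fun k : ℕ => 2 * l * κ ^ k) atTop (𝓝 0) := by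
      simpa using (tendsto_pow_atTop_nhds_zero_of_lt_one hκ0.le hκ1).const_mul (2 * l)
    exact hinj (sub_eq_zero.1 (norm_le_zero_iff.1 (ge_of_tendsto' hlim hbd)))
  -- Choose `z k ∈ T` such that `G^[k] (z k)` lies on the fibre over `x`. A limit of these points
  -- lies in every image of the closure of `U`, and on the same fibre by continuity of `π`.
  have hπsurj : ∀ x ∈ T, ∃ y ∈ T₀, π y = x := by
    intro x hx
    choose z hzT hz using fun k => hpre k x hx
    let 𝒰 : Ultrafilter ℕ := hyperfilter ℕ
    obtain ⟨y, -, hy⟩ := isCompact_univ.ultrafilter_le_nhds (𝒰.map fun k => G^[k] (z k))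
      (by simp)
    have hy' : Tendsto (fun k => G^[k] (z k)) 𝒰 (𝓝 y) := hy
    have hyT₀ : y ∈ T₀ := by
      rw [hT₀cl, mem_iInter]
      intro m
      have hcl : IsClosed (G^[m] '' closure U) :=
        (isClosed_closure.isCompact.image (hGcont.iterate m)).isClosed
      refine hcl.mem_of_tendsto hy' ?_
      have : ∀ᶠ k : ℕ in (𝒰 : Filter ℕ), m ≤ k :=
        (Nat.hyperfilter_le_atTop) (eventually_ge_atTop m)
      filter_upwards [this] with k hk
      obtain ⟨d, rfl⟩ := Nat.exists_eq_add_of_le hk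
      rw [Function.iterate_add_apply]
      exact mem_image_of_mem _ (subset_closure (hGkU d _ (hTU (hzT _))))
    refine ⟨y, hyT₀, ?_⟩
    have hc : Tendsto (fun k => π (G^[k] (z k))) 𝒰 (𝓝 (π y)) :=
      ((hπc.continuousAt (hU.mem_nhds (hT₀U hyT₀))).tendsto.comp hy')
    simp only [hz] at hc
    exact tendsto_nhds_unique hc tendsto_const_nhds
  refine ⟨n, by omega, ?_, T₀, rfl, ?_, ?_, hT₀comp, ?_, ?_⟩
  · rintro _ ⟨y, hy, rfl⟩
    exact htrap y hy
  · have : CompactSpace T₀ := isCompact_iff_compactSpace.1 hT₀comp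
    let φ : T₀ ≃ T := Equiv.ofBijective (fun y => ⟨π y, hπT y (hT₀U y.2)⟩)
      ⟨fun y y' h => Subtype.ext (hπinj _ y.2 _ y'.2 (congrArg Subtype.val h)), fun x => by
        obtain ⟨y, hy, h⟩ := hπsurj x x.2
        exact ⟨⟨y, hy⟩, Subtype.ext h⟩⟩
    have hφ : Continuous φ :=
      ((hπc.mono hT₀U).domRestrict).subtype_mk _
    exact ⟨hφ.homeoOfEquivCompactToT2⟩
  · ext y
    constructor
    · rintro ⟨z, hz, rfl⟩
      refine (hT₀mem _).2 fun k => ?_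
      obtain ⟨w, hw, rfl⟩ := (hT₀mem z).1 hz k
      exact ⟨G w, hGU w hw, by rw [← Function.iterate_succ_apply, Function.iterate_succ_apply']⟩
    · intro hy
      obtain ⟨z, hz, rfl⟩ := (hT₀mem y).1 hy 1
      refine ⟨z, (hT₀mem z).2 fun k => ?_, rfl⟩
      obtain ⟨w, hw, h⟩ := (hT₀mem _).1 hy (k + 1)
      refine ⟨w, hw, hGinj ?_⟩
      rw [← Function.iterate_succ_apply' G]
      exact h
  · intro y hy y' hy' h
    refine hπinj y hy y' hy' (hsep _ (hπT y (hT₀U hy)) _ (hπT y' (hT₀U hy')) ?_)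
    exact (((hπ y (hT₀U hy)).trans h0 hl₀ hl.le h).trans h0 (by positivity) hl₀
      (hπ y' (hT₀U hy')).symm).mono h0 (by linarith)
  · intro y hy k
    obtain ⟨z, hz, rfl⟩ := (hT₀mem y).1 hy k
    refine ⟨π z, hπT z hz, ?_⟩
    have h2 := (hπ z hz).norm_iterate_le h0 hκ (k * n)
    rw [hGk] at h2 ⊢
    refine h2.trans ?_
    have : κ ^ (k * n) ≤ κ ^ k :=
      pow_le_pow_of_le_one hκ0.le hκ1.le (Nat.le_mul_of_pos_right _ (by omega))
    gcongr

end Attractor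

/-! ### Euler chains, limits of solutions and a viability theorem -/

section Peano

open Metric

variable {E : Type*} [NormedAddCommGroup E] [NormedSpace ℝ E]

/-- The curve `c` solves `c' = X c` on `[a, b]` and stays in `B`. -/
def IsSolutionOn (X : E → E) (B : Set E) (c : ℝ → E) (a b : ℝ) : Prop :=
  ∀ t ∈ Icc a b, c t ∈ B ∧ HasDerivWithinAt c (X (c t)) (Icc a b) t

/-- The curve `c` solves `c' = X c` up to errors that are uniformly small over short times. -/
lemma hasDerivWithinAt_of_euler_estimate {X : E → E} {c : ℝ → E} {a b C : ℝ}
    {B : Set E} (hX : UniformContinuousOn X B) (hC : ∀ p ∈ B, ‖X p‖ ≤ C)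
    (hcB : ∀ t ∈ Icc a b, c t ∈ B)
    (h : ∀ η > 0, ∃ d > 0, ∀ s ∈ Icc a b, ∀ t ∈ Icc a b, s ≤ t → t - s < d →
      ‖c t - c s - (t - s) • X (c s)‖ ≤ η * (t - s)) :
    IsSolutionOn X B c a b := by
  refine fun t ht => ⟨hcB t ht, ?_⟩
  have hC0 : 0 ≤ C := (norm_nonneg _).trans (hC _ (hcB t ht))
  rw [hasDerivWithinAt_iff_isLittleO]
  refine Asymptotics.IsLittleO.of_bound fun η hη => ?_
  obtain ⟨d₁, hd₁, h₁⟩ := h (η / 2) (by positivity)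
  obtain ⟨d₂, hd₂, h₂⟩ := h 1 one_pos
  obtain ⟨d₃, hd₃, h₃⟩ := Metric.uniformContinuousOn_iff.1 hX (η / 2) (by positivity)
  have hd : 0 < min (min d₁ d₂) (d₃ / (C + 2)) := by positivity
  filter_upwards [self_mem_nhdsWithin, mem_nhdsWithin_of_mem_nhds (Metric.ball_mem_nhds t hd)]
    with u hu hut
  rw [Metric.mem_ball, Real.dist_eq, lt_min_iff, lt_min_iff] at hut
  obtain ⟨⟨hu₁, hu₂⟩, hu₃⟩ := hut
  rw [lt_div_iff₀ (by positivity)] at hu₃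
  rcases le_total t u with htu | htu
  · rw [abs_of_nonneg (by linarith)] at hu₁
    rw [Real.norm_eq_abs, abs_of_nonneg (by linarith : 0 ≤ u - t)]
    refine (h₁ t ht u hu htu hu₁).trans ?_
    nlinarith
  -- For backward increments the estimate is based at the earlier time `u`, so `X (c u)` has to be
  -- compared with `X (c t)`; the bounds `d₂` and `d₃` serve this purpose.
  · rw [abs_sub_comm, abs_of_nonneg (by linarith)] at hu₁ hu₂ hu₃
    have e1 := h₁ u hu t ht htu hu₁
    have e2 := h₂ u hu t ht htu hu₂
    have e3 : ‖c t - c u‖ < d₃ := by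
      calc ‖c t - c u‖ = ‖(c t - c u - (t - u) • X (c u)) + (t - u) • X (c u)‖ := by simp
        _ ≤ 1 * (t - u) + (t - u) * C := by
          refine (norm_add_le _ _).trans (add_le_add e2 ?_)
          rw [norm_smul, Real.norm_eq_abs, abs_of_nonneg (by linarith : 0 ≤ t - u)]
          exact mul_le_mul_of_nonneg_left (hC _ (hcB u hu)) (by linarith)
        _ < d₃ := by nlinarith
    have e4 := h₃ (c t) (hcB t ht) (c u) (hcB u hu) (by rwa [dist_eq_norm])
    rw [dist_eq_norm] at e4
    rw [Real.norm_eq_abs, abs_sub_comm, abs_of_nonneg (by linarith : 0 ≤ t - u)]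
    calc ‖c u - c t - (u - t) • X (c t)‖
        = ‖-(c t - c u - (t - u) • X (c u)) + (t - u) • (X (c t) - X (c u))‖ := by
          congr 1; module
      _ ≤ η / 2 * (t - u) + (t - u) * (η / 2) := by
          refine (norm_add_le _ _).trans (add_le_add (by rwa [norm_neg]) ?_)
          rw [norm_smul, Real.norm_eq_abs, abs_of_nonneg (by linarith : 0 ≤ t - u)]
          exact mul_le_mul_of_nonneg_left e4.le (by linarith)
      _ = η * (t - u) := by ring

lemma IsSolutionOn.continuousOn {X : E → E} {B : Set E} {c : ℝ → E} {a b : ℝ}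
    (h : IsSolutionOn X B c a b) : ContinuousOn c (Icc a b) :=
  fun t ht => (h t ht).2.continuousWithinAt

lemma IsSolutionOn.mono {X : E → E} {B : Set E} {c : ℝ → E} {a b a' b' : ℝ}
    (h : IsSolutionOn X B c a b) (ha : a ≤ a') (hb : b' ≤ b) : IsSolutionOn X B c a' b' :=
  fun t ht => ⟨(h t ⟨ha.trans ht.1, ht.2.trans hb⟩).1,
    (h t ⟨ha.trans ht.1, ht.2.trans hb⟩).2.mono (Icc_subset_Icc ha hb)⟩

lemma IsSolutionOn.norm_sub_le {X : E → E} {B : Set E} {c : ℝ → E} {a b C : ℝ}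
    (h : IsSolutionOn X B c a b) (hC : ∀ p ∈ B, ‖X p‖ ≤ C) {s t : ℝ} (hs : s ∈ Icc a b)
    (ht : t ∈ Icc a b) : ‖c t - c s‖ ≤ C * |t - s| :=
  (convex_Icc a b).norm_image_sub_le_of_norm_hasDerivWithin_le
    (fun u hu => (h u hu).2) (fun u hu => hC _ (h u hu).1) hs ht

/-- The time scale `d` depends on the field and on `η` but not on the solution. This uniformity lets
the estimate pass to pointwise limits of solutions. -/
lemma IsSolutionOn.euler_estimate {X : E → E} {B : Set E} {C : ℝ}
    (hX : UniformContinuousOn X B) (hC : ∀ p ∈ B, ‖X p‖ ≤ C) {η : ℝ} (hη : 0 < η) :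
    ∃ d > 0, ∀ c : ℝ → E, ∀ a b : ℝ, IsSolutionOn X B c a b →
      ∀ s ∈ Icc a b, ∀ t ∈ Icc a b, s ≤ t → t - s < d →
        ‖c t - c s - (t - s) • X (c s)‖ ≤ η * (t - s) := by
  obtain ⟨d₃, hd₃, h₃⟩ := Metric.uniformContinuousOn_iff.1 hX η hη
  refine ⟨d₃ / (|C| + 1), by positivity, fun c a b hc s hs t ht hst hd => ?_⟩
  rw [lt_div_iff₀ (by positivity)] at hd
  have hsub : Icc s t ⊆ Icc a b := Icc_subset_Icc hs.1 ht.2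
  have key := norm_image_sub_le_of_norm_deriv_le_segment'
    (f := fun u => c u - (u - s) • X (c s)) (f' := fun u => X (c u) - X (c s))
    (a := s) (b := t) (C := η) (fun u hu => by
      have h1 := (hc u (hsub hu)).2.mono hsub
      have h2 : HasDerivWithinAt (fun u : ℝ => (u - s) • X (c s)) ((1 : ℝ) • X (c s))
          (Icc s t) u := ((hasDerivWithinAt_id u _).sub_const s).smul_const _
      rw [one_smul] at h2
      exact h1.sub h2)
    (fun u hu => by
      have hu' : u ∈ Icc s t := ⟨hu.1, hu.2.le⟩
      have h1 := hc.norm_sub_le hC hs (hsub hu')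
      have h2 := h₃ (c u) (hc u (hsub hu')).1 (c s) (hc s hs).1 (by
        rw [dist_eq_norm]
        refine h1.trans_lt ?_
        rw [abs_of_nonneg (by linarith [hu.1])]
        have : C * (u - s) ≤ |C| * (t - s) :=
          mul_le_mul (le_abs_self C) (by linarith [hu.2]) (by linarith [hu.1]) (abs_nonneg C)
        nlinarith)
      rw [dist_eq_norm] at h2
      exact h2.le) t ⟨hst, le_rfl⟩
  simpa [sub_right_comm] using key

/-- A limit of solutions is a solution. -/
lemma IsSolutionOn.of_tendsto {ι : Type*} {X : E → E} {B : Set E} (hB : IsCompact B)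
    (hX : ContinuousOn X B) {u : Filter ι} [u.NeBot] {c : ι → ℝ → E} {c₀ : ℝ → E} {a b : ℝ}
    (hc : ∀ᶠ i in u, IsSolutionOn X B (c i) a b)
    (hlim : ∀ t ∈ Icc a b, Tendsto (fun i => c i t) u (𝓝 (c₀ t))) :
    IsSolutionOn X B c₀ a b := by
  obtain ⟨C, hC⟩ := hB.exists_bound_of_continuousOn hX
  have hXu := hB.uniformContinuousOn_of_continuous hX
  have hmem : ∀ t ∈ Icc a b, c₀ t ∈ B := fun t ht =>
    hB.isClosed.mem_of_tendsto (hlim t ht) (hc.mono fun i hi => (hi t ht).1)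
  refine hasDerivWithinAt_of_euler_estimate hXu hC hmem fun η hη => ?_
  obtain ⟨d, hd, h⟩ := IsSolutionOn.euler_estimate hXu hC hη
  refine ⟨d, hd, fun s hs t ht hst hsd => ?_⟩
  have hXs : Tendsto (fun i => X (c i s)) u (𝓝 (X (c₀ s))) :=
    (hX _ (hmem s hs)).tendsto.comp (tendsto_nhdsWithin_iff.2
      ⟨hlim s hs, hc.mono fun i hi => (hi s hs).1⟩)
  exact le_of_tendsto (((hlim t ht).sub (hlim s hs)).sub (hXs.const_smul (t - s))).norm
    (hc.mono fun i hi => h (c i) a b hi s hs t ht hst hsd)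

/-- With relative error at most one, a chain moves at speed at most `C + 1`, so it cannot leave the
ball before time `T`. -/
lemma exists_euler_chain {K : Set E} {X : E → E} {p₀ : E} {R C T h η : ℝ}
    (hR : 0 ≤ R) (hXC : ∀ p ∈ closedBall p₀ R, ‖X p‖ ≤ C) (hh : 0 < h) (hη : η ≤ 1)
    (hstep : ∀ p ∈ K ∩ closedBall p₀ R, ∃ p' ∈ K, ‖p' - p - h • X p‖ ≤ η * h)
    (hp₀ : p₀ ∈ K) (hT : T * (C + 1) ≤ R) :
    ∃ p : ℕ → E, p 0 = p₀ ∧ (∀ i : ℕ, i * h ≤ T → p i ∈ K ∩ closedBall p₀ R) ∧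
      ∀ i : ℕ, i * h ≤ T → ‖p (i + 1) - p i - h • X (p i)‖ ≤ η * h := by
  classical
  choose! next hnext using hstep
  let p : ℕ → E := fun i => next^[i] p₀
  have hps : ∀ i, p (i + 1) = next (p i) := fun i => Function.iterate_succ_apply' _ _ _
  have hC0 : 0 ≤ C := (norm_nonneg _).trans (hXC p₀ (mem_closedBall_self hR))
  have key : ∀ i : ℕ, i * h ≤ T → p i ∈ K ∧ ‖p i - p₀‖ ≤ i * h * (C + 1) := by
    intro i
    induction i with
    | zero => intro _; simpa [p] using hp₀
    | succ i ih =>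
      intro hi
      push_cast at hi ⊢
      obtain ⟨h1, h2⟩ := ih (by nlinarith)
      have h3 : p i ∈ K ∩ closedBall p₀ R := ⟨h1, by
        rw [mem_closedBall, dist_eq_norm]
        refine h2.trans (le_trans ?_ hT)
        have : (i : ℝ) * h ≤ T := by nlinarith
        gcongr⟩
      obtain ⟨h4, h5⟩ := hnext _ h3
      rw [hps]
      refine ⟨h4, ?_⟩
      calc ‖next (p i) - p₀‖ = ‖(next (p i) - p i - h • X (p i)) + h • X (p i) + (p i - p₀)‖ := by
            congr 1; abel
        _ ≤ η * h + h * C + i * h * (C + 1) := by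
            refine (norm_add_le _ _).trans (add_le_add ((norm_add_le _ _).trans
              (add_le_add h5 ?_)) h2)
            rw [norm_smul, Real.norm_eq_abs, abs_of_pos hh]
            exact mul_le_mul_of_nonneg_left (hXC _ h3.2) hh.le
        _ ≤ (i + 1) * h * (C + 1) := by nlinarith
  have hmem : ∀ i : ℕ, i * h ≤ T → p i ∈ K ∩ closedBall p₀ R := fun i hi =>
    ⟨(key i hi).1, by
      rw [mem_closedBall, dist_eq_norm]
      refine (key i hi).2.trans (le_trans ?_ hT)
      gcongr⟩
  exact ⟨p, rfl, hmem, fun i hi => by rw [hps]; exact (hnext _ (hmem i hi)).2⟩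

/-- Discrete counterpart of `IsSolutionOn.euler_estimate`: while the chain stays within `d` of `p
i`, each step deviates from `h • X (p i)` by the step error plus the oscillation `η'` of the field.
-/
lemma euler_chain_estimate {X : E → E} {p : ℕ → E} {B : Set E} {C h η η' d : ℝ} {k : ℕ}
    (hXC : ∀ q ∈ B, ‖X q‖ ≤ C) (hh : 0 < h) (hη : η ≤ 1) (hB : ∀ i ≤ k, p i ∈ B)
    (hp : ∀ i < k, ‖p (i + 1) - p i - h • X (p i)‖ ≤ η * h)
    (hX : ∀ q ∈ B, ∀ q' ∈ B, dist q q' < d → dist (X q) (X q') < η') {i : ℕ} (hik : i ≤ k)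
    (hd : (k - i) * h * (C + 1) < d) :
    ‖p k - p i - ((k - i) * h) • X (p i)‖ ≤ (k - i) * h * (η + η') := by
  have hC0 : 0 ≤ C := (norm_nonneg _).trans (hXC (p k) (hB k le_rfl))
  have key : ∀ j : ℕ, i + j ≤ k → ‖p (i + j) - p i‖ ≤ j * h * (C + 1) ∧
      ‖p (i + j) - p i - (j * h) • X (p i)‖ ≤ j * h * (η + η') := by
    intro j
    induction j with
    | zero => intro _; simp
    | succ j ih =>
      intro hj
      obtain ⟨h1, h2⟩ := ih (by omega)
      have h3 := hp (i + j) (by omega)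
      have hBj := hB (i + j) (by omega)
      have h4 : ‖p (i + j) - p i‖ < d := by
        refine h1.trans_lt (lt_of_le_of_lt ?_ hd)
        have : (j : ℝ) ≤ k - i := by
          rw [le_sub_iff_add_le]; exact_mod_cast (by omega : j + i ≤ k)
        gcongr
      have h5 := hX _ hBj _ (hB i hik) (by rwa [dist_eq_norm])
      rw [dist_eq_norm] at h5
      rw [← add_assoc]
      push_cast
      constructor
      · calc ‖p (i + j + 1) - p i‖
            = ‖(p (i + j + 1) - p (i + j) - h • X (p (i + j))) + h • X (p (i + j)) +
                (p (i + j) - p i)‖ := by congr 1; abel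
          _ ≤ η * h + h * C + j * h * (C + 1) := by
            refine (norm_add_le _ _).trans (add_le_add ((norm_add_le _ _).trans
              (add_le_add h3 ?_)) h1)
            rw [norm_smul, Real.norm_eq_abs, abs_of_pos hh]
            exact mul_le_mul_of_nonneg_left (hXC _ hBj) hh.le
          _ ≤ (j + 1) * h * (C + 1) := by nlinarith
      · calc ‖p (i + j + 1) - p i - ((j + 1) * h) • X (p i)‖
            = ‖(p (i + j + 1) - p (i + j) - h • X (p (i + j))) +
                h • (X (p (i + j)) - X (p i)) + (p (i + j) - p i - (j * h) • X (p i))‖ := by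
              congr 1; module
          _ ≤ η * h + h * η' + j * h * (η + η') := by
            refine (norm_add_le _ _).trans (add_le_add ((norm_add_le _ _).trans
              (add_le_add h3 ?_)) h2)
            rw [norm_smul, Real.norm_eq_abs, abs_of_pos hh]
            exact mul_le_mul_of_nonneg_left h5.le hh.le
          _ = (j + 1) * h * (η + η') := by ring
  have := (key (k - i) (by omega)).2
  rw [Nat.add_sub_cancel' hik, Nat.cast_sub hik] at this
  exact this

/-- A viability theorem: if the closed set `K` contains approximate Euler steps for the
continuous field `X`, then it contains solutions of `c' = X c`. -/
theorem exists_viable_solution [ProperSpace E] {K : Set E} (hK : IsClosed K) {X : E → E} {p₀ : E}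
    {R C T : ℝ} (hR : 0 ≤ R) (hX : ContinuousOn X (closedBall p₀ R))
    (hXC : ∀ p ∈ closedBall p₀ R, ‖X p‖ ≤ C)
    (hstep : ∀ η > 0, ∃ ρ > 0, ∀ p ∈ K ∩ closedBall p₀ R, ∀ t, 0 < t → t ≤ ρ →
      ∃ p' ∈ K, ‖p' - p - t • X p‖ ≤ η * t)
    (hp₀ : p₀ ∈ K) (hT0 : 0 ≤ T) (hT : T * (C + 1) ≤ R) :
    ∃ c : ℝ → E, c 0 = p₀ ∧ IsSolutionOn X (K ∩ closedBall p₀ R) c 0 T := by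
  set B := K ∩ closedBall p₀ R with hBdef
  have hBc : IsCompact B := (isCompact_closedBall p₀ R).inter_left hK
  have hXB : ContinuousOn X B := hX.mono inter_subset_right
  have hCB : ∀ p ∈ B, ‖X p‖ ≤ C := fun p hp => hXC p hp.2
  have hXu := hBc.uniformContinuousOn_of_continuous hXB
  choose ρ hρ0 hρ using fun m : ℕ => hstep (1 / ((m : ℝ) + 1)) (by positivity)
  let h : ℕ → ℝ := fun m => min (ρ m) (1 / ((m : ℝ) + 1))
  have hh : ∀ m, 0 < h m := fun m => lt_min (hρ0 m) (by positivity)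
  have hη1 : ∀ m : ℕ, 1 / ((m : ℝ) + 1) ≤ 1 := fun m => by
    rw [div_le_one (by positivity)]; linarith [(Nat.cast_nonneg m : (0 : ℝ) ≤ m)]
  choose p hp0 hpB hpE using fun m : ℕ => exists_euler_chain (T := T) hR hXC (hh m) (hη1 m)
    (fun q hq => hρ m q hq (h m) (hh m) (min_le_left _ _)) hp₀ hT
  let k : ℕ → ℝ → ℕ := fun m t => ⌊t / h m⌋₊
  have hkle : ∀ m, ∀ t, 0 ≤ t → k m t * h m ≤ t := fun m t ht => by
    rw [← le_div_iff₀ (hh m)]; exact Nat.floor_le (by have := hh m; positivity)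
  have hklt : ∀ m, ∀ t, t < k m t * h m + h m := fun m t => by
    have := Nat.lt_floor_add_one (t / h m)
    rw [div_lt_iff₀ (hh m), add_mul, one_mul] at this
    exact this
  -- The limit of the step functions is taken pointwise along an ultrafilter, using compactness of
  -- `B`. No equicontinuity argument is needed, since the chain estimate itself passes to the limit.
  let 𝒰 : Ultrafilter ℕ := hyperfilter ℕ
  have h𝒰 : (𝒰 : Filter ℕ) ≤ atTop := Nat.hyperfilter_le_atTop
  have hη : Tendsto (fun m : ℕ => 1 / ((m : ℝ) + 1)) 𝒰 (𝓝 0) :=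
    tendsto_one_div_add_atTop_nhds_zero_nat.mono_left h𝒰
  have hh0 : Tendsto h 𝒰 (𝓝 0) :=
    squeeze_zero (fun m => (hh m).le) (fun m => min_le_right _ _) hη
  have hkt : ∀ t, 0 ≤ t → Tendsto (fun m => k m t * h m) 𝒰 (𝓝 t) := fun t ht => by
    have h1 : Tendsto (fun m => t - h m) 𝒰 (𝓝 t) := by simpa using hh0.const_sub t
    exact tendsto_of_tendsto_of_tendsto_of_le_of_le h1 tendsto_const_nhds
      (fun m => by linarith [hklt m t]) (fun m => hkle m t ht)
  have hmem : ∀ m, ∀ t ∈ Icc 0 T, p m (k m t) ∈ B := fun m t ht =>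
    hpB m _ ((hkle m t ht.1).trans ht.2)
  have hlim : ∀ t : ℝ, ∃ q, t ∈ Icc 0 T → Tendsto (fun m => p m (k m t)) 𝒰 (𝓝 q) := by
    intro t
    by_cases ht : t ∈ Icc 0 T
    · obtain ⟨q, -, hq⟩ := hBc.ultrafilter_le_nhds (𝒰.map fun m => p m (k m t))
        (by
          rw [Ultrafilter.coe_map, le_principal_iff, mem_map]
          exact Filter.univ_mem' fun m => hmem m t ht)
      exact ⟨q, fun _ => hq⟩
    · exact ⟨0, fun h => absurd h ht⟩
  choose c hc using hlim
  have hcB : ∀ t ∈ Icc 0 T, c t ∈ B := fun t ht =>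
    hBc.isClosed.mem_of_tendsto (hc t ht) (Eventually.of_forall fun m => hmem m t ht)
  refine ⟨c, ?_, hasDerivWithinAt_of_euler_estimate hXu hCB hcB fun η' hη' => ?_⟩
  · refine tendsto_nhds_unique (hc 0 ⟨le_rfl, hT0⟩) ?_
    simp [k, hp0]
  · obtain ⟨d, hd, hXd⟩ := Metric.uniformContinuousOn_iff.1 hXu η' hη'
    have hC0 : 0 ≤ C := (norm_nonneg _).trans (hCB _ (hcB 0 ⟨le_rfl, hT0⟩))
    refine ⟨d / (C + 1), by positivity, fun s hs t ht hst hsd => ?_⟩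
    rw [lt_div_iff₀ (by positivity)] at hsd
    have hdiff : Tendsto (fun m => ((k m t : ℝ) - k m s) * h m) 𝒰 (𝓝 (t - s)) := by
      simpa [sub_mul] using (hkt t ht.1).sub (hkt s hs.1)
    have hev : ∀ᶠ m in (𝒰 : Filter ℕ), ((k m t : ℝ) - k m s) * h m * (C + 1) < d :=
      (hdiff.mul_const (C + 1)).eventually_lt_const hsd
    have hXs : Tendsto (fun m => X (p m (k m s))) 𝒰 (𝓝 (X (c s))) :=
      (hXB _ (hcB s hs)).tendsto.comp (tendsto_nhdsWithin_iff.2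
        ⟨hc s hs, Eventually.of_forall fun m => hmem m s hs⟩)
    have hL := (((hc t ht).sub (hc s hs)).sub (hdiff.smul hXs)).norm
    have hRt : Tendsto (fun m : ℕ => ((k m t : ℝ) - k m s) * h m * (1 / ((m : ℝ) + 1) + η')) 𝒰
        (𝓝 ((t - s) * (0 + η'))) := hdiff.mul (hη.add_const η')
    rw [zero_add, mul_comm] at hRt
    refine le_of_tendsto_of_tendsto hL hRt (hev.mono fun m hm => ?_)
    have hkT : ∀ i ≤ k m t, (i : ℝ) * h m ≤ T := fun i hi => by
      refine le_trans ?_ ((hkle m t ht.1).trans ht.2)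
      have := (hh m).le
      gcongr
    exact euler_chain_estimate hCB (hh m) (hη1 m) (fun i hi => hpB m i (hkT i hi))
      (fun i hi => hpE m i (hkT i hi.le)) hXd
      (Nat.floor_le_floor (by have := hh m; gcongr)) hm

end Peano

/-! ### Operations on solutions and uniqueness by separation -/

section SolutionCalculus

open Metric

variable {E : Type*} [NormedAddCommGroup E] [NormedSpace ℝ E] {X : E → E} {B : Set E}
  {c c' : ℝ → E} {a b : ℝ}

lemma IsSolutionOn.mono_set {B' : Set E} (h : IsSolutionOn X B c a b) (hB : B ⊆ B') :
    IsSolutionOn X B' c a b := fun t ht => ⟨hB (h t ht).1, (h t ht).2⟩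

lemma IsSolutionOn.congr (h : IsSolutionOn X B c a b) (hc : EqOn c' c (Icc a b)) :
    IsSolutionOn X B c' a b := fun t ht => by
  rw [hc ht]
  exact ⟨(h t ht).1, (h t ht).2.congr hc (hc ht)⟩

lemma IsSolutionOn.comp_neg (h : IsSolutionOn X B c a b) :
    IsSolutionOn (fun p => -X p) B (fun t => c (-t)) (-b) (-a) := fun t ht => by
  have ht' : -t ∈ Icc a b := ⟨by linarith [ht.2], by linarith [ht.1]⟩
  refine ⟨(h _ ht').1, ?_⟩
  have := HasDerivWithinAt.scomp (h := fun t : ℝ => -t) (h' := -1) t (h _ ht').2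
    ((hasDerivAt_neg t).hasDerivWithinAt (s := Icc (-b) (-a)))
    (fun s hs => ⟨by linarith [hs.2], by linarith [hs.1]⟩)
  simpa [Function.comp_def] using this

lemma IsSolutionOn.comp_add (h : IsSolutionOn X B c a b) (s : ℝ) :
    IsSolutionOn X B (fun t => c (t + s)) (a - s) (b - s) := fun t ht => by
  have ht' : t + s ∈ Icc a b := ⟨by linarith [ht.1], by linarith [ht.2]⟩
  refine ⟨(h _ ht').1, ?_⟩
  have := HasDerivWithinAt.scomp (h := fun t : ℝ => t + s) (h' := 1) t (h _ ht').2
    (((hasDerivAt_id t).add_const s).hasDerivWithinAt (s := Icc (a - s) (b - s)))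
    (fun u hu => ⟨by linarith [hu.1], by linarith [hu.2]⟩)
  simpa [Function.comp_def] using this

lemma IsSolutionOn.union {m : ℝ} (h : IsSolutionOn X B c a m) (h' : IsSolutionOn X B c m b)
    (ham : a ≤ m) (hmb : m ≤ b) : IsSolutionOn X B c a b := by
  intro t ht
  rcases lt_trichotomy t m with htm | rfl | htm
  · obtain ⟨h1, h2⟩ := h t ⟨ht.1, htm.le⟩
    refine ⟨h1, h2.mono_of_mem_nhdsWithin ?_⟩
    filter_upwards [self_mem_nhdsWithin, mem_nhdsWithin_of_mem_nhds (Iio_mem_nhds htm)] with s hs hsm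
    exact ⟨hs.1, le_of_lt hsm⟩
  · refine ⟨(h t ⟨ham, le_rfl⟩).1, ?_⟩
    rw [← Icc_union_Icc_eq_Icc ham hmb]
    exact (h t ⟨ham, le_rfl⟩).2.union (h' t ⟨le_rfl, hmb⟩).2
  · obtain ⟨h1, h2⟩ := h' t ⟨htm.le, ht.2⟩
    refine ⟨h1, h2.mono_of_mem_nhdsWithin ?_⟩
    filter_upwards [self_mem_nhdsWithin, mem_nhdsWithin_of_mem_nhds (Ioi_mem_nhds htm)] with s hs hsm
    exact ⟨le_of_lt hsm, hs.2⟩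

/-- Solutions climb in the height `ℓ` at a definite rate. This is the source of injectivity in time
and of the contradictions for curves returning to the same point. -/
lemma IsSolutionOn.lower_bound {ℓ : E →L[ℝ] ℝ} {m : ℝ} (h : IsSolutionOn X B c a b)
    (hℓ : ∀ p ∈ B, m ≤ ℓ (X p)) {s t : ℝ} (hs : s ∈ Icc a b) (ht : t ∈ Icc a b) (hst : s ≤ t) :
    m * (t - s) ≤ ℓ (c t) - ℓ (c s) := by
  have h1 : Icc s t ⊆ Icc a b := Icc_subset_Icc hs.1 ht.2
  have hd : ∀ u ∈ Icc a b, HasDerivWithinAt (fun u => ℓ (c u)) (ℓ (X (c u))) (Icc a b) u :=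
    fun u hu => ℓ.hasFDerivAt.comp_hasDerivWithinAt u (h u hu).2
  have key := image_le_of_deriv_right_le_deriv_boundary (f := fun u => m * (u - s))
    (f' := fun _ => m) (B := fun u => ℓ (c u) - ℓ (c s)) (B' := fun u => ℓ (X (c u)))
    (a := s) (b := t) (by fun_prop)
    (fun u _ => by simpa using (((hasDerivAt_id u).sub_const s).const_mul m).hasDerivWithinAt)
    (by simp)
    (((ℓ.continuous.comp_continuousOn h.continuousOn).mono h1).sub continuousOn_const)
    (fun u hu => by
      refine ((hd u (h1 ⟨hu.1, hu.2.le⟩)).mono_of_mem_nhdsWithin ?_).sub_const _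
      exact mem_of_superset (Icc_mem_nhdsGE_of_mem hu) h1)
    (fun u hu => hℓ _ (h u (h1 ⟨hu.1, hu.2.le⟩)).1)
  exact key ⟨hst, le_rfl⟩

/-- Speed up `c'` by the factor `1 + ν`. At a time when the heights agree the points agree by
`hsep`, so both curves see the same field vector and the faster one climbs strictly faster; hence it
is never overtaken. Then `ν` tends to zero. Continuity of the field suffices, without a Lipschitz
bound. -/
lemma IsSolutionOn.le_of_separated {ℓ : E →L[ℝ] ℝ} (h : IsSolutionOn X B c 0 b)
    (h' : IsSolutionOn X B c' 0 b) (hℓ : ∀ p ∈ B, 0 < ℓ (X p)) (h0 : c 0 = c' 0)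
    (hsep : ∀ s ∈ Icc 0 b, ∀ t ∈ Icc 0 b, ℓ (c s) = ℓ (c' t) → c s = c' t) {t : ℝ}
    (ht : t ∈ Ico 0 b) : ℓ (c t) ≤ ℓ (c' t) := by
  have hder : ∀ {γ : ℝ → E}, IsSolutionOn X B γ 0 b → ∀ u ∈ Ico 0 b,
      HasDerivWithinAt (fun u => ℓ (γ u)) (ℓ (X (γ u))) (Ici u) u := fun hγ u hu =>
    (ℓ.hasFDerivAt.comp_hasDerivWithinAt u (hγ u ⟨hu.1, hu.2.le⟩).2).mono_of_mem_nhdsWithin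
      (Icc_mem_nhdsGE_of_mem hu)
  have hcont : ∀ {γ : ℝ → E}, IsSolutionOn X B γ 0 b →
      ContinuousOn (fun u => ℓ (γ u)) (Icc 0 b) := fun hγ =>
    ℓ.continuous.comp_continuousOn hγ.continuousOn
  have key : ∀ ν > 0, (1 + ν) * t < b → ℓ (c t) ≤ ℓ (c' ((1 + ν) * t)) := by
    intro ν hν hνt
    have hmaps : MapsTo (fun u => (1 + ν) * u) (Icc 0 t) (Icc 0 b) := fun u hu =>
      ⟨mul_nonneg (by linarith) hu.1, by nlinarith [hu.2]⟩
    refine image_le_of_deriv_right_lt_deriv_boundary' (f := fun u => ℓ (c u))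
      (f' := fun u => ℓ (X (c u))) (B := fun u => ℓ (c' ((1 + ν) * u)))
      (B' := fun u => (1 + ν) * ℓ (X (c' ((1 + ν) * u)))) (a := 0) (b := t)
      ((hcont h).mono (Icc_subset_Icc le_rfl ht.2.le))
      (fun u hu => hder h u ⟨hu.1, hu.2.trans ht.2⟩) (by simp [h0])
      ((hcont h').comp (by fun_prop) hmaps) (fun u hu => ?_) (fun u hu heq => ?_) ⟨ht.1, le_rfl⟩
    · have hu' : (1 + ν) * u ∈ Ico 0 b :=
        ⟨mul_nonneg (by linarith) hu.1, by nlinarith [hu.2]⟩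
      have := HasDerivWithinAt.scomp (h := fun u : ℝ => (1 + ν) * u) (h' := (1 + ν) * 1) u
        (hder h' _ hu') (((hasDerivAt_id u).const_mul (1 + ν)).hasDerivWithinAt (s := Ici u))
        (fun w hw => mul_le_mul_of_nonneg_left (show u ≤ w from hw)
          (show (0 : ℝ) ≤ 1 + ν by linarith))
      simpa [Function.comp_def] using this
    · have hu1 : u ∈ Icc 0 b := ⟨hu.1, hu.2.le.trans ht.2.le⟩
      rw [← hsep u hu1 _ (hmaps ⟨hu.1, hu.2.le⟩) heq]
      nlinarith [hℓ _ (h u hu1).1]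
  have hlim : Tendsto (fun ν : ℝ => ℓ (c' ((1 + ν) * t))) (𝓝[>] 0) (𝓝 (ℓ (c' t))) := by
    have h1 : Tendsto (fun ν : ℝ => (1 + ν) * t) (𝓝[>] 0) (𝓝[Ici t] t) := by
      refine tendsto_nhdsWithin_iff.2 ⟨?_, ?_⟩
      · have : Tendsto (fun ν : ℝ => (1 + ν) * t) (𝓝 0) (𝓝 ((1 + 0) * t)) :=
          Continuous.tendsto (by fun_prop) 0
        simp only [add_zero, one_mul] at this
        exact this.mono_left nhdsWithin_le_nhds
      · filter_upwards [self_mem_nhdsWithin] with ν hν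
        have : 0 < ν := hν
        have := ht.1
        change t ≤ (1 + ν) * t
        nlinarith
    exact (hder h' t ht).continuousWithinAt.tendsto.comp h1
  refine ge_of_tendsto hlim ?_
  have h2 : ∀ᶠ ν : ℝ in 𝓝 0, (1 + ν) * t < b :=
    (Continuous.tendsto (by fun_prop : Continuous fun ν : ℝ => (1 + ν) * t) 0).eventually_lt_const
      (by simpa using ht.2)
  filter_upwards [self_mem_nhdsWithin, mem_nhdsWithin_of_mem_nhds h2] with ν hν hνb
  exact key ν hν hνb

/-- Two solutions with the same initial point coincide, if points of equal height on them do. -/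
lemma IsSolutionOn.eqOn_of_separated_right {ℓ : E →L[ℝ] ℝ} (h : IsSolutionOn X B c 0 b)
    (h' : IsSolutionOn X B c' 0 b) (hℓ : ∀ p ∈ B, 0 < ℓ (X p)) (h0 : c 0 = c' 0)
    (hsep : ∀ s ∈ Icc 0 b, ∀ t ∈ Icc 0 b, ℓ (c s) = ℓ (c' t) → c s = c' t) :
    EqOn c c' (Icc 0 b) := by
  have hIco : EqOn c c' (Ico 0 b) := fun t ht =>
    hsep t ⟨ht.1, ht.2.le⟩ t ⟨ht.1, ht.2.le⟩ (le_antisymm (h.le_of_separated h' hℓ h0 hsep ht)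
      (h'.le_of_separated h hℓ h0.symm (fun s hs t ht e => (hsep t ht s hs e.symm).symm) ht))
  rcases lt_trichotomy b 0 with hb | rfl | hb
  · simp [Icc_eq_empty (not_le.2 hb)]
  · intro t ht
    obtain rfl : t = 0 := le_antisymm ht.2 ht.1
    exact h0
  · exact hIco.of_subset_closure h.continuousOn h'.continuousOn Ico_subset_Icc_self
      (by rw [closure_Ico hb.ne])

/-- Negative times reduce to positive ones by reversing the field and replacing the height `ℓ` by
`-ℓ`. -/
lemma IsSolutionOn.eqOn_of_separated {ℓ : E →L[ℝ] ℝ} (h : IsSolutionOn X B c a b)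
    (h' : IsSolutionOn X B c' a b) (ha : a ≤ 0) (hb : 0 ≤ b) (hℓ : ∀ p ∈ B, 0 < ℓ (X p))
    (h0 : c 0 = c' 0)
    (hsep : ∀ s ∈ Icc a b, ∀ t ∈ Icc a b, ℓ (c s) = ℓ (c' t) → c s = c' t) :
    EqOn c c' (Icc a b) := by
  have h1 := (h.mono ha le_rfl).eqOn_of_separated_right (h'.mono ha le_rfl) hℓ h0
    fun s hs t ht => hsep s ⟨ha.trans hs.1, hs.2⟩ t ⟨ha.trans ht.1, ht.2⟩
  have h2 := (((h.mono le_rfl hb).comp_neg).mono (by simp) le_rfl).eqOn_of_separated_right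
    (((h'.mono le_rfl hb).comp_neg).mono (by simp) le_rfl) (ℓ := -ℓ)
    (fun p hp => by simpa using hℓ p hp) (by simpa using h0)
    (fun s hs t ht e => hsep _ ⟨by linarith [hs.2], by linarith [hs.1]⟩ _
      ⟨by linarith [ht.2], by linarith [ht.1]⟩ (by simpa using e))
  intro t ht
  rcases le_total 0 t with h0t | h0t
  · exact h1 ⟨h0t, ht.2⟩
  · simpa using h2 (x := -t) ⟨by linarith, by linarith [ht.1]⟩

/-- Local solutions of `c' = X c` exist for a uniform time. -/
lemma exists_local_solution [ProperSpace E] {p₀ : E} {R C r : ℝ}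
    (hX : ContinuousOn X (closedBall p₀ R)) (hC : ∀ p ∈ closedBall p₀ R, ‖X p‖ ≤ C)
    (hr : 0 ≤ r) (hrR : r + r * (C + 1) ≤ R) (hC0 : 0 ≤ C) {y : E} (hy : y ∈ closedBall p₀ r) :
    ∃ c : ℝ → E, c 0 = y ∧ IsSolutionOn X (closedBall p₀ R) c (-r) r := by
  have hsub : closedBall y (r * (C + 1)) ⊆ closedBall p₀ R :=
    closedBall_subset_closedBall' (by linarith [mem_closedBall.1 hy])
  -- In the whole space the exact Euler step is available, so viability specialises to Peano's
  -- existence theorem.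
  have hstep : ∀ Y : E → E, ∀ η > (0 : ℝ), ∃ ρ > (0 : ℝ), ∀ p ∈ univ ∩ closedBall y (r * (C + 1)),
      ∀ t, 0 < t → t ≤ ρ → ∃ p' ∈ (univ : Set E), ‖p' - p - t • Y p‖ ≤ η * t :=
    fun Y η hη => ⟨1, one_pos, fun p _ t ht _ => ⟨p + t • Y p, trivial, by
      simp only [add_sub_cancel_left, sub_self, norm_zero]; positivity⟩⟩
  obtain ⟨c₁, h10, h1⟩ := exists_viable_solution isClosed_univ (by positivity) (hX.mono hsub)
    (fun p hp => hC p (hsub hp)) (hstep X) (mem_univ y) hr le_rfl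
  obtain ⟨c₂, h20, h2⟩ := exists_viable_solution (X := fun p => -X p) isClosed_univ (by positivity)
    (hX.mono hsub).neg
    (fun p hp => by simpa using hC p (hsub hp)) (hstep _) (mem_univ y) hr le_rfl
  have h1' := h1.mono_set (inter_subset_right.trans hsub)
  have h2' := (h2.mono_set (inter_subset_right.trans hsub)).comp_neg
  simp only [neg_neg, neg_zero] at h2'
  refine ⟨fun t => if 0 ≤ t then c₁ t else c₂ (-t), by simpa using h10, ?_⟩
  refine IsSolutionOn.union (h2'.congr fun t ht => ?_) (h1'.congr fun t ht => ?_)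
    (by linarith) hr
  · dsimp only
    split_ifs with h
    · obtain rfl : t = 0 := le_antisymm ht.2 h
      rw [h10, neg_zero, h20]
    · rfl
  · exact if_pos ht.1

end SolutionCalculus

/-! ### Boxes transverse to a plane field and sets followed by tangent steps -/

section TransverseBox

open Metric

variable {E : Type*} [NormedAddCommGroup E] [NormedSpace ℝ E]

/-- In the ball of radius `R` around `p₀`, the continuous vector field `X` is transverse to the
continuous plane field `ker θ`, and so is the constant field `v`. -/
structure IsTransverseBox (p₀ : E) (R : ℝ) (X : E → E) (θ : E → E →L[ℝ] ℝ) (v : E) : Prop where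
  pos : 0 < R
  continuousOn_field : ContinuousOn X (closedBall p₀ R)
  continuousOn_form : ContinuousOn θ (closedBall p₀ R)
  form_apply : ∀ p ∈ closedBall p₀ R, θ p v = 1
  half_le : ∀ p ∈ closedBall p₀ R, ∀ q ∈ closedBall p₀ R, 1 / 2 ≤ θ p (X q)

/-- The set `S` contains, near each of its points in `B`, points in all directions tangent to
`ker θ`, up to a small error in the direction of `v`. -/
def HasTangentSteps (θ : E → E →L[ℝ] ℝ) (v : E) (S B : Set E) : Prop :=
  ∀ η > 0, ∃ ρ > 0, ∀ p ∈ S ∩ B, ∀ w : E, ‖w‖ ≤ ρ →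
    ∃ r : ℝ, |r - θ p w| ≤ η * ‖w‖ ∧ p + w - r • v ∈ S

variable {p₀ v : E} {R : ℝ} {X : E → E} {θ : E → E →L[ℝ] ℝ}

namespace IsTransverseBox

lemma mono (h : IsTransverseBox p₀ R X θ v) {R' : ℝ} (h0 : 0 < R') (hR : R' ≤ R) :
    IsTransverseBox p₀ R' X θ v :=
  have hs := closedBall_subset_closedBall (x := p₀) hR
  ⟨h0, h.continuousOn_field.mono hs, h.continuousOn_form.mono hs,
    fun p hp => h.form_apply p (hs hp), fun p hp q hq => h.half_le p (hs hp) q (hs hq)⟩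

lemma center_mem (h : IsTransverseBox p₀ R X θ v) : p₀ ∈ closedBall p₀ R :=
  mem_closedBall_self h.pos.le

variable [ProperSpace E]

lemma exists_form_bound (h : IsTransverseBox p₀ R X θ v) :
    ∃ C, 0 ≤ C ∧ ∀ p ∈ closedBall p₀ R, ‖θ p‖ ≤ C := by
  obtain ⟨C, hC⟩ := (isCompact_closedBall p₀ R).exists_bound_of_continuousOn h.continuousOn_form
  exact ⟨C, (norm_nonneg _).trans (hC _ h.center_mem), hC⟩

lemma exists_field_bound (h : IsTransverseBox p₀ R X θ v) :
    ∃ C, 0 ≤ C ∧ ∀ p ∈ closedBall p₀ R, ‖X p‖ ≤ C := by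
  obtain ⟨C, hC⟩ := (isCompact_closedBall p₀ R).exists_bound_of_continuousOn h.continuousOn_field
  exact ⟨C, (norm_nonneg _).trans (hC _ h.center_mem), hC⟩

/-- Solutions of `c' = Y c` lift along `v` to solutions in a set with tangent steps. -/
lemma exists_lift (h : IsTransverseBox p₀ R X θ v) {C : ℝ} (hC : 0 ≤ C) :
    ∃ r > 0, ∀ S : Set E, IsClosed S → HasTangentSteps θ v S (closedBall p₀ (R / 2)) →
      ∀ Y : E → E, ContinuousOn Y (closedBall p₀ R) → (∀ p ∈ closedBall p₀ R, ‖Y p‖ ≤ C) →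
      ∀ y ρ₀, y ∈ closedBall p₀ r → |ρ₀| ≤ r → y - ρ₀ • v ∈ S →
      ∃ (γ : ℝ → E) (ρ : ℝ → ℝ), γ 0 = y ∧ ρ 0 = ρ₀ ∧
        IsSolutionOn Y (closedBall p₀ R) γ 0 r ∧ ∀ t ∈ Icc 0 r, γ t - ρ t • v ∈ S ∧
          γ t - ρ t • v ∈ closedBall p₀ (R / 2) ∧
          HasDerivWithinAt ρ (θ (γ t - ρ t • v) (Y (γ t))) (Icc 0 r) t := by
  obtain ⟨Cθ, hCθ0, hCθ⟩ := h.exists_form_bound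
  have hR := h.pos
  -- If both the point and its offset are bounded by `2 * R₁`, then the shifted point is within `2 *
  -- R₁ * (1 + ‖v‖) = R / 2` of the center.
  set R₁ := R / (4 * (1 + ‖v‖)) with hR₁
  have hR₁0 : 0 < R₁ := by positivity
  have hR₁R : (2 * R₁) * (1 + ‖v‖) = R / 2 := by rw [hR₁]; field_simp; norm_num
  set D := C * (1 + Cθ) with hD
  have hD0 : 0 ≤ D := by positivity
  refine ⟨min R₁ (R₁ / (D + 1)), by positivity, fun S hS hstep Y hY hYC y ρ₀ hy hρ₀ hyS => ?_⟩
  set r := min R₁ (R₁ / (D + 1)) with hr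
  have hr0 : 0 < r := by positivity
  have hr1 : r ≤ R₁ := min_le_left _ _
  have hr2 : r * (D + 1) ≤ R₁ := by
    rw [← le_div_iff₀ (by positivity)]; exact min_le_right _ _
  -- Lifting a solution of `Y` means finding a viable solution in `K` of the product field `Z`. Its
  -- second component is forced: since `θ v = 1`, the velocity of the shifted point lies in `ker θ`
  -- exactly when the offset changes at the rate `θ Y`.
  set K : Set (E × ℝ) := {q | q.1 - q.2 • v ∈ S}
  have hK : IsClosed K := hS.preimage (by fun_prop)
  have hgeo : ∀ q ∈ closedBall (y, ρ₀) R₁, q.1 ∈ closedBall p₀ R ∧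
      q.1 - q.2 • v ∈ closedBall p₀ (R / 2) := by
    rintro ⟨z, ρ⟩ hq
    rw [mem_closedBall, Prod.dist_eq, max_le_iff] at hq
    simp only [Real.dist_eq] at hq
    have h1 : ‖z - p₀‖ ≤ 2 * R₁ := by
      rw [← dist_eq_norm]
      linarith [dist_triangle z y p₀, mem_closedBall.1 hy]
    have h2 : |ρ| ≤ 2 * R₁ := by
      have := abs_sub_abs_le_abs_sub ρ ρ₀
      linarith
    have h3 : 0 ≤ 2 * R₁ * ‖v‖ := by positivity
    refine ⟨by rw [mem_closedBall, dist_eq_norm]; linarith, ?_⟩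
    rw [mem_closedBall, dist_eq_norm, sub_right_comm]
    refine (norm_sub_le _ _).trans ?_
    rw [norm_smul, Real.norm_eq_abs]
    have := mul_le_mul_of_nonneg_right h2 (norm_nonneg v)
    linarith
  have hhalf : closedBall p₀ (R / 2) ⊆ closedBall p₀ R :=
    closedBall_subset_closedBall (by linarith)
  let Z : E × ℝ → E × ℝ := fun q => (Y q.1, θ (q.1 - q.2 • v) (Y q.1))
  have hYc : ContinuousOn (fun q : E × ℝ => Y q.1) (closedBall (y, ρ₀) R₁) :=
    hY.comp continuousOn_fst fun q hq => (hgeo q hq).1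
  have hθc : ContinuousOn (fun q : E × ℝ => θ (q.1 - q.2 • v)) (closedBall (y, ρ₀) R₁) :=
    h.continuousOn_form.comp (by fun_prop) fun q hq => hhalf (hgeo q hq).2
  have hZ : ContinuousOn Z (closedBall (y, ρ₀) R₁) := hYc.prodMk (hθc.clm_apply hYc)
  have hZC : ∀ q ∈ closedBall (y, ρ₀) R₁, ‖Z q‖ ≤ D := by
    intro q hq
    have h1 := hYC _ (hgeo q hq).1
    have h2 := hCθ _ (hhalf (hgeo q hq).2)
    have h3 : 0 ≤ C * Cθ := by positivity
    rw [Prod.norm_def, max_le_iff]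
    refine ⟨h1.trans (by rw [hD]; linarith), ((θ _).le_opNorm _).trans ?_⟩
    calc ‖θ (q.1 - q.2 • v)‖ * ‖Y q.1‖ ≤ Cθ * C := by gcongr
      _ ≤ D := by rw [hD]; linarith
  have hstepK : ∀ η > 0, ∃ τ > 0, ∀ q ∈ K ∩ closedBall (y, ρ₀) R₁, ∀ t, 0 < t → t ≤ τ →
      ∃ q' ∈ K, ‖q' - q - t • Z q‖ ≤ η * t := by
    intro η hη
    obtain ⟨τ, hτ, hst⟩ := hstep (η / (C + 1)) (by positivity)
    refine ⟨τ / (C + 1), by positivity, fun q hq t ht htτ => ?_⟩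
    rw [le_div_iff₀ (by positivity)] at htτ
    have hw : ‖t • Y q.1‖ ≤ t * C := by
      rw [norm_smul, Real.norm_eq_abs, abs_of_pos ht]
      exact mul_le_mul_of_nonneg_left (hYC _ (hgeo q hq.2).1) ht.le
    obtain ⟨s, hs, hmem⟩ := hst _ ⟨hq.1, (hgeo q hq.2).2⟩ (t • Y q.1) (by linarith)
    refine ⟨(q.1 + t • Y q.1, q.2 + s), ?_, ?_⟩
    · change q.1 + t • Y q.1 - (q.2 + s) • v ∈ S
      convert hmem using 1
      module
    · have : (q.1 + t • Y q.1, q.2 + s) - q - t • Z q =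
          ((0 : E), s - θ (q.1 - q.2 • v) (t • Y q.1)) := by
        ext <;> simp [Z]
      rw [this, Prod.norm_def, norm_zero, max_eq_right (norm_nonneg _), Real.norm_eq_abs]
      refine hs.trans ((mul_le_mul_of_nonneg_left hw (by positivity)).trans ?_)
      rw [div_mul_eq_mul_div, div_le_iff₀ (by positivity)]
      nlinarith [mul_pos hη ht]
  obtain ⟨c, hc0, hc⟩ := exists_viable_solution hK hR₁0.le hZ hZC hstepK
    (show (y, ρ₀) ∈ K from hyS) hr0.le hr2
  refine ⟨fun t => (c t).1, fun t => (c t).2, by simp [hc0], by simp [hc0], fun t ht => ?_,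
    fun t ht => ?_⟩
  · obtain ⟨h1, h2⟩ := hc t ht
    exact ⟨(hgeo _ h1.2).1,
      (ContinuousLinearMap.fst ℝ E ℝ).hasFDerivAt.comp_hasDerivWithinAt t h2⟩
  · obtain ⟨h1, h2⟩ := hc t ht
    exact ⟨h1.1, (hgeo _ h1.2).2,
      (ContinuousLinearMap.snd ℝ E ℝ).hasFDerivAt.comp_hasDerivWithinAt t h2⟩

/-- The scale of the tangent steps of a set depends only on the box. -/
lemma exists_uniform_tangentSteps (h : IsTransverseBox p₀ R X θ v) :
    ∃ r₀ > 0, ∀ η > 0, ∃ r > 0, ∀ S : Set E, IsClosed S →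
      HasTangentSteps θ v S (closedBall p₀ (R / 2)) →
      ∀ p ∈ S ∩ closedBall p₀ r₀, ∀ w : E, ‖w‖ ≤ r →
        ∃ ρ : ℝ, |ρ - θ p w| ≤ η * ‖w‖ ∧ p + w - ρ • v ∈ S := by
  obtain ⟨r₀, hr₀, hlift⟩ := h.exists_lift (C := 1) zero_le_one
  obtain ⟨Cθ, hCθ0, hCθ⟩ := h.exists_form_bound
  have hR := h.pos
  refine ⟨min r₀ (R / 2), by positivity, fun η hη => ?_⟩
  obtain ⟨d, hd, hθd⟩ := Metric.uniformContinuousOn_iff.1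
    ((isCompact_closedBall p₀ R).uniformContinuousOn_of_continuous h.continuousOn_form) η hη
  set D := 1 + Cθ * ‖v‖
  have hD : 0 < D := by positivity
  refine ⟨min r₀ (d / (2 * D)), by positivity, fun S hS hstep p hp w hw => ?_⟩
  have hhalf : closedBall p₀ (R / 2) ⊆ closedBall p₀ R :=
    closedBall_subset_closedBall (by linarith)
  rcases eq_or_ne w 0 with rfl | hw0
  · exact ⟨0, by simp, by simpa using hp.1⟩
  have hwn : 0 < ‖w‖ := norm_pos_iff.2 hw0
  obtain ⟨u, hu1, hwu⟩ : ∃ u : E, ‖u‖ = 1 ∧ ‖w‖ • u = w :=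
    ⟨‖w‖⁻¹ • w, by rw [norm_smul, norm_inv, norm_norm, inv_mul_cancel₀ hwn.ne'],
      by rw [smul_smul, mul_inv_cancel₀ hwn.ne', one_smul]⟩
  -- The set is followed along the straight segment from `p` in direction `u`. The rate of the
  -- offset stays within `η` of `θ p u` on a length governed by the modulus of continuity of `θ`,
  -- which does not involve `S`.
  obtain ⟨γ, ρ, hγ0, hρ0, hγ, hρ⟩ := hlift S hS hstep (fun _ => u) continuousOn_const
    (fun _ _ => hu1.le) p 0 (closedBall_subset_closedBall (min_le_left _ _) hp.2)
    (by simpa using hr₀.le) (by simpa using hp.1)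
  set t := ‖w‖
  have htr : t ≤ r₀ := hw.trans (min_le_left _ _)
  have hsub : Icc 0 t ⊆ Icc 0 r₀ := Icc_subset_Icc le_rfl htr
  have hγt : ∀ s ∈ Icc 0 r₀, γ s = p + s • u := by
    intro s hs
    have := (convex_Icc 0 r₀).norm_image_sub_le_of_norm_hasDerivWithin_le (C := 0)
      (f := fun s => γ s - s • u) (f' := fun _ => 0) (fun x hx => by
        have h1 : HasDerivWithinAt (fun s => γ s - s • u) (u - (1 : ℝ) • u) (Icc 0 r₀) x :=
          (hγ x hx).2.sub ((hasDerivWithinAt_id x (Icc 0 r₀)).smul_const u)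
        simpa using h1) (by simp) ⟨le_rfl, hr₀.le⟩ hs
    rw [zero_mul, norm_le_zero_iff, hγ0] at this
    simp only [zero_smul, sub_zero] at this
    rw [sub_eq_zero, sub_eq_iff_eq_add] at this
    exact this
  have hθb : ∀ s ∈ Icc 0 r₀, |ρ s| ≤ Cθ * s := by
    intro s hs
    have := (convex_Icc 0 r₀).norm_image_sub_le_of_norm_hasDerivWithin_le (C := Cθ)
      (fun x hx => (hρ x hx).2.2) (fun x hx => by
        have := (θ (γ x - ρ x • v)).le_opNorm u
        rw [hu1, mul_one] at this
        exact this.trans (hCθ _ (hhalf (hρ x hx).2.1))) ⟨le_rfl, hr₀.le⟩ hs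
    simpa [hρ0, abs_of_nonneg hs.1] using this
  have hclose : ∀ s ∈ Icc 0 t, ‖θ (γ s - ρ s • v) - θ p‖ ≤ η := by
    intro s hs
    rw [← dist_eq_norm]
    refine (hθd _ (hhalf (hρ s (hsub hs)).2.1) _
      (hhalf (closedBall_subset_closedBall (min_le_right _ _) hp.2)) ?_).le
    rw [dist_eq_norm, hγt s (hsub hs)]
    have h1 : p + s • u - ρ s • v - p = s • u - ρ s • v := by abel
    have h2 : ‖s • u - ρ s • v‖ ≤ s * D := by
      refine (norm_sub_le _ _).trans ?_
      rw [norm_smul, norm_smul, hu1, Real.norm_eq_abs, Real.norm_eq_abs, abs_of_nonneg hs.1]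
      nlinarith [mul_le_mul_of_nonneg_right (hθb s (hsub hs)) (norm_nonneg v)]
    have h3 : t * (2 * D) ≤ d := by
      rw [← le_div_iff₀ (by positivity)]; exact hw.trans (min_le_right _ _)
    rw [h1]
    have : s * D ≤ t * D := mul_le_mul_of_nonneg_right hs.2 hD.le
    linarith
  have ht : t ∈ Icc 0 t := ⟨hwn.le, le_rfl⟩
  refine ⟨ρ t, ?_, ?_⟩
  · have := (convex_Icc 0 t).norm_image_sub_le_of_norm_hasDerivWithin_le (C := η)
      (f := fun s => ρ s - s * θ p u) (f' := fun s => θ (γ s - ρ s • v) u - 1 * θ p u)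
      (fun x hx => ((hρ x (hsub hx)).2.2.mono hsub).sub
        ((hasDerivWithinAt_id x (Icc 0 t)).mul_const _))
      (fun x hx => by
        rw [one_mul, ← sub_apply]
        refine (ContinuousLinearMap.le_opNorm _ _).trans ?_
        rw [hu1, mul_one]
        exact hclose x hx) ⟨le_rfl, hwn.le⟩ ht
    rw [hρ0] at this
    simp only [zero_mul, sub_zero, Real.norm_eq_abs, abs_of_pos hwn] at this
    rwa [← smul_eq_mul, ← map_smul, hwu] at this
  · have := (hρ t (hsub ht)).1
    rwa [hγt t (hsub ht), hwu] at this

/-- The flow line of `X` through a point close to a set with tangent steps hits that set. -/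
lemma exists_hit (h : IsTransverseBox p₀ R X θ v) :
    ∃ r > 0, ∀ S : Set E, IsClosed S → HasTangentSteps θ v S (closedBall p₀ (R / 2)) →
      ∀ y ρ₀, y ∈ closedBall p₀ r → |ρ₀| ≤ r → y - ρ₀ • v ∈ S →
      ∃ τ ∈ Icc 0 (2 * |ρ₀|), (ρ₀ ≠ 0 → 0 < τ) ∧ ∃ γ : ℝ → E, γ 0 = y ∧ γ τ ∈ S ∧
        (IsSolutionOn X (closedBall p₀ R) γ 0 τ ∨
          IsSolutionOn (fun p => -X p) (closedBall p₀ R) γ 0 τ) := by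
  obtain ⟨C, hC0, hC⟩ := h.exists_field_bound
  obtain ⟨r, hr, hlift⟩ := h.exists_lift hC0
  have hR := h.pos
  have hhalf : closedBall p₀ (R / 2) ⊆ closedBall p₀ R :=
    closedBall_subset_closedBall (by linarith)
  refine ⟨r / 2, by positivity, fun S hS hstep y ρ₀ hy hρ₀ hyS => ?_⟩
  have hy' : y ∈ closedBall p₀ r := closedBall_subset_closedBall (by linarith) hy
  have hτr : 2 * |ρ₀| ∈ Icc 0 r := ⟨by positivity, by linarith⟩
  have hsub : Icc 0 (2 * |ρ₀|) ⊆ Icc 0 r := Icc_subset_Icc le_rfl hτr.2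
  -- The offset changes at a rate of absolute value at least `1 / 2`, so it vanishes by time `2 *
  -- |ρ₀|`. The field is followed forwards for a nonpositive offset and backwards for a nonnegative
  -- one.
  rcases le_total ρ₀ 0 with hs | hs
  · obtain ⟨γ, ρ, hγ0, hρ0, hγ, hρ⟩ := hlift S hS hstep X h.continuousOn_field hC y ρ₀ hy'
      (by linarith) hyS
    have hcont : ContinuousOn ρ (Icc 0 (2 * |ρ₀|)) := fun t ht =>
      ((hρ t (hsub ht)).2.2.mono hsub).continuousWithinAt
    have hend : 0 ≤ ρ (2 * |ρ₀|) := by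
      have hlow := image_le_of_deriv_right_le_deriv_boundary (f := fun u => 1 / 2 * u + ρ₀)
        (f' := fun _ => 1 / 2) (B := ρ) (B' := fun t => θ (γ t - ρ t • v) (X (γ t)))
        (a := 0) (b := 2 * |ρ₀|) (by fun_prop)
        (fun u _ => by
          simpa using (((hasDerivAt_id u).const_mul (1 / 2 : ℝ)).add_const ρ₀).hasDerivWithinAt)
        (by simp [hρ0]) hcont
        (fun u hu => ((hρ u (hsub ⟨hu.1, hu.2.le⟩)).2.2).mono_of_mem_nhdsWithin
          (mem_of_superset (Icc_mem_nhdsGE_of_mem hu) hsub))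
        (fun u hu => h.half_le _ (hhalf (hρ u (hsub ⟨hu.1, hu.2.le⟩)).2.1) _
          (hγ u (hsub ⟨hu.1, hu.2.le⟩)).1) ⟨hτr.1, le_rfl⟩
      rw [abs_of_nonpos hs] at hlow ⊢
      linarith
    obtain ⟨τ, hτ, hτ0⟩ := intermediate_value_Icc hτr.1 hcont ⟨by rw [hρ0]; exact hs, hend⟩
    refine ⟨τ, hτ, fun hz => hτ.1.lt_of_ne fun hz' =>
      hz (hρ0.symm.trans ((congrArg ρ hz').trans hτ0)), γ, hγ0, ?_, Or.inl (hγ.mono le_rfl (hsub hτ).2)⟩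
    simpa [hτ0] using (hρ τ (hsub hτ)).1
  · obtain ⟨γ, ρ, hγ0, hρ0, hγ, hρ⟩ := hlift S hS hstep (fun p => -X p) h.continuousOn_field.neg
      (fun p hp => by simpa using hC p hp) y ρ₀ hy' (by linarith) hyS
    have hcont : ContinuousOn ρ (Icc 0 (2 * |ρ₀|)) := fun t ht =>
      ((hρ t (hsub ht)).2.2.mono hsub).continuousWithinAt
    have hend : ρ (2 * |ρ₀|) ≤ 0 := by
      have hlow := image_le_of_deriv_right_le_deriv_boundary (B := fun u => -(1 / 2) * u + ρ₀)
        (B' := fun _ => -(1 / 2)) (f := ρ) (f' := fun t => θ (γ t - ρ t • v) (-X (γ t)))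
        (a := 0) (b := 2 * |ρ₀|) hcont
        (fun u hu => ((hρ u (hsub ⟨hu.1, hu.2.le⟩)).2.2).mono_of_mem_nhdsWithin
          (mem_of_superset (Icc_mem_nhdsGE_of_mem hu) hsub))
        (by simp [hρ0]) (by fun_prop)
        (fun u _ => by
          simpa using (((hasDerivAt_id u).const_mul (-(1 / 2) : ℝ)).add_const ρ₀).hasDerivWithinAt)
        (fun u hu => by
          rw [map_neg]
          exact neg_le_neg (h.half_le _ (hhalf (hρ u (hsub ⟨hu.1, hu.2.le⟩)).2.1) _
            (hγ u (hsub ⟨hu.1, hu.2.le⟩)).1)) ⟨hτr.1, le_rfl⟩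
      rw [abs_of_nonneg hs] at hlow ⊢
      linarith
    obtain ⟨τ, hτ, hτ0⟩ := intermediate_value_Icc' hτr.1 hcont ⟨hend, by rw [hρ0]; exact hs⟩
    refine ⟨τ, hτ, fun hz => hτ.1.lt_of_ne fun hz' =>
      hz (hρ0.symm.trans ((congrArg ρ hz').trans hτ0)), γ, hγ0, ?_, Or.inr (hγ.mono le_rfl (hsub hτ).2)⟩
    simpa [hτ0] using (hρ τ (hsub hτ)).1

/-- A set with uniform tangent steps that meets each line parallel to `v` at most once is locally
the zero set of a `C¹` function with differential `θ`. -/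
lemma exists_graph_function (h : IsTransverseBox p₀ R X θ v) {S : Set E} (hp₀ : p₀ ∈ S) {r₀ : ℝ}
    (hr₀ : 0 < r₀) (hr₀R : r₀ ≤ R) (hstep : HasTangentSteps θ v S (closedBall p₀ r₀))
    (huniq : ∀ p ∈ S ∩ closedBall p₀ r₀, ∀ ρ : ℝ, |ρ| ≤ r₀ → p + ρ • v ∈ S → ρ = 0) :
    ∃ r > 0, r ≤ R ∧ ∃ φ : E → ℝ, ContDiffOn ℝ 1 φ (ball p₀ r) ∧
      ∀ y ∈ ball p₀ r, (y ∈ S ↔ φ y = 0) ∧ (y ∈ S → HasFDerivAt φ (θ y) y) := by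
  obtain ⟨Cθ, hCθ0, hCθ⟩ := h.exists_form_bound
  obtain ⟨r₁, hr₁, hst₁⟩ := hstep 1 one_pos
  set D := (Cθ + 1) * (1 + ‖v‖)
  have hD : 0 < D := by positivity
  have hD1 : Cθ + 1 ≤ D := le_mul_of_one_le_right (by positivity) (by linarith [norm_nonneg v])
  set r := min (min r₁ R) (r₀ / (4 * (D + 1)))
  have hr : 0 < r := by have := h.pos; positivity
  have hrr₀ : r * (4 * (D + 1)) ≤ r₀ := by
    rw [← le_div_iff₀ (by positivity)]; exact min_le_right _ _
  have hex : ∀ y, ∃ ρ : ℝ, y ∈ ball p₀ r → |ρ| ≤ (Cθ + 1) * ‖y - p₀‖ ∧ y - ρ • v ∈ S := by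
    intro y
    by_cases hy : y ∈ ball p₀ r
    · have hy' : ‖y - p₀‖ < r := by rwa [← dist_eq_norm]
      obtain ⟨ρ, h1, h2⟩ := hst₁ p₀ ⟨hp₀, mem_closedBall_self hr₀.le⟩ (y - p₀)
        (hy'.le.trans ((min_le_left _ _).trans (min_le_left _ _)))
      refine ⟨ρ, fun _ => ⟨?_, by rwa [add_sub_cancel] at h2⟩⟩
      have h3 := (θ p₀).le_opNorm (y - p₀)
      have h4 := mul_le_mul_of_nonneg_right (hCθ p₀ h.center_mem) (norm_nonneg (y - p₀))
      have h5 := abs_sub_abs_le_abs_sub ρ (θ p₀ (y - p₀))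
      rw [Real.norm_eq_abs] at h3
      linarith
    · exact ⟨0, fun h => absurd h hy⟩
  -- The defining function is the offset along `v` that carries a point to `S`.
  choose φ hφ using hex
  have hφb : ∀ y ∈ ball p₀ r, |φ y| ≤ r₀ / 4 ∧ y - φ y • v ∈ closedBall p₀ (r₀ / 2) := by
    intro y hy
    have hy' : ‖y - p₀‖ < r := by rwa [← dist_eq_norm]
    have h1 := (hφ y hy).1
    have h2 : (Cθ + 1) * ‖y - p₀‖ ≤ D * r := by gcongr
    have h3 : |φ y| * ‖v‖ ≤ (Cθ + 1) * r * ‖v‖ := by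
      refine mul_le_mul_of_nonneg_right (h1.trans ?_) (norm_nonneg v); gcongr
    refine ⟨by nlinarith, ?_⟩
    rw [mem_closedBall, dist_eq_norm, sub_right_comm]
    refine (norm_sub_le _ _).trans ?_
    rw [norm_smul, Real.norm_eq_abs]
    have h4 : (Cθ + 1) * r * ‖v‖ ≤ D * r := by
      have : 0 ≤ (Cθ + 1) * r := by positivity
      change _ ≤ (Cθ + 1) * (1 + ‖v‖) * r
      nlinarith
    nlinarith
  have hφu : ∀ y ∈ ball p₀ r, ∀ ρ : ℝ, |ρ| ≤ r₀ / 2 → y - ρ • v ∈ S → ρ = φ y := by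
    intro y hy ρ hρ hS
    have h1 := huniq (y - φ y • v) ⟨(hφ y hy).2,
      closedBall_subset_closedBall (by linarith) (hφb y hy).2⟩ (φ y - ρ)
      ((abs_sub _ _).trans (by linarith [(hφb y hy).1])) (by convert hS using 1; module)
    linarith
  have hS : ∀ y ∈ ball p₀ r, (y ∈ S ↔ φ y = 0) := by
    intro y hy
    refine ⟨fun hyS => (hφu y hy 0 (by rw [abs_zero]; positivity) (by simpa using hyS)).symm, fun h0 => ?_⟩
    simpa [h0] using (hφ y hy).2
  -- A tangent step from the shifted point `y - φ y • v` yields an offset for `y + w`, and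
  -- uniqueness identifies it with `φ (y + w)`. The derivative found in this way is continuous
  -- because `φ` and `θ` are.
  have hder : ∀ y ∈ ball p₀ r, HasFDerivAt φ (θ (y - φ y • v)) y := by
    intro y hy
    rw [hasFDerivAt_iff_isLittleO_nhds_zero]
    refine Asymptotics.IsLittleO.of_bound fun η hη => ?_
    obtain ⟨r₂, hr₂, hst₂⟩ := hstep (min η 1) (by positivity)
    have hdy : 0 < r - dist y p₀ := by linarith [mem_ball.1 hy]
    have hd : 0 < min (min r₂ (r₀ / (4 * (Cθ + 1)))) (r - dist y p₀) := by positivity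
    filter_upwards [Metric.ball_mem_nhds (0 : E) hd] with w hw
    rw [mem_ball_zero_iff, lt_min_iff, lt_min_iff] at hw
    obtain ⟨⟨hw1, hw2⟩, hw3⟩ := hw
    rw [lt_div_iff₀ (by positivity)] at hw2
    have hyw : y + w ∈ ball p₀ r := by
      rw [mem_ball, dist_eq_norm] at *
      rw [add_sub_right_comm]
      linarith [norm_add_le (y - p₀) w]
    have hmem := closedBall_subset_closedBall (show r₀ / 2 ≤ r₀ by linarith) (hφb y hy).2
    obtain ⟨ρ, hρ1, hρ2⟩ := hst₂ _ ⟨(hφ y hy).2, hmem⟩ w hw1.le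
    have hρb : |ρ| ≤ r₀ / 4 := by
      have h3 := (θ (y - φ y • v)).le_opNorm w
      have h4 := mul_le_mul_of_nonneg_right
        (hCθ _ (closedBall_subset_closedBall hr₀R hmem)) (norm_nonneg w)
      have h5 := abs_sub_abs_le_abs_sub ρ (θ (y - φ y • v) w)
      rw [Real.norm_eq_abs] at h3
      have h6 : min η 1 * ‖w‖ ≤ 1 * ‖w‖ :=
        mul_le_mul_of_nonneg_right (min_le_right _ _) (norm_nonneg w)
      linarith
    have h7 := hφu (y + w) hyw (φ y + ρ) ((abs_add_le _ _).trans (by linarith [(hφb y hy).1]))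
      (by convert hρ2 using 1; module)
    rw [← h7, add_sub_cancel_left, Real.norm_eq_abs]
    exact hρ1.trans (mul_le_mul_of_nonneg_right (min_le_left _ _) (norm_nonneg w))
  refine ⟨r, hr, (min_le_left _ _).trans (min_le_right _ _), φ, ?_, fun y hy => ⟨hS y hy,
    fun hyS => by simpa [(hS y hy).1 hyS] using hder y hy⟩⟩
  have hφc : ContinuousOn φ (ball p₀ r) := fun y hy => (hder y hy).continuousAt.continuousWithinAt
  rw [show (1 : ℕ∞ω) = 0 + 1 from rfl, contDiffOn_succ_iff_fderiv_of_isOpen isOpen_ball]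
  refine ⟨fun y hy => (hder y hy).differentiableAt.differentiableWithinAt, by simp, ?_⟩
  rw [contDiffOn_zero]
  refine ContinuousOn.congr (f := fun y => θ (y - φ y • v)) ?_ fun y hy => (hder y hy).fderiv
  refine h.continuousOn_form.comp (by fun_prop) fun y hy => ?_
  exact closedBall_subset_closedBall (by linarith) (hφb y hy).2

end IsTransverseBox

end TransverseBox

/-! ### Local flows of continuous fields with separated solutions -/

section LocalFlow

open Metric

variable {E : Type*} [NormedAddCommGroup E] [NormedSpace ℝ E]
  {p₀ v : E} {R : ℝ} {X : E → E} {θ : E → E →L[ℝ] ℝ}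

/-- Points of equal height on short solutions through the same point coincide. -/
def SeparatesSolutions (X : E → E) (B : Set E) (ℓ : E →L[ℝ] ℝ) (r : ℝ) : Prop :=
  ∀ a b : ℝ, -r ≤ a → a ≤ 0 → 0 ≤ b → b ≤ r → ∀ c c' : ℝ → E, IsSolutionOn X B c a b →
    IsSolutionOn X B c' a b → c 0 = c' 0 → ∀ s ∈ Icc a b, ∀ t ∈ Icc a b,
      ℓ (c s) = ℓ (c' t) → c s = c' t

lemma IsTransverseBox.eqOn_of_isSolutionOn (h : IsTransverseBox p₀ R X θ v) {r : ℝ}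
    (hsep : SeparatesSolutions X (closedBall p₀ R) (θ p₀) r) {a b : ℝ} (har : -r ≤ a) (ha : a ≤ 0)
    (hb : 0 ≤ b) (hbr : b ≤ r) {c c' : ℝ → E} (hc : IsSolutionOn X (closedBall p₀ R) c a b)
    (hc' : IsSolutionOn X (closedBall p₀ R) c' a b) (h0 : c 0 = c' 0) : EqOn c c' (Icc a b) :=
  hc.eqOn_of_separated hc' ha hb
    (fun p hp => lt_of_lt_of_le (by norm_num) (h.half_le p₀ h.center_mem p hp)) h0
    (hsep a b har ha hb hbr c c' hc hc' h0)

/-- The local flow of the field of a box whose solutions are separated. -/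
theorem IsTransverseBox.exists_flow [ProperSpace E] (h : IsTransverseBox p₀ R X θ v) {r₀ : ℝ}
    (hr₀ : 0 < r₀) (hsep : SeparatesSolutions X (closedBall p₀ R) (θ p₀) r₀) :
    ∃ r > 0, r ≤ r₀ ∧ r ≤ R ∧ ∃ ψ : E → ℝ → E,
      (∀ y ∈ closedBall p₀ r, ψ y 0 = y ∧ IsSolutionOn X (closedBall p₀ R) (ψ y) (-r) r) ∧
      ContinuousOn (fun q : E × ℝ => ψ q.1 q.2) (closedBall p₀ r ×ˢ Icc (-r) r) := by
  obtain ⟨C, hC0, hC⟩ := h.exists_field_bound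
  have hR := h.pos
  set r := min r₀ (R / (C + 2))
  have hr : 0 < r := by positivity
  have hrR : r * (C + 2) ≤ R := by
    rw [← le_div_iff₀ (by positivity)]; exact min_le_right _ _
  have hex : ∀ y, ∃ c : ℝ → E, y ∈ closedBall p₀ r →
      c 0 = y ∧ IsSolutionOn X (closedBall p₀ R) c (-r) r := by
    intro y
    by_cases hy : y ∈ closedBall p₀ r
    · obtain ⟨c, hc⟩ := exists_local_solution h.continuousOn_field hC hr.le (by linarith) hC0 hy
      exact ⟨c, fun _ => hc⟩
    · exact ⟨fun _ => 0, fun h => absurd h hy⟩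
  choose ψ hψ using hex
  refine ⟨r, hr, min_le_left _ _, by nlinarith, ψ, hψ, ?_⟩
  rintro ⟨y, t⟩ ⟨hy, ht⟩
  -- Along any ultrafilter the solutions converge to a solution through `y`, which is `ψ y` by
  -- uniqueness. The dependence on time is controlled by the speed bound `C`.
  rw [ContinuousWithinAt, tendsto_iff_ultrafilter]
  intro 𝒰 h𝒰
  rw [nhdsWithin, le_inf_iff, le_principal_iff] at h𝒰
  obtain ⟨hlim, hmem⟩ := h𝒰
  have hmem' : ∀ᶠ q in (𝒰 : Filter (E × ℝ)), q.1 ∈ closedBall p₀ r ∧ q.2 ∈ Icc (-r) r := hmem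
  have hcl : ∀ s, ∃ z, s ∈ Icc (-r) r → Tendsto (fun q : E × ℝ => ψ q.1 s) 𝒰 (𝓝 z) := by
    intro s
    by_cases hs : s ∈ Icc (-r) r
    · obtain ⟨z, -, hz⟩ := (isCompact_closedBall p₀ R).ultrafilter_le_nhds
        (𝒰.map fun q => ψ q.1 s) (by
          rw [Ultrafilter.coe_map, le_principal_iff, mem_map]
          filter_upwards [hmem'] with q hq
          exact ((hψ q.1 hq.1).2 s hs).1)
      exact ⟨z, fun _ => hz⟩
    · exact ⟨0, fun h => absurd h hs⟩
  choose c₀ hc₀ using hcl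
  have hsol : IsSolutionOn X (closedBall p₀ R) c₀ (-r) r :=
    IsSolutionOn.of_tendsto (isCompact_closedBall p₀ R) h.continuousOn_field
      (hmem'.mono fun q hq => (hψ q.1 hq.1).2) hc₀
  have h0 : c₀ 0 = ψ y 0 := by
    rw [(hψ y hy).1]
    refine tendsto_nhds_unique (hc₀ 0 ⟨by linarith, hr.le⟩) ?_
    have h1 : Tendsto (fun q : E × ℝ => q.1) 𝒰 (𝓝 y) := (continuous_fst.tendsto (y, t)).comp hlim
    exact h1.congr' (hmem'.mono fun q hq => (hψ q.1 hq.1).1.symm)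
  have heq := h.eqOn_of_isSolutionOn hsep (neg_le_neg (min_le_left _ _)) (by linarith) hr.le
    (min_le_left _ _) hsol (hψ y hy).2 h0
  have h2 : Tendsto (fun q : E × ℝ => q.2) 𝒰 (𝓝 t) := (continuous_snd.tendsto (y, t)).comp hlim
  have h3 : Tendsto (fun q : E × ℝ => ψ q.1 q.2 - ψ q.1 t) 𝒰 (𝓝 0) := by
    refine squeeze_zero_norm' (a := fun q : E × ℝ => C * |q.2 - t|) ?_ ?_
    · filter_upwards [hmem'] with q hq
      exact (hψ q.1 hq.1).2.norm_sub_le hC ht hq.2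
    · have := ((h2.sub_const t).abs).const_mul C
      simpa using this
  have h4 := (hc₀ t ht).add h3
  rw [heq ht, add_zero] at h4
  exact h4.congr fun q => by simp

end LocalFlow

/-! ### Tangent vectors and line fields in charts -/

section Charts

variable {M : Type*} [TopologicalSpace M] [ChartedSpace (EuclideanSpace ℝ (Fin 3)) M]
  [IsManifold (𝓡 3) ∞ M]

local notation "𝔼" => EuclideanSpace ℝ (Fin 3)

/-- The frame of the tangent space at `φ⁻¹ p` induced by the chart `φ` at `x₀`. -/
noncomputable def chartFrame (x₀ : M) (p : 𝔼) :
    𝔼 →L[ℝ] TangentSpace (𝓡 3) ((extChartAt (𝓡 3) x₀).symm p) :=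
  (trivializationAt 𝔼 (TangentSpace (𝓡 3)) x₀).symmL ℝ ((extChartAt (𝓡 3) x₀).symm p)

lemma symm_mem_baseSet {x₀ : M} {p : 𝔼} (hp : p ∈ (extChartAt (𝓡 3) x₀).target) :
    (extChartAt (𝓡 3) x₀).symm p ∈ (trivializationAt 𝔼 (TangentSpace (𝓡 3)) x₀).baseSet := by
  rw [TangentBundle.trivializationAt_baseSet, ← extChartAt_source (𝓡 3)]
  exact (extChartAt (𝓡 3) x₀).map_target hp

/-- Links the trivialization, in which continuity of fields is expressed, with the derivatives of
curves and functions read in the chart. -/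
lemma hasMFDerivAt_chart_symm {x₀ : M} {p : 𝔼} (hp : p ∈ (extChartAt (𝓡 3) x₀).target) :
    HasMFDerivAt 𝓘(ℝ, 𝔼) (𝓡 3) (extChartAt (𝓡 3) x₀).symm p (chartFrame x₀ p) := by
  have h1 : (extChartAt (𝓡 3) x₀).symm p ∈ (chartAt 𝔼 x₀).source := by
    rw [← extChartAt_source (𝓡 3)]
    exact (extChartAt (𝓡 3) x₀).map_target hp
  have h2 := mdifferentiableWithinAt_extChartAt_symm (I := 𝓡 3) hp
  rw [ModelWithCorners.range_eq_univ, mdifferentiableWithinAt_univ] at h2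
  have h3 := TangentBundle.symmL_trivializationAt (I := 𝓡 3) h1
  rw [ModelWithCorners.range_eq_univ, mfderivWithin_univ, (extChartAt (𝓡 3) x₀).right_inv hp] at h3
  unfold chartFrame
  rw [h3]
  exact h2.hasMFDerivAt

lemma bijective_chartFrame {x₀ : M} {p : 𝔼} (hp : p ∈ (extChartAt (𝓡 3) x₀).target) :
    Function.Bijective (chartFrame x₀ p) := by
  have := ((trivializationAt 𝔼 (TangentSpace (𝓡 3)) x₀).continuousLinearEquivAt ℝ _
    (symm_mem_baseSet hp)).symm.bijective
  have h2 : ⇑(chartFrame x₀ p) = ⇑((trivializationAt 𝔼 (TangentSpace (𝓡 3)) x₀).continuousLinearEquivAt ℝ _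
    (symm_mem_baseSet hp)).symm := by
    exact (Bundle.Trivialization.symm_continuousLinearEquivAt_eq _ _).symm
  rw [h2]
  exact this

lemma HasMFDerivAt.comp_chart_symm {F : Type*} [NormedAddCommGroup F] [NormedSpace ℝ F]
    {x₀ : M} {p : 𝔼} (hp : p ∈ (extChartAt (𝓡 3) x₀).target) {u : M → F}
    {u' : TangentSpace (𝓡 3) ((extChartAt (𝓡 3) x₀).symm p) →L[ℝ] F}
    (hu : HasMFDerivAt (𝓡 3) 𝓘(ℝ, F) u ((extChartAt (𝓡 3) x₀).symm p) u') :
    HasFDerivAt (u ∘ (extChartAt (𝓡 3) x₀).symm) (u' ∘L chartFrame x₀ p) p := by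
  exact (hu.comp p (hasMFDerivAt_chart_symm hp)).hasFDerivAt

/-- Turns continuous functions on the tangent bundle, such as the length or the differential of an
embedding, into continuous functions of a chart point and a coordinate vector. -/
lemma continuousOn_mk_chartFrame (x₀ : M) :
    ContinuousOn (fun q : 𝔼 × 𝔼 => (⟨(extChartAt (𝓡 3) x₀).symm q.1, chartFrame x₀ q.1 q.2⟩ :
      TangentBundle (𝓡 3) M)) ((extChartAt (𝓡 3) x₀).target ×ˢ univ) := by
  have h1 := (trivializationAt 𝔼 (TangentSpace (𝓡 3)) x₀).continuousOn_symm
  have h2 : ContinuousOn (fun q : 𝔼 × 𝔼 => ((extChartAt (𝓡 3) x₀).symm q.1, q.2))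
      ((extChartAt (𝓡 3) x₀).target ×ˢ univ) :=
    ((continuousOn_extChartAt_symm x₀).comp continuousOn_fst fun q hq => hq.1).prodMk
      continuousOn_snd
  refine (h1.comp h2 fun q hq => ⟨symm_mem_baseSet hq.1, trivial⟩).congr fun q hq => ?_
  exact congrArg (Bundle.TotalSpace.mk _) (Bundle.Trivialization.symmL_apply _
    (symm_mem_baseSet hq.1) q.2)

lemma RiemMetric.continuous_len (g : RiemMetric M) :
    Continuous (fun q : TangentBundle (𝓡 3) M => g.len q.1 q.2) := by
  have h1 : Continuous (fun q : TangentBundle (𝓡 3) M =>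
      Bundle.TotalSpace.mk' ℝ (E := Bundle.Trivial M ℝ) q.1 (g.inner q.1 q.2 q.2)) :=
    Continuous.clm_bundle_apply₂ (F₁ := 𝔼) (F₂ := 𝔼) (F₃ := ℝ)
      (g.continuous.comp (FiberBundle.continuous_proj _ _)) continuous_id continuous_id
  simp only [continuous_iff_continuousAt, FiberBundle.continuousAt_totalSpace] at h1
  exact (continuous_iff_continuousAt.2 fun q => (h1 q).2).sqrt

lemma RiemMetric.len_smul (g : RiemMetric M) (x : M) (c : ℝ) (v : TangentSpace (𝓡 3) x) :
    g.len x (c • v) = |c| * g.len x v := by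
  unfold RiemMetric.len
  rw [map_smul, map_smul, smul_apply, smul_eq_mul, smul_eq_mul, ← mul_assoc, ← sq,
    Real.sqrt_mul (sq_nonneg c), Real.sqrt_sq_eq_abs]

lemma RiemMetric.len_neg (g : RiemMetric M) (x : M) (v : TangentSpace (𝓡 3) x) :
    g.len x (-v) = g.len x v := by
  have := g.len_smul x (-1) v
  simpa using this

lemma RiemMetric.len_pos (g : RiemMetric M) {x : M} {v : TangentSpace (𝓡 3) x} (hv : v ≠ 0) :
    0 < g.len x v := Real.sqrt_pos.2 (g.pos x v hv)

lemma RiemMetric.len_zero (g : RiemMetric M) (x : M) : g.len x 0 = 0 := by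
  simp [RiemMetric.len]

/-- Unit vectors on the same line agree up to sign. -/
lemma RiemMetric.eq_or_eq_neg (g : RiemMetric M) {x : M} {v w u : TangentSpace (𝓡 3) x}
    (hv : v ∈ Submodule.span ℝ {u}) (hw : w ∈ Submodule.span ℝ {u})
    (h : g.len x v = g.len x w) : v = w ∨ v = -w := by
  obtain ⟨a, rfl⟩ := Submodule.mem_span_singleton.1 hv
  obtain ⟨b, rfl⟩ := Submodule.mem_span_singleton.1 hw
  by_cases hu : u = 0
  · simp [hu]
  · rw [g.len_smul, g.len_smul] at h
    have := mul_right_cancel₀ (g.len_pos hu).ne' h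
    rcases abs_eq_abs.1 this with h | h
    · exact Or.inl (by rw [h])
    · exact Or.inr (by rw [h, neg_smul])

omit [IsManifold (𝓡 3) ∞ M] in
lemma ContinuousAt.of_chart {Y : Type*} [TopologicalSpace Y] {x₀ : M} {H : M → Y}
    (h : ContinuousAt (fun p => H ((extChartAt (𝓡 3) x₀).symm p)) (extChartAt (𝓡 3) x₀ x₀)) :
    ContinuousAt H x₀ := by
  have h1 : ContinuousAt (extChartAt (𝓡 3) x₀) x₀ := continuousAt_extChartAt x₀
  refine (ContinuousAt.comp (f := extChartAt (𝓡 3) x₀) h h1).congr ?_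
  filter_upwards [extChartAt_source_mem_nhds (I := 𝓡 3) x₀] with x hx
  exact congrArg H ((extChartAt (𝓡 3) x₀).left_inv hx)

/-- A continuous line field is spanned in charts by a continuous field of unit vectors. -/
lemma IsContinuousLineField.exists_chart_field {E : PlaneField M} (hE : IsContinuousLineField E)
    (g : RiemMetric M) (x₀ : M) :
    ∃ r > 0, Metric.closedBall (extChartAt (𝓡 3) x₀ x₀) r ⊆ (extChartAt (𝓡 3) x₀).target ∧
      ∃ X : 𝔼 → 𝔼, ContinuousOn X (Metric.closedBall (extChartAt (𝓡 3) x₀ x₀) r) ∧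
        ∀ p ∈ Metric.closedBall (extChartAt (𝓡 3) x₀ x₀) r,
          g.len _ (chartFrame x₀ p (X p)) = 1 ∧
          E ((extChartAt (𝓡 3) x₀).symm p) = Submodule.span ℝ {chartFrame x₀ p (X p)} := by
  obtain ⟨V, hVo, hxV, Y, hYc, hY⟩ := hE x₀
  set φ := extChartAt (𝓡 3) x₀
  have hopen : IsOpen (φ.target ∩ φ.symm ⁻¹' V) :=
    (continuousOn_extChartAt_symm x₀).isOpen_inter_preimage (isOpen_extChartAt_target x₀) hVo
  have hmem : φ x₀ ∈ φ.target ∩ φ.symm ⁻¹' V :=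
    ⟨mem_extChartAt_target x₀, by rwa [mem_preimage, extChartAt_to_inv x₀]⟩
  obtain ⟨r, hr, hball⟩ := Metric.nhds_basis_closedBall.mem_iff.1 (hopen.mem_nhds hmem)
  set 𝒯 := trivializationAt 𝔼 (TangentSpace (𝓡 3) (M := M)) x₀
  let Z : 𝔼 → 𝔼 := fun p => (𝒯 ⟨φ.symm p, Y (φ.symm p)⟩).2
  have hZc : ContinuousOn Z (Metric.closedBall (φ x₀) r) := by
    have h1 : ContinuousOn (fun p => (⟨φ.symm p, Y (φ.symm p)⟩ : TangentBundle (𝓡 3) M))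
        (Metric.closedBall (φ x₀) r) :=
      hYc.comp ((continuousOn_extChartAt_symm x₀).mono fun p hp => (hball hp).1)
        fun p hp => (hball hp).2
    refine continuous_snd.comp_continuousOn (𝒯.continuousOn.comp h1 fun p hp => ?_)
    rw [𝒯.mem_source]
    exact symm_mem_baseSet (hball hp).1
  have hZ : ∀ p ∈ Metric.closedBall (φ x₀) r, chartFrame x₀ p (Z p) = Y (φ.symm p) := by
    intro p hp
    have h1 := symm_mem_baseSet (hball hp).1
    have h2 := Bundle.Trivialization.symmL_continuousLinearMapAt (R := ℝ) 𝒯 h1 (Y (φ.symm p))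
    rw [Bundle.Trivialization.continuousLinearMapAt_apply_of_mem ℝ 𝒯 h1] at h2
    exact h2
  have hpos : ∀ p ∈ Metric.closedBall (φ x₀) r, 0 < g.len _ (chartFrame x₀ p (Z p)) :=
    fun p hp => g.len_pos (by rw [hZ p hp]; exact (hY _ (hball hp).2).1)
  have hlen : ContinuousOn (fun p => g.len _ (chartFrame x₀ p (Z p)))
      (Metric.closedBall (φ x₀) r) :=
    g.continuous_len.comp_continuousOn ((continuousOn_mk_chartFrame x₀).comp
      (continuousOn_id.prodMk hZc) fun p hp => ⟨(hball hp).1, trivial⟩)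
  refine ⟨r, hr, fun p hp => (hball hp).1, fun p => (g.len _ (chartFrame x₀ p (Z p)))⁻¹ • Z p,
    (hlen.inv₀ fun p hp => (hpos p hp).ne').smul hZc, fun p hp => ?_⟩
  have hp0 := hpos p hp
  refine ⟨?_, ?_⟩
  · rw [map_smul, g.len_smul, abs_of_pos (inv_pos.2 hp0), inv_mul_cancel₀ hp0.ne']
  · rw [map_smul, (hY _ (hball hp).2).2, hZ p hp,
      Submodule.span_singleton_smul_eq (IsUnit.mk0 _ (by rw [← hZ p hp]; exact (inv_pos.2 hp0).ne'))]

/-- A choice of unit vectors in a field of subspaces. -/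
def IsUnitSection (g : RiemMetric M) (E : PlaneField M) (v : ∀ x : M, TangentSpace (𝓡 3) x) :
    Prop := ∀ x, v x ∈ E x ∧ g.len x (v x) = 1 ∧ E x = Submodule.span ℝ {v x}

/-- The choice is made pointwise, since a line field that is not orientable has no continuous unit
section. Continuity is therefore claimed only for quantities that ignore the sign of the vector. -/
lemma IsContinuousLineField.exists_isUnitSection {E : PlaneField M}
    (hE : IsContinuousLineField E) (g : RiemMetric M) : ∃ v, IsUnitSection g E v := by
  have : ∀ x, ∃ v : TangentSpace (𝓡 3) x, v ∈ E x ∧ g.len x v = 1 ∧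
      E x = Submodule.span ℝ {v} := by
    intro x
    obtain ⟨V, hVo, hxV, Y, hYc, hY⟩ := hE x
    obtain ⟨h1, h2⟩ := hY x hxV
    have hp := g.len_pos h1
    refine ⟨(g.len x (Y x))⁻¹ • Y x, ?_, ?_, ?_⟩
    · rw [h2]; exact Submodule.smul_mem _ _ (Submodule.mem_span_singleton_self _)
    · rw [g.len_smul, abs_of_pos (inv_pos.2 hp), inv_mul_cancel₀ hp.ne']
    · rw [h2, Submodule.span_singleton_smul_eq (IsUnit.mk0 _ (inv_pos.2 hp).ne')]
  choose v hv using this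
  exact ⟨v, hv⟩

lemma IsUnitSection.eq_or_eq_neg {g : RiemMetric M} {E : PlaneField M}
    {v : ∀ x : M, TangentSpace (𝓡 3) x} (hv : IsUnitSection g E v) {x : M}
    {w : TangentSpace (𝓡 3) x} (hw : w ∈ E x) (hw1 : g.len x w = 1) : v x = w ∨ v x = -w :=
  g.eq_or_eq_neg (u := v x) (Submodule.mem_span_singleton_self _) ((hv x).2.2 ▸ hw)
    ((hv x).2.1.trans hw1.symm)

/-- A continuous even function of tangent vectors is continuous on the unit vectors of a
continuous line field. -/
lemma IsUnitSection.continuous {g : RiemMetric M} {E : PlaneField M}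
    {v : ∀ x : M, TangentSpace (𝓡 3) x} (hv : IsUnitSection g E v) (hE : IsContinuousLineField E)
    {Y : Type*} [TopologicalSpace Y] {G : TangentBundle (𝓡 3) M → Y} (hG : Continuous G)
    (heven : ∀ x (w : TangentSpace (𝓡 3) x), G ⟨x, -w⟩ = G ⟨x, w⟩) :
    Continuous fun x => G ⟨x, v x⟩ := by
  refine continuous_iff_continuousAt.2 fun x₀ => ContinuousAt.of_chart ?_
  obtain ⟨r, hr, hball, X, hXc, hX⟩ := hE.exists_chart_field g x₀
  have h1 : ContinuousOn (fun p => G ⟨_, chartFrame x₀ p (X p)⟩)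
      (Metric.closedBall (extChartAt (𝓡 3) x₀ x₀) r) :=
    hG.comp_continuousOn ((continuousOn_mk_chartFrame x₀).comp
      (continuousOn_id.prodMk hXc) fun p hp => ⟨hball hp, trivial⟩)
  refine (h1.congr fun p hp => ?_).continuousAt (Metric.closedBall_mem_nhds _ hr)
  obtain ⟨h2, h3⟩ := hX p hp
  rcases hv.eq_or_eq_neg (w := chartFrame x₀ p (X p))
    (by rw [h3]; exact Submodule.mem_span_singleton_self _) h2 with h | h
  · simp only [h]
  · simp only [h, heven]

end Charts

/-! ### Coordinates in a frame that is continuous up to signs -/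

section LeftInverse

variable {G F : Type*} [NormedAddCommGroup G] [InnerProductSpace ℝ G] [FiniteDimensional ℝ G]
  [NormedAddCommGroup F] [InnerProductSpace ℝ F] [FiniteDimensional ℝ F]

open ContinuousLinearMap in
/-- The Moore-Penrose left inverse of an injective linear map. -/
noncomputable def leftInv (B : G →L[ℝ] F) : F →L[ℝ] G :=
  (Ring.inverse (adjoint B ∘L B : G →L[ℝ] G)) ∘L adjoint B

open ContinuousLinearMap in
lemma isUnit_gram {B : G →L[ℝ] F} (hB : Function.Injective B) :
    IsUnit (adjoint B ∘L B : G →L[ℝ] G) := by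
  rw [ContinuousLinearMap.isUnit_iff_bijective]
  have hinj : Function.Injective (adjoint B ∘L B : G →L[ℝ] G) := by
    refine (injective_iff_map_eq_zero _).2 fun x hx => ?_
    have h1 : inner ℝ (B x) (B x) = 0 := by
      rw [← ContinuousLinearMap.adjoint_inner_left]
      have : adjoint B (B x) = 0 := hx
      rw [this, inner_zero_left]
    exact (injective_iff_map_eq_zero B).1 hB x (inner_self_eq_zero.1 h1)
  exact ⟨hinj, (LinearMap.injective_iff_surjective
    (f := ((adjoint B ∘L B : G →L[ℝ] G) : G →ₗ[ℝ] G))).1 hinj⟩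

lemma leftInv_apply {B : G →L[ℝ] F} (hB : Function.Injective B) (x : G) :
    leftInv B (B x) = x := by
  have := Ring.inverse_mul_cancel _ (isUnit_gram hB)
  exact congrArg (fun L : G →L[ℝ] G => L x) this

lemma continuousAt_leftInv {B : G →L[ℝ] F} (hB : Function.Injective B) :
    ContinuousAt (leftInv (G := G) (F := F)) B := by
  have h1 : Continuous fun B : G →L[ℝ] F => ContinuousLinearMap.adjoint B :=
    (ContinuousLinearMap.adjoint (𝕜 := ℝ) (E := G) (F := F)).continuous
  have h2 : Continuous fun B : G →L[ℝ] F => (ContinuousLinearMap.adjoint B ∘L B : G →L[ℝ] G) :=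
    h1.clm_comp continuous_id
  obtain ⟨u, hu⟩ := isUnit_gram hB
  have h3 : ContinuousAt (Ring.inverse : (G →L[ℝ] G) → _) (ContinuousLinearMap.adjoint B ∘L B) := by
    rw [← hu]; exact NormedRing.inverse_continuousAt u
  exact (ContinuousAt.comp (f := fun B : G →L[ℝ] F => ContinuousLinearMap.adjoint B ∘L B) h3
    h2.continuousAt).clm_comp h1.continuousAt

/-- The adjoint of an isometry is its inverse, so the Gram operator is merely conjugated. This
covariance, together with continuity in `B`, is the reason for using this particular left inverse.
-/
lemma leftInv_comp_isometry {B : G →L[ℝ] F} (hB : Function.Injective B) (U : G ≃ₗᵢ[ℝ] G) (w : F) :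
    leftInv (B ∘L (U.toContinuousLinearEquiv : G →L[ℝ] G)) w = U.symm (leftInv B w) := by
  set A : G →L[ℝ] G := (U.toContinuousLinearEquiv : G →L[ℝ] G) with hA
  obtain ⟨g, hg⟩ := isUnit_gram hB
  let u : (G →L[ℝ] G)ˣ := ContinuousLinearEquiv.toUnit U.toContinuousLinearEquiv
  have hadj : ContinuousLinearMap.adjoint A = (↑u⁻¹ : G →L[ℝ] G) := by
    refine ContinuousLinearMap.ext fun x => ?_
    refine ext_inner_right ℝ fun y => ?_
    rw [ContinuousLinearMap.adjoint_inner_left]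
    change inner ℝ x (U y) = inner ℝ (U.symm x) y
    rw [← U.inner_map_map (U.symm x) y, U.apply_symm_apply]
  have hgram : (ContinuousLinearMap.adjoint (B ∘L A) ∘L (B ∘L A) : G →L[ℝ] G)
      = ((u⁻¹ * g * u : (G →L[ℝ] G)ˣ) : G →L[ℝ] G) := by
    rw [ContinuousLinearMap.adjoint_comp, hadj, Units.val_mul, Units.val_mul, hg]
    rfl
  unfold leftInv
  rw [hgram, Ring.inverse_unit, ContinuousLinearMap.adjoint_comp, hadj, ← hg, Ring.inverse_unit]
  have : ((u⁻¹ * g * u)⁻¹ : (G →L[ℝ] G)ˣ) = u⁻¹ * g⁻¹ * u := by group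
  rw [this, Units.val_mul, Units.val_mul]
  have huu : ∀ z : G, (u : G →L[ℝ] G) ((↑u⁻¹ : G →L[ℝ] G) z) = z := fun z => U.apply_symm_apply z
  simp only [ContinuousLinearMap.comp_apply, mul_apply_eq_comp, huu]
  rfl

/-- The linear map that sends the standard basis to the vectors `d i`. -/
noncomputable def frameMap (d : Fin 3 → F) : EuclideanSpace ℝ (Fin 3) →L[ℝ] F :=
  ∑ i, (EuclideanSpace.proj i : EuclideanSpace ℝ (Fin 3) →L[ℝ] ℝ).smulRight (d i)

omit [FiniteDimensional ℝ F] in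
lemma frameMap_apply (d : Fin 3 → F) (c : EuclideanSpace ℝ (Fin 3)) :
    frameMap d c = ∑ i, c i • d i := by
  simp [frameMap]

omit [FiniteDimensional ℝ F] in
lemma continuous_frameMap : Continuous (frameMap (F := F)) := by
  have h : ∀ i, Continuous fun d : Fin 3 → F =>
      (EuclideanSpace.proj i : EuclideanSpace ℝ (Fin 3) →L[ℝ] ℝ).smulRight (d i) := fun i =>
    ((ContinuousLinearMap.smulRightL ℝ (EuclideanSpace ℝ (Fin 3)) F
      (EuclideanSpace.proj i)).continuous).comp (continuous_apply i)
  exact continuous_finsetSum _ fun i _ => h i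

omit [FiniteDimensional ℝ F] in
lemma frameMap_injective {d : Fin 3 → F} (hd : LinearIndependent ℝ d) :
    Function.Injective (frameMap d) := by
  refine (injective_iff_map_eq_zero _).2 fun c hc => ?_
  rw [frameMap_apply] at hc
  have := Fintype.linearIndependent_iff.1 hd (fun i => c i) hc
  ext i
  exact this i

/-- Changing signs in a frame composes `frameMap` with a diagonal isometry, which alters the
coordinates only by signs. -/
lemma abs_leftInv_frameMap_of_signs {d d' : Fin 3 → F} (hd : LinearIndependent ℝ d)
    (h : ∀ i, d' i = d i ∨ d' i = -d i) (w : F) (i : Fin 3) :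
    |leftInv (frameMap d') w i| = |leftInv (frameMap d) w i| := by
  classical
  let U : EuclideanSpace ℝ (Fin 3) ≃ₗᵢ[ℝ] EuclideanSpace ℝ (Fin 3) :=
    LinearIsometryEquiv.piLpCongrRight 2 fun i =>
      if d' i = d i then LinearIsometryEquiv.refl ℝ ℝ else LinearIsometryEquiv.neg ℝ
  have hU : frameMap d' = frameMap d ∘L (U.toContinuousLinearEquiv : _ →L[ℝ] _) := by
    ext c
    rw [ContinuousLinearMap.comp_apply, frameMap_apply, frameMap_apply]
    refine Finset.sum_congr rfl fun j _ => ?_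
    change c j • d' j = ((if d' j = d j then LinearIsometryEquiv.refl ℝ ℝ
      else LinearIsometryEquiv.neg ℝ) (c j)) • d j
    split_ifs with hj
    · rw [hj]; rfl
    · rw [(h j).resolve_left hj, smul_neg, ← neg_smul]; rfl
  rw [hU, leftInv_comp_isometry (frameMap_injective hd)]
  change |(if d' i = d i then LinearIsometryEquiv.refl ℝ ℝ
      else LinearIsometryEquiv.neg ℝ).symm (leftInv (frameMap d) w i)| = _
  split_ifs with hj
  · rfl
  · exact abs_neg _

/-- The coordinates with respect to a frame that is continuous up to signs are continuous up to
signs. -/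
lemma eventually_abs_leftInv_frameMap {M : Type*} [TopologicalSpace M] {x₀ : M}
    {d d' : M → Fin 3 → F} (hind : LinearIndependent ℝ (d x₀)) (hd' : ContinuousAt d' x₀)
    (h : ∀ᶠ x in 𝓝 x₀, ∀ i, d' x i = d x i ∨ d' x i = -d x i)
    (hli : ∀ x, LinearIndependent ℝ (d x)) {η : ℝ} (hη : 0 < η) :
    ∀ᶠ x in 𝓝 x₀, ∀ w i, |(|leftInv (frameMap (d x)) w i| - |leftInv (frameMap (d x₀)) w i|)| ≤
      η * ‖w‖ := by
  classical
  have h0 := h.self_of_nhds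
  have hind' : LinearIndependent ℝ (d' x₀) := by
    have : d' x₀ = fun i => (if d' x₀ i = d x₀ i then (1 : ℝˣ) else -1) • d x₀ i := by
      funext i
      rcases h0 i with hi | hi
      · simp [hi]
      · split_ifs with h1
        · simp [h1]
        · rw [hi, Units.smul_def, Units.val_neg, Units.val_one, neg_smul, one_smul]
    rw [this]
    exact hind.units_smul _
  have hc : ContinuousAt (fun x => leftInv (frameMap (d' x))) x₀ :=
    ContinuousAt.comp (f := fun x => frameMap (d' x)) (g := leftInv)
      (continuousAt_leftInv (frameMap_injective hind'))
      (continuous_frameMap.continuousAt.comp hd')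
  filter_upwards [h, Metric.continuousAt_iff'.1 hc η hη] with x hx hxη w i
  rw [← abs_leftInv_frameMap_of_signs (hli x) hx, ← abs_leftInv_frameMap_of_signs hind h0]
  refine (abs_abs_sub_abs_le _ _).trans ?_
  rw [← PiLp.sub_apply, ← Real.norm_eq_abs]
  refine (PiLp.norm_apply_le _ i).trans ?_
  rw [← sub_apply]
  refine (ContinuousLinearMap.le_opNorm _ _).trans ?_
  rw [dist_eq_norm] at hxη
  gcongr

end LeftInverse

/-! ### Frames adapted to a partially hyperbolic diffeomorphism -/

section AdaptedFrame

variable {M : Type*} [TopologicalSpace M] [ChartedSpace (EuclideanSpace ℝ (Fin 3)) M]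
  [IsManifold (𝓡 3) ∞ M]

local notation "𝔼" => EuclideanSpace ℝ (Fin 3)

/-- The derivative of a vector valued function, as a map to the vector space. -/
noncomputable def differential {F : Type*} [NormedAddCommGroup F] [NormedSpace ℝ F] (u : M → F)
    (x : M) : TangentSpace (𝓡 3) x →L[ℝ] F :=
  mfderiv (𝓡 3) 𝓘(ℝ, F) u x

lemma ContMDiff.continuous_differential {F : Type*} [NormedAddCommGroup F] [NormedSpace ℝ F]
    {u : M → F} (hu : ContMDiff (𝓡 3) 𝓘(ℝ, F) 1 u) :
    Continuous fun q : TangentBundle (𝓡 3) M => differential u q.1 q.2 := by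
  have h1 := hu.continuous_tangentMap le_rfl
  have h2 := (tangentBundleModelSpaceHomeomorph 𝓘(ℝ, F)).continuous.comp h1
  exact continuous_snd.comp h2

/-- The base point is kept in the form given by the inverse chart, rather than rewritten to `x₀`, so
that the differential and the frame live on the same tangent space without a cast. -/
lemma ContMDiff.hasStrictFDerivAt_chart {F : Type*} [NormedAddCommGroup F] [NormedSpace ℝ F]
    {u : M → F} {x₀ : M} (hu : ContMDiffAt (𝓡 3) 𝓘(ℝ, F) 1 u x₀) :
    HasStrictFDerivAt (u ∘ (extChartAt (𝓡 3) x₀).symm)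
      (differential u ((extChartAt (𝓡 3) x₀).symm (extChartAt (𝓡 3) x₀ x₀)) ∘L chartFrame x₀ (extChartAt (𝓡 3) x₀ x₀)) (extChartAt (𝓡 3) x₀ x₀) := by
  have h1 := (contMDiffAt_iff.1 hu).2
  rw [ModelWithCorners.range_eq_univ, contDiffWithinAt_univ] at h1
  have h2 : ContDiffAt ℝ 1 (u ∘ (extChartAt (𝓡 3) x₀).symm) (extChartAt (𝓡 3) x₀ x₀) := h1
  have h3 := h2.hasStrictFDerivAt one_ne_zero
  have h4 : MDifferentiableAt (𝓡 3) 𝓘(ℝ, F) u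
      ((extChartAt (𝓡 3) x₀).symm (extChartAt (𝓡 3) x₀ x₀)) := by
    rw [extChartAt_to_inv x₀]; exact hu.mdifferentiableAt one_ne_zero
  have h5 := HasMFDerivAt.comp_chart_symm (mem_extChartAt_target x₀) h4.hasMFDerivAt
  rw [h3.hasFDerivAt.unique h5] at h3
  exact h3

omit [IsManifold (𝓡 3) ∞ M] in
/-- Linear approximation of a `C¹` function in a chart. -/
lemma ContMDiffAt.eventually_norm_sub_le {F : Type*} [NormedAddCommGroup F] [NormedSpace ℝ F]
    {u : M → F} {x₀ : M} {N : 𝔼 →L[ℝ] F}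
    (hu : HasStrictFDerivAt (u ∘ (extChartAt (𝓡 3) x₀).symm) N (extChartAt (𝓡 3) x₀ x₀))
    {η : ℝ} (hη : 0 < η) :
    ∀ᶠ q : M × M in 𝓝 (x₀, x₀),
      ‖u q.2 - u q.1 - N (extChartAt (𝓡 3) x₀ q.2 - extChartAt (𝓡 3) x₀ q.1)‖ ≤
        η * ‖extChartAt (𝓡 3) x₀ q.2 - extChartAt (𝓡 3) x₀ q.1‖ := by
  set φ := extChartAt (𝓡 3) x₀
  have hφ : ContinuousAt φ x₀ := continuousAt_extChartAt x₀
  have h1 : Tendsto (fun q : M × M => (φ q.2, φ q.1)) (𝓝 (x₀, x₀)) (𝓝 (φ x₀, φ x₀)) := by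
    rw [nhds_prod_eq, nhds_prod_eq]
    exact ((hφ.tendsto.comp tendsto_snd).prodMk (hφ.tendsto.comp tendsto_fst))
  have h2 := h1.eventually (hu.isLittleO.def hη)
  have hs := extChartAt_source_mem_nhds (I := 𝓡 3) x₀
  filter_upwards [h2, prod_mem_nhds hs hs] with q hq hqs
  simp only [Function.comp_apply] at hq
  rw [(extChartAt (𝓡 3) x₀).left_inv hqs.1, (extChartAt (𝓡 3) x₀).left_inv hqs.2] at hq
  exact hq

/-- A frame of unit vectors, spanning three line fields, that a diffeomorphism rescales by
increasing factors `lam i`, together with an embedding of the manifold. -/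
structure IsAdaptedFrame {F : Type*} [NormedAddCommGroup F] [InnerProductSpace ℝ F]
    (f : M ≃ₘ^1⟮𝓡 3, 𝓡 3⟯ M) (g : RiemMetric M) (E : Fin 3 → PlaneField M)
    (v : Fin 3 → ∀ x : M, TangentSpace (𝓡 3) x) (lam : Fin 3 → M → ℝ) (e : M → F) : Prop where
  lineField : ∀ i, IsContinuousLineField (E i)
  unitSection : ∀ i, IsUnitSection g (E i) (v i)
  linearIndependent : ∀ x, LinearIndependent ℝ fun i => v i x
  continuous_lam : ∀ i, Continuous (lam i)
  lam_pos : ∀ i x, 0 < lam i x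
  lam_zero_lt : ∀ x, lam 0 x < lam 1 x
  lam_one_lt : ∀ x, lam 1 x < lam 2 x
  mfderiv_apply : ∀ i x, mfderiv (𝓡 3) (𝓡 3) f x (v i x) = lam i x • v i (f x) ∨
    mfderiv (𝓡 3) (𝓡 3) f x (v i x) = -(lam i x • v i (f x))
  contMDiff : ContMDiff (𝓡 3) 𝓘(ℝ, F) 1 e
  injective : Function.Injective e
  injective_differential : ∀ x, Function.Injective (differential e x)

/-- The coordinates of a vector of the ambient space with respect to the image of a frame. -/
noncomputable def frameCoord {F : Type*} [NormedAddCommGroup F] [InnerProductSpace ℝ F]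
    [FiniteDimensional ℝ F] (e : M → F) (v : Fin 3 → ∀ x : M, TangentSpace (𝓡 3) x) (x : M) :
    F →L[ℝ] 𝔼 :=
  leftInv (frameMap fun i => differential e x (v i x))

namespace IsAdaptedFrame

variable {F : Type*} [NormedAddCommGroup F] [InnerProductSpace ℝ F]
  {f : M ≃ₘ^1⟮𝓡 3, 𝓡 3⟯ M} {g : RiemMetric M} {E : Fin 3 → PlaneField M}
  {v : Fin 3 → ∀ x : M, TangentSpace (𝓡 3) x} {lam : Fin 3 → M → ℝ} {e : M → F}

lemma linearIndependent_differential (h : IsAdaptedFrame f g E v lam e) (x : M) :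
    LinearIndependent ℝ fun i => differential e x (v i x) :=
  (h.linearIndependent x).map' (differential e x).toLinearMap
    (LinearMap.ker_eq_bot.2 (h.injective_differential x))

lemma exists_coord (h : IsAdaptedFrame f g E v lam e) (x : M) (w : TangentSpace (𝓡 3) x) :
    ∃ ξ : 𝔼, w = ∑ i, ξ i • v i x := by
  have hb := (h.linearIndependent x).span_eq_top_of_card_eq_finrank (by
    show Fintype.card (Fin 3) = Module.finrank ℝ 𝔼
    simp)
  have hw : w ∈ Submodule.span ℝ (range fun i => v i x) := by rw [hb]; trivial
  obtain ⟨c, hc⟩ := (Submodule.mem_span_range_iff_exists_fun ℝ).1 hw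
  exact ⟨WithLp.toLp 2 c, hc.symm⟩

variable [FiniteDimensional ℝ F]

lemma frameCoord_differential (h : IsAdaptedFrame f g E v lam e) (x : M) (ξ : 𝔼) :
    frameCoord e v x (differential e x (∑ i, ξ i • v i x)) = ξ := by
  rw [map_sum]
  simp only [map_smul]
  have h1 := leftInv_apply (frameMap_injective (h.linearIndependent_differential x)) ξ
  rw [frameMap_apply] at h1
  exact h1

/-- Although `v` may be discontinuous, near `x₀` it agrees up to signs with continuous chart fields,
and absolute values of coordinates do not see the signs. -/
lemma eventually_abs_frameCoord (h : IsAdaptedFrame f g E v lam e) (x₀ : M) {η : ℝ}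
    (hη : 0 < η) : ∀ᶠ x in 𝓝 x₀, ∀ (w : F) i,
      |(|frameCoord e v x w i| - |frameCoord e v x₀ w i|)| ≤ η * ‖w‖ := by
  choose r hr hball X hXc hX using fun i => (h.lineField i).exists_chart_field g x₀
  set φ := extChartAt (𝓡 3) x₀
  let G : TangentBundle (𝓡 3) M → F := fun q => differential e q.1 q.2
  have hG : Continuous G := h.contMDiff.continuous_differential
  have hφ : ContinuousAt φ x₀ := continuousAt_extChartAt x₀
  refine eventually_abs_leftInv_frameMap
    (d' := fun x i => G ⟨φ.symm (φ x), chartFrame x₀ (φ x) (X i (φ x))⟩)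
    (h.linearIndependent_differential x₀) ?_ ?_ h.linearIndependent_differential hη
  · refine continuousAt_pi.2 fun i => ?_
    have h1 : ContinuousOn (fun p => G ⟨φ.symm p, chartFrame x₀ p (X i p)⟩)
        (Metric.closedBall (φ x₀) (r i)) :=
      hG.comp_continuousOn ((continuousOn_mk_chartFrame x₀).comp
        (continuousOn_id.prodMk (hXc i)) fun p hp => ⟨hball i hp, trivial⟩)
    exact ContinuousAt.comp (f := φ)
      (g := fun p => G ⟨φ.symm p, chartFrame x₀ p (X i p)⟩)
      (h1.continuousAt (Metric.closedBall_mem_nhds _ (hr i))) hφ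
  · have h2 : ∀ᶠ x in 𝓝 x₀, ∀ i, φ x ∈ Metric.closedBall (φ x₀) (r i) :=
      eventually_all.2 fun i => hφ (Metric.closedBall_mem_nhds _ (hr i))
    filter_upwards [h2, extChartAt_source_mem_nhds (I := 𝓡 3) x₀] with x hx hxs i
    have h3 : G ⟨x, v i x⟩ = G ⟨φ.symm (φ x), v i (φ.symm (φ x))⟩ := by rw [φ.left_inv hxs]
    change G _ = G ⟨x, v i x⟩ ∨ G _ = - G ⟨x, v i x⟩
    rw [h3]
    have h4 := hX i (φ x) (hx i)
    rcases (h.unitSection i).eq_or_eq_neg (w := chartFrame x₀ (φ x) (X i (φ x)))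
      (by rw [h4.2]; exact Submodule.mem_span_singleton_self _) h4.1 with h5 | h5
    · left; rw [h5]
    · right
      rw [h5]
      exact ((congrArg Neg.neg (map_neg (differential e (φ.symm (φ x)))
        (chartFrame x₀ (φ x) (X i (φ x))))).trans (neg_neg _)).symm

/-- The coordinates of a difference of values of a `C¹` function. -/
lemma eventually_abs_frameCoord_sub (h : IsAdaptedFrame f g E v lam e) {x₀ : M} {u : M → F}
    {k : M → M} {N : 𝔼 →L[ℝ] F} (hk : ContinuousAt k x₀)
    (hu : HasStrictFDerivAt (u ∘ (extChartAt (𝓡 3) x₀).symm) N (extChartAt (𝓡 3) x₀ x₀))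
    {η : ℝ} (hη : 0 < η) :
    ∀ᶠ q : M × M in 𝓝 (x₀, x₀), ∀ i,
      |(|frameCoord e v (k q.1) (u q.2 - u q.1) i| - |frameCoord e v (k x₀)
        (N (extChartAt (𝓡 3) x₀ q.2 - extChartAt (𝓡 3) x₀ q.1)) i|)| ≤
        η * ‖extChartAt (𝓡 3) x₀ q.2 - extChartAt (𝓡 3) x₀ q.1‖ := by
  set A := frameCoord e v (k x₀)
  set K : ℝ := ‖N‖ + 1 + ‖A‖ with hK
  have hKpos : 0 < K := by positivity
  set η' := min 1 (η / K)
  have hη' : 0 < η' := lt_min one_pos (by positivity)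
  have h1 := hk.eventually (h.eventually_abs_frameCoord (k x₀) hη')
  have h2 : ∀ᶠ q : M × M in 𝓝 (x₀, x₀), _ := (continuousAt_fst (p := (x₀, x₀))).eventually h1
  filter_upwards [h2, ContMDiffAt.eventually_norm_sub_le hu hη'] with q h3 h4 i
  set Δ := extChartAt (𝓡 3) x₀ q.2 - extChartAt (𝓡 3) x₀ q.1
  set w := u q.2 - u q.1
  have hw : ‖w‖ ≤ (‖N‖ + 1) * ‖Δ‖ := by
    calc ‖w‖ = ‖(w - N Δ) + N Δ‖ := by rw [sub_add_cancel]
      _ ≤ ‖w - N Δ‖ + ‖N Δ‖ := norm_add_le _ _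
      _ ≤ 1 * ‖Δ‖ + ‖N‖ * ‖Δ‖ := by
        gcongr
        · exact h4.trans (by gcongr; exact min_le_left _ _)
        · exact N.le_opNorm _
      _ = _ := by ring
  have h6 : |(|A w i| - |A (N Δ) i|)| ≤ ‖A‖ * (η' * ‖Δ‖) := by
    refine (abs_abs_sub_abs_le _ _).trans ?_
    rw [← PiLp.sub_apply, ← Real.norm_eq_abs, ← map_sub]
    exact (PiLp.norm_apply_le _ i).trans ((A.le_opNorm _).trans (by gcongr))
  calc _ ≤ |(|frameCoord e v (k q.1) w i| - |A w i|)| + |(|A w i| - |A (N Δ) i|)| :=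
        abs_sub_le _ _ _
    _ ≤ η' * ((‖N‖ + 1) * ‖Δ‖) + ‖A‖ * (η' * ‖Δ‖) := by
        gcongr
        exact (h3 w i).trans (by gcongr)
    _ = η' * K * ‖Δ‖ := by rw [hK]; ring
    _ ≤ η * ‖Δ‖ := by
        gcongr
        calc η' * K ≤ η / K * K := by gcongr; exact min_le_right _ _
          _ = η := by field_simp

end IsAdaptedFrame

end AdaptedFrame

/-! ### Cone estimates for differences of nearby points -/

section CoordinateGap

variable {M : Type*} [TopologicalSpace M] [ChartedSpace (EuclideanSpace ℝ (Fin 3)) M]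
  [IsManifold (𝓡 3) ∞ M]

local notation "𝔼" => EuclideanSpace ℝ (Fin 3)

lemma ContinuousLinearMap.exists_lower_bound {G F : Type*} [NormedAddCommGroup G] [NormedSpace ℝ G]
    [FiniteDimensional ℝ G] [NormedAddCommGroup F] [NormedSpace ℝ F] (L : G →L[ℝ] F)
    (hL : Function.Injective L) : ∃ c > 0, ∀ w, c * ‖w‖ ≤ ‖L w‖ := by
  obtain ⟨K, hK, h⟩ := LinearMap.exists_antilipschitzWith (L : G →ₗ[ℝ] F)
    (LinearMap.ker_eq_bot.2 hL)
  have hK' : (0 : ℝ) < K := hK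
  refine ⟨(K : ℝ)⁻¹, inv_pos.2 hK', fun w => ?_⟩
  have h1 : ‖w‖ ≤ K * ‖L w‖ := by simpa using h.le_mul_dist w 0
  rw [inv_mul_le_iff₀ hK']
  exact h1

variable {F : Type*} [NormedAddCommGroup F] [InnerProductSpace ℝ F] [FiniteDimensional ℝ F]

/-- The absolute values of the coordinates, in the frame at `x`, of the difference of the images
of `x` and `y` in the ambient space. -/
noncomputable def coordGap (e : M → F) (v : Fin 3 → ∀ x : M, TangentSpace (𝓡 3) x) (x y : M)
    (i : Fin 3) : ℝ :=
  |frameCoord e v x (e y - e x) i|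

/-- The coordinates in the frame at `x₀` of the tangent vectors given by a chart. -/
noncomputable def chartCoord (e : M → F) (v : Fin 3 → ∀ x : M, TangentSpace (𝓡 3) x) (x₀ : M) :
    𝔼 →L[ℝ] 𝔼 :=
  frameCoord e v x₀ ∘L
    (differential e ((extChartAt (𝓡 3) x₀).symm (extChartAt (𝓡 3) x₀ x₀)) ∘L
      chartFrame x₀ (extChartAt (𝓡 3) x₀ x₀))

namespace IsAdaptedFrame

variable {f : M ≃ₘ^1⟮𝓡 3, 𝓡 3⟯ M} {g : RiemMetric M} {E : Fin 3 → PlaneField M}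
  {v : Fin 3 → ∀ x : M, TangentSpace (𝓡 3) x} {lam : Fin 3 → M → ℝ} {e : M → F}

lemma chartCoord_eq (h : IsAdaptedFrame f g E v lam e) (x₀ : M) {w ξ : 𝔼}
    (hw : chartFrame x₀ (extChartAt (𝓡 3) x₀ x₀) w =
      ∑ i, ξ i • v i ((extChartAt (𝓡 3) x₀).symm (extChartAt (𝓡 3) x₀ x₀))) :
    chartCoord e v x₀ w = ξ := by
  have h1 := h.frameCoord_differential
    ((extChartAt (𝓡 3) x₀).symm (extChartAt (𝓡 3) x₀ x₀)) ξ
  rw [← hw] at h1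
  conv at h1 =>
    lhs
    arg 1
    rw [extChartAt_to_inv x₀]
  exact h1

lemma injective_chartCoord (h : IsAdaptedFrame f g E v lam e) (x₀ : M) :
    Function.Injective (chartCoord e v x₀) := by
  refine (injective_iff_map_eq_zero _).2 fun w hw => ?_
  obtain ⟨ξ, hξ⟩ := h.exists_coord _ (chartFrame x₀ (extChartAt (𝓡 3) x₀ x₀) w)
  have h1 := h.chartCoord_eq x₀ hξ
  rw [hw] at h1
  refine (injective_iff_map_eq_zero _).1
    (bijective_chartFrame (mem_extChartAt_target x₀)).1 w ?_
  rw [hξ, ← h1]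
  exact Finset.sum_eq_zero fun i _ => zero_smul ℝ _

/-- First-order expansion: near `x₀`, estimates on pairs of points reduce to estimates on the fixed
linear map `chartCoord e v x₀`. -/
lemma eventually_coordGap (h : IsAdaptedFrame f g E v lam e) (x₀ : M) {η : ℝ} (hη : 0 < η) :
    ∀ᶠ q : M × M in 𝓝 (x₀, x₀), ∀ i, |coordGap e v q.1 q.2 i -
      (|chartCoord e v x₀ (extChartAt (𝓡 3) x₀ q.2 - extChartAt (𝓡 3) x₀ q.1) i|)| ≤
        η * ‖extChartAt (𝓡 3) x₀ q.2 - extChartAt (𝓡 3) x₀ q.1‖ :=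
  h.eventually_abs_frameCoord_sub (k := id) continuousAt_id
    (ContMDiff.hasStrictFDerivAt_chart h.contMDiff.contMDiffAt) hη

/-- The derivative of `f` is diagonal in the adapted frame, with entries `lam i` up to sign, and the
signs drop out of the absolute values. -/
lemma abs_frameCoord_image (h : IsAdaptedFrame f g E v lam e) (x₀ : M) (w : 𝔼) (i : Fin 3) :
    |frameCoord e v (f x₀) ((differential (e ∘ f)
      ((extChartAt (𝓡 3) x₀).symm (extChartAt (𝓡 3) x₀ x₀)) ∘L
      chartFrame x₀ (extChartAt (𝓡 3) x₀ x₀)) w) i| = lam i x₀ * |chartCoord e v x₀ w i| := by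
  have hy : (extChartAt (𝓡 3) x₀).symm (extChartAt (𝓡 3) x₀ x₀) = x₀ := extChartAt_to_inv x₀
  obtain ⟨ξ, hξ⟩ := h.exists_coord _ (chartFrame x₀ (extChartAt (𝓡 3) x₀ x₀) w)
  rw [h.chartCoord_eq x₀ hξ, ContinuousLinearMap.comp_apply, hξ]
  set y := (extChartAt (𝓡 3) x₀).symm (extChartAt (𝓡 3) x₀ x₀)
  have h1 : differential (e ∘ f) y = differential e (f y) ∘L mfderiv (𝓡 3) (𝓡 3) f y :=
    mfderiv_comp y (h.contMDiff.mdifferentiableAt one_ne_zero)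
      (f.contMDiff.mdifferentiableAt one_ne_zero)
  choose σ hσ hσ1 using fun i => (show ∃ σ : ℝ, mfderiv (𝓡 3) (𝓡 3) f y (v i y) =
      (σ * lam i y) • v i (f y) ∧ |σ| = 1 from by
    rcases h.mfderiv_apply i y with h | h
    · exact ⟨1, by rw [h, one_mul], by simp⟩
    · exact ⟨-1, by rw [h, neg_one_mul, neg_smul], by simp⟩)
  let ζ : 𝔼 := WithLp.toLp 2 fun i => ξ i * (σ i * lam i y)
  have h2 : mfderiv (𝓡 3) (𝓡 3) f y (∑ i, ξ i • v i y) = ∑ i, ζ i • v i (f y) := by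
    rw [map_sum]
    refine Finset.sum_congr rfl fun j _ => ?_
    rw [map_smul, hσ, smul_smul]
  have h3 := h.frameCoord_differential (f y) ζ
  rw [h1, ContinuousLinearMap.comp_apply, h2, ← hy, h3]
  change |ξ i * (σ i * lam i y)| = _
  rw [abs_mul, abs_mul, hσ1, one_mul, abs_of_pos (h.lam_pos i y), mul_comm]

lemma eventually_coordGap_image (h : IsAdaptedFrame f g E v lam e) (x₀ : M) {η : ℝ} (hη : 0 < η) :
    ∀ᶠ q : M × M in 𝓝 (x₀, x₀), ∀ i, |coordGap e v (f q.1) (f q.2) i - lam i x₀ *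
      (|chartCoord e v x₀ (extChartAt (𝓡 3) x₀ q.2 - extChartAt (𝓡 3) x₀ q.1) i|)| ≤
        η * ‖extChartAt (𝓡 3) x₀ q.2 - extChartAt (𝓡 3) x₀ q.1‖ := by
  have h1 := h.eventually_abs_frameCoord_sub (k := f) (x₀ := x₀) f.continuous.continuousAt
    (ContMDiff.hasStrictFDerivAt_chart (u := e ∘ f) (h.contMDiff.comp f.contMDiff).contMDiffAt) hη
  simp only [h.abs_frameCoord_image] at h1
  exact h1

/-- The derivative of `e` in the chart is injective on a finite-dimensional space, hence bounded
below; so chart distance and ambient distance are comparable. -/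
lemma exists_eventually_norm_equiv (h : IsAdaptedFrame f g E v lam e) (x₀ : M) :
    ∃ K > 0, ∀ᶠ q : M × M in 𝓝 (x₀, x₀),
      ‖extChartAt (𝓡 3) x₀ q.2 - extChartAt (𝓡 3) x₀ q.1‖ ≤ K * ‖e q.1 - e q.2‖ ∧
      ‖e q.1 - e q.2‖ ≤ K * ‖extChartAt (𝓡 3) x₀ q.2 - extChartAt (𝓡 3) x₀ q.1‖ := by
  have hs := ContMDiff.hasStrictFDerivAt_chart (u := e) (x₀ := x₀) h.contMDiff.contMDiffAt
  set N := differential e ((extChartAt (𝓡 3) x₀).symm (extChartAt (𝓡 3) x₀ x₀)) ∘L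
    chartFrame x₀ (extChartAt (𝓡 3) x₀ x₀) with hN
  have hNinj : Function.Injective N := fun a b hab =>
    h.injective_chartCoord x₀ (congrArg (frameCoord e v x₀) hab)
  obtain ⟨c, hc, hcN⟩ := N.exists_lower_bound hNinj
  refine ⟨max (2 / c) (‖N‖ + c / 2), lt_max_of_lt_left (by positivity), ?_⟩
  filter_upwards [ContMDiffAt.eventually_norm_sub_le hs (half_pos hc)] with q hq
  set Δ := extChartAt (𝓡 3) x₀ q.2 - extChartAt (𝓡 3) x₀ q.1
  rw [norm_sub_rev (e q.1)]
  have h1 := hcN Δ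
  have h2 := N.le_opNorm Δ
  have h3 := norm_sub_norm_le (N Δ) (e q.2 - e q.1)
  have h4 := norm_sub_norm_le (e q.2 - e q.1) (N Δ)
  rw [norm_sub_rev (N Δ)] at h3
  constructor
  · calc ‖Δ‖ = 2 / c * (c / 2 * ‖Δ‖) := by field_simp
      _ ≤ 2 / c * ‖e q.2 - e q.1‖ := by gcongr; linarith
      _ ≤ _ := by gcongr; exact le_max_left _ _
  · calc _ ≤ (‖N‖ + c / 2) * ‖Δ‖ := by linarith
      _ ≤ _ := by gcongr; exact le_max_right _ _

lemma sum_abs_chartCoord_lower (h : IsAdaptedFrame f g E v lam e) (x₀ : M) :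
    ∃ c > 0, ∀ w, c * ‖w‖ ≤ |chartCoord e v x₀ w 0| + (|chartCoord e v x₀ w 1| +
      |chartCoord e v x₀ w 2|) := by
  obtain ⟨c, hc, hcL⟩ := (chartCoord e v x₀).exists_lower_bound (h.injective_chartCoord x₀)
  refine ⟨c, hc, fun w => (hcL w).trans ?_⟩
  rw [EuclideanSpace.norm_eq, Fin.sum_univ_three]
  simp only [Real.norm_eq_abs]
  refine Real.sqrt_le_iff.2 ⟨by positivity, ?_⟩
  have := abs_nonneg (chartCoord e v x₀ w 0)
  have := abs_nonneg (chartCoord e v x₀ w 1)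
  have := abs_nonneg (chartCoord e v x₀ w 2)
  nlinarith [mul_nonneg (abs_nonneg (chartCoord e v x₀ w 0)) (abs_nonneg (chartCoord e v x₀ w 1)),
    mul_nonneg (abs_nonneg (chartCoord e v x₀ w 0)) (abs_nonneg (chartCoord e v x₀ w 2)),
    mul_nonneg (abs_nonneg (chartCoord e v x₀ w 1)) (abs_nonneg (chartCoord e v x₀ w 2))]

lemma eventually_coordGap_comparable (h : IsAdaptedFrame f g E v lam e) (x₀ : M) :
    ∃ c > 0, ∀ᶠ q : M × M in 𝓝 (x₀, x₀),
      c * ‖e q.1 - e q.2‖ ≤ coordGap e v q.1 q.2 0 +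
        (coordGap e v q.1 q.2 1 + coordGap e v q.1 q.2 2) ∧
      c * (coordGap e v q.1 q.2 1 + coordGap e v q.1 q.2 2) ≤ ‖e q.1 - e q.2‖ := by
  obtain ⟨K, hK, hKe⟩ := h.exists_eventually_norm_equiv x₀
  obtain ⟨c, hc, hcL⟩ := h.sum_abs_chartCoord_lower x₀
  set L := chartCoord e v x₀
  set B : ℝ := 2 * (‖L‖ + c / 6) * K with hB
  have hBpos : 0 < B := by positivity
  refine ⟨min (c / 2 / K) B⁻¹, lt_min (by positivity) (by positivity), ?_⟩
  -- Three coordinates with error `c / 6` each lose at most half of the lower bound `c`.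
  filter_upwards [hKe, h.eventually_coordGap x₀ (show 0 < c / 6 by positivity)] with q hq hg
  set Δ := extChartAt (𝓡 3) x₀ q.2 - extChartAt (𝓡 3) x₀ q.1
  have hLi : ∀ i, |L Δ i| ≤ ‖L‖ * ‖Δ‖ := fun i => by
    rw [← Real.norm_eq_abs]
    exact (PiLp.norm_apply_le _ i).trans (L.le_opNorm _)
  have h0 := abs_le.1 (hg 0)
  have h1 := abs_le.1 (hg 1)
  have h2 := abs_le.1 (hg 2)
  have hΔ := hcL Δ
  have := hLi 1
  have := hLi 2
  constructor
  · calc _ ≤ c / 2 / K * (K * ‖Δ‖) := by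
          gcongr
          · exact min_le_left _ _
          · exact hq.2
      _ = c / 2 * ‖Δ‖ := by field_simp
      _ ≤ _ := by linarith
  · calc _ ≤ B⁻¹ * (2 * (‖L‖ + c / 6) * (K * ‖e q.1 - e q.2‖)) := by
          refine mul_le_mul (min_le_right _ _) ?_
            (add_nonneg (abs_nonneg _) (abs_nonneg _)) (by positivity)
          refine le_trans ?_ (mul_le_mul_of_nonneg_left hq.1 (by positivity))
          linarith
      _ = _ := by rw [hB]; field_simp

/-- The one-step estimate behind the cone argument. Linearisation gives the rate at `x₀`, and
continuity of `lam i` replaces it by the rate at the moving point. -/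
lemma eventually_coordGap_scaling (h : IsAdaptedFrame f g E v lam e) (x₀ : M) {η : ℝ}
    (hη : 0 < η) : ∀ᶠ q : M × M in 𝓝 (x₀, x₀), ∀ i,
      |coordGap e v (f q.1) (f q.2) i - lam i q.1 * coordGap e v q.1 q.2 i| ≤
        η * ‖e q.1 - e q.2‖ := by
  refine eventually_all.2 fun i => ?_
  obtain ⟨K, hK, hKe⟩ := h.exists_eventually_norm_equiv x₀
  set L := chartCoord e v x₀
  set B : ℝ := (2 + lam i x₀ + ‖L‖) * K with hB
  have hl := h.lam_pos i x₀
  have hBpos : 0 < B := by positivity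
  set η' := min 1 (η / B)
  have hη' : 0 < η' := lt_min one_pos (by positivity)
  have hlam : ∀ᶠ q : M × M in 𝓝 (x₀, x₀), |lam i q.1 - lam i x₀| ≤ η' := by
    have h1 := ((h.continuous_lam i).comp continuous_fst).continuousAt (x := (x₀, x₀))
    filter_upwards [Metric.continuousAt_iff'.1 h1 η' hη'] with q hq
    exact hq.le
  filter_upwards [hKe, hlam, h.eventually_coordGap x₀ hη', h.eventually_coordGap_image x₀ hη']
    with q hq hlq h1 h2
  set Δ := extChartAt (𝓡 3) x₀ q.2 - extChartAt (𝓡 3) x₀ q.1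
  have hLi : |L Δ i| ≤ ‖L‖ * ‖Δ‖ := by
    rw [← Real.norm_eq_abs]
    exact (PiLp.norm_apply_le _ i).trans (L.le_opNorm _)
  have h3 := h1 i
  have h4 : |coordGap e v q.1 q.2 i| ≤ (‖L‖ + 1) * ‖Δ‖ := by
    rw [abs_of_nonneg (show 0 ≤ coordGap e v q.1 q.2 i from abs_nonneg _)]
    have := (abs_le.1 h3).2
    have : η' * ‖Δ‖ ≤ 1 * ‖Δ‖ := by gcongr; exact min_le_left _ _
    linarith
  have h5 : coordGap e v (f q.1) (f q.2) i - lam i q.1 * coordGap e v q.1 q.2 i =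
      (coordGap e v (f q.1) (f q.2) i - lam i x₀ * |L Δ i|) -
      lam i x₀ * (coordGap e v q.1 q.2 i - |L Δ i|) -
      (lam i q.1 - lam i x₀) * coordGap e v q.1 q.2 i := by ring
  calc _ ≤ |coordGap e v (f q.1) (f q.2) i - lam i x₀ * (|L Δ i|)| +
        |lam i x₀ * (coordGap e v q.1 q.2 i - |L Δ i|)| +
        |(lam i q.1 - lam i x₀) * coordGap e v q.1 q.2 i| := by
        rw [h5]
        exact (abs_sub _ _).trans (add_le_add_left (abs_sub _ _) _)
    _ ≤ η' * ‖Δ‖ + lam i x₀ * (η' * ‖Δ‖) + η' * ((‖L‖ + 1) * ‖Δ‖) := by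
        rw [abs_mul, abs_mul, abs_of_pos hl]
        gcongr
        exact h2 i
    _ = η' * ((2 + lam i x₀ + ‖L‖) * ‖Δ‖) := by ring
    _ ≤ η / B * ((2 + lam i x₀ + ‖L‖) * (K * ‖e q.1 - e q.2‖)) := by
        gcongr
        · exact min_le_right _ _
        · exact hq.1
    _ = η * ‖e q.1 - e q.2‖ := by rw [hB]; field_simp

/-- Pairs of points near `x₀` whose chart difference is close to the kernel of `H` lie in the
center-unstable cone. -/
lemma exists_coordGap_le (h : IsAdaptedFrame f g E v lam e) (x₀ : M) (H : 𝔼 →L[ℝ] ℝ)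
    (hH : ∀ w, H w = 0 → chartFrame x₀ (extChartAt (𝓡 3) x₀ x₀) w ∈
      E 1 ((extChartAt (𝓡 3) x₀).symm (extChartAt (𝓡 3) x₀ x₀)) ⊔
      E 2 ((extChartAt (𝓡 3) x₀).symm (extChartAt (𝓡 3) x₀ x₀))) :
    ∃ η₀ > 0, ∀ᶠ q : M × M in 𝓝 (x₀, x₀),
      |H (extChartAt (𝓡 3) x₀ q.2 - extChartAt (𝓡 3) x₀ q.1)| ≤
        η₀ * ‖extChartAt (𝓡 3) x₀ q.2 - extChartAt (𝓡 3) x₀ q.1‖ →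
      coordGap e v q.1 q.2 0 ≤ coordGap e v q.1 q.2 1 + coordGap e v q.1 q.2 2 := by
  obtain ⟨c, hc, hcL⟩ := h.sum_abs_chartCoord_lower x₀
  set L := chartCoord e v x₀
  have hker : ∀ w, H w = 0 → L w 0 = 0 := by
    intro w hw
    obtain ⟨y, hy, z, hz, hyz⟩ := Submodule.mem_sup.1 (hH w hw)
    rw [(h.unitSection 1 _).2.2] at hy
    rw [(h.unitSection 2 _).2.2] at hz
    obtain ⟨α, rfl⟩ := Submodule.mem_span_singleton.1 hy
    obtain ⟨β, rfl⟩ := Submodule.mem_span_singleton.1 hz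
    have := h.chartCoord_eq x₀ (w := w) (ξ := !₂[0, α, β]) (by
      rw [← hyz, Fin.sum_univ_three]
      change _ = (0 : ℝ) • v 0 _ + α • v 1 _ + β • v 2 _
      rw [zero_smul, zero_add])
    change chartCoord e v x₀ w 0 = 0
    rw [this]; rfl
  -- A functional that vanishes on the kernel of `H` is a multiple of `H`, also in the degenerate
  -- case `H = 0`.
  obtain ⟨C, hC⟩ : ∃ C : ℝ, ∀ w, L w 0 = C * H w := by
    by_cases hz : ∃ u, H u ≠ 0
    · obtain ⟨u, hu⟩ := hz
      refine ⟨L u 0 / H u, fun w => ?_⟩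
      have := hker (w - (H w / H u) • u) (by
        rw [map_sub, map_smul, smul_eq_mul, div_mul_cancel₀ _ hu, sub_self])
      rw [map_sub, map_smul, PiLp.sub_apply, PiLp.smul_apply, smul_eq_mul] at this
      rw [sub_eq_zero.1 this]; ring
    · push Not at hz
      exact ⟨0, fun w => by rw [hker w (hz w), zero_mul]⟩
  -- The stable coordinate is then at most `c / 4` times the distance, so the other two sum to at
  -- least `3 * c / 4` times it. Errors of `c / 6` per coordinate leave exactly `5 * c / 12` on both
  -- sides.
  refine ⟨c / (4 * (|C| + 1)), by positivity, ?_⟩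
  filter_upwards [h.eventually_coordGap x₀ (show 0 < c / 6 by positivity)] with q hg hq
  set Δ := extChartAt (𝓡 3) x₀ q.2 - extChartAt (𝓡 3) x₀ q.1
  have h0 := abs_le.1 (hg 0)
  have h1 := abs_le.1 (hg 1)
  have h2 := abs_le.1 (hg 2)
  have hΔ := hcL Δ
  have h3 : |L Δ 0| ≤ c / 4 * ‖Δ‖ := by
    rw [hC, abs_mul]
    calc |C| * |H Δ| ≤ (|C| + 1) * (c / (4 * (|C| + 1)) * ‖Δ‖) := by gcongr; linarith
      _ = c / 4 * ‖Δ‖ := by field_simp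
  linarith

variable [CompactSpace M]

omit [FiniteDimensional ℝ F] in
/-- The strongest contraction rates are uniformly bounded by a constant less than one. -/
lemma exists_lam_zero_le (h : IsAdaptedFrame f g E v lam e) (h1 : ∀ x, lam 0 x < 1) :
    ∃ κ, 0 < κ ∧ κ < 1 ∧ ∀ x, lam 0 x ≤ κ := by
  rcases isEmpty_or_nonempty M with hM | hM
  · exact ⟨1 / 2, by norm_num, by norm_num, fun x => isEmptyElim x⟩
  · obtain ⟨q, -, hq⟩ := isCompact_univ.exists_isMaxOn univ_nonempty
      (h.continuous_lam 0).continuousOn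
    exact ⟨lam 0 q, h.lam_pos 0 q, h1 q, fun x => hq (mem_univ x)⟩

/-- Stably related points whose difference lies in the center-unstable cone coincide. -/
lemma exists_separation (h : IsAdaptedFrame f g E v lam e) {κ : ℝ} (hκ : ∀ x, lam 0 x ≤ κ)
    (hκ1 : κ ≤ 1) : ∃ ε > 0, ∀ x y, StableRel e f (lam 0) ε x y →
      coordGap e v x y 0 ≤ coordGap e v x y 1 + coordGap e v x y 2 → x = y := by
  refine exists_stableRel_separation h.contMDiff.continuous h.injective (mu := lam 1)
    (a := fun x y => coordGap e v x y 0)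
    (b := fun x y => coordGap e v x y 1 + coordGap e v x y 2) (h.lam_pos 0) hκ hκ1
    (h.continuous_lam 0) (h.continuous_lam 1) h.lam_zero_lt h.eventually_coordGap_comparable
    (fun x y => add_nonneg (abs_nonneg _) (abs_nonneg _)) fun x η hη => ?_
  filter_upwards [h.eventually_coordGap_scaling x (half_pos hη)] with q hq
  have h0 := abs_le.1 (hq 0)
  have h1 := abs_le.1 (hq 1)
  have h2 := abs_le.1 (hq 2)
  -- The center rate bounds both rates of the center-unstable part from below.
  have h3 : lam 1 q.1 * coordGap e v q.1 q.2 2 ≤ lam 2 q.1 * coordGap e v q.1 q.2 2 :=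
    mul_le_mul_of_nonneg_right (h.lam_one_lt q.1).le (abs_nonneg _)
  have h4 : 0 ≤ η / 2 * ‖e q.1 - e q.2‖ := by positivity
  constructor <;> linarith

end IsAdaptedFrame

omit [FiniteDimensional ℝ F] in
/-- A partially hyperbolic diffeomorphism has an adapted frame. -/
lemma IsPartiallyHyperbolic.exists_isAdaptedFrame {f : M ≃ₘ^1⟮𝓡 3, 𝓡 3⟯ M} {g : RiemMetric M}
    {Es Ec Eu : PlaneField M} (hf : IsPartiallyHyperbolic f g Es Ec Eu) {e : M → F}
    (he : ContMDiff (𝓡 3) 𝓘(ℝ, F) 1 e) (hinj : Function.Injective e)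
    (himm : ∀ x, Function.Injective (differential e x)) :
    ∃ v lam, IsAdaptedFrame f g ![Es, Ec, Eu] v lam e ∧ ∀ x, lam 0 x < 1 := by
  have hline : ∀ i : Fin 3, IsContinuousLineField (![Es, Ec, Eu] i) := by
    intro i
    fin_cases i
    · exact hf.stable_lineField
    · exact hf.center_lineField
    · exact hf.unstable_lineField
  have hinv : ∀ i : Fin 3, IsInvariantField f (![Es, Ec, Eu] i) := by
    intro i
    fin_cases i
    · exact hf.stable_invariant
    · exact hf.center_invariant
    · exact hf.unstable_invariant
  choose v hv using fun i => (hline i).exists_isUnitSection g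
  have hspan : ∀ x, Submodule.span ℝ (range fun i => v i x) = ⊤ := by
    intro x
    rw [eq_top_iff, ← hf.splitting x]
    have h0 := (hv 0 x).2.2
    have h1 := (hv 1 x).2.2
    have h2 := (hv 2 x).2.2
    change Es x = _ at h0
    change Ec x = _ at h1
    change Eu x = _ at h2
    rw [h0, h1, h2]
    refine sup_le (sup_le ?_ ?_) ?_ <;>
    · rw [Submodule.span_le, singleton_subset_iff]
      exact Submodule.subset_span (mem_range_self _)
  have hli : ∀ x, LinearIndependent ℝ fun i => v i x := fun x =>
    linearIndependent_of_top_le_span_of_card_eq_finrank (hspan x).ge (by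
      show Fintype.card (Fin 3) = Module.finrank ℝ 𝔼
      simp)
  have hfd : ∀ x, Function.Injective (mfderiv (𝓡 3) (𝓡 3) f x) := fun x =>
    ((f.mfderivToContinuousLinearEquiv one_ne_zero x).injective)
  -- The rates are continuous although `v` need not be, because the length of the image vector is
  -- even in the vector.
  let lam : Fin 3 → M → ℝ := fun i x => g.len (f x) (mfderiv (𝓡 3) (𝓡 3) f x (v i x))
  have hlam : ∀ i, Continuous (lam i) := by
    intro i
    have h1 : Continuous fun q : TangentBundle (𝓡 3) M =>
        g.len (f q.1) (mfderiv (𝓡 3) (𝓡 3) f q.1 q.2) :=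
      g.continuous_len.comp (f.contMDiff.continuous_tangentMap le_rfl)
    refine (hv i).continuous (hline i) h1 fun x w => ?_
    rw [map_neg, g.len_neg]
  have hlampos : ∀ i x, 0 < lam i x := fun i x => g.len_pos fun h =>
    (hli x).ne_zero i ((injective_iff_map_eq_zero _).1 (hfd x) _ h)
  have hdom := fun x => hf.domination x (v 0 x) (hv 0 x).1 (v 1 x) (hv 1 x).1 (v 2 x) (hv 2 x).1
    (hv 0 x).2.1 (hv 1 x).2.1 (hv 2 x).2.1
  refine ⟨v, lam, ⟨hline, hv, hli, hlam, hlampos, fun x => (hdom x).1, fun x => (hdom x).2.1,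
    fun i x => ?_, he, hinj, himm⟩, fun x => (hdom x).2.2.1⟩
  have h1 : mfderiv (𝓡 3) (𝓡 3) f x (v i x) ∈ ![Es, Ec, Eu] i (f x) := by
    rw [← hinv i x]
    exact ⟨v i x, (hv i x).1, rfl⟩
  refine g.eq_or_eq_neg (u := v i (f x)) ((hv i (f x)).2.2 ▸ h1)
    (Submodule.smul_mem _ _ (Submodule.mem_span_singleton_self _)) ?_
  rw [g.len_smul, (hv i (f x)).2.1, mul_one, abs_of_pos (hlampos i x)]

end CoordinateGap

/-! ### Arcs tangent to the stable field are stably related -/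

section StableCurves

variable {M : Type*} [TopologicalSpace M] [ChartedSpace (EuclideanSpace ℝ (Fin 3)) M]
  [IsManifold (𝓡 3) ∞ M]

local notation "𝔼" => EuclideanSpace ℝ (Fin 3)

variable {F : Type*} [NormedAddCommGroup F] [InnerProductSpace ℝ F]
  {f : M ≃ₘ^1⟮𝓡 3, 𝓡 3⟯ M} {g : RiemMetric M} {E : Fin 3 → PlaneField M}
  {v : Fin 3 → ∀ x : M, TangentSpace (𝓡 3) x} {lam : Fin 3 → M → ℝ} {e : M → F}

omit [IsManifold (𝓡 3) ∞ M] in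
lemma Diffeomorph.contMDiff_iterate (f : M ≃ₘ^1⟮𝓡 3, 𝓡 3⟯ M) (n : ℕ) :
    ContMDiff (𝓡 3) (𝓡 3) 1 f^[n] := by
  induction n with
  | zero => exact contMDiff_id
  | succ n ih => rw [Function.iterate_succ']; exact f.contMDiff.comp ih

namespace IsAdaptedFrame

lemma mfderiv_iterate_apply (h : IsAdaptedFrame f g E v lam e) (n : ℕ) (x : M) :
    mfderiv (𝓡 3) (𝓡 3) f^[n] x (v 0 x) = orbitProd f (lam 0) n x • v 0 (f^[n] x) ∨
      mfderiv (𝓡 3) (𝓡 3) f^[n] x (v 0 x) = -(orbitProd f (lam 0) n x • v 0 (f^[n] x)) := by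
  induction n with
  | zero =>
    left
    have h1 : mfderiv (𝓡 3) (𝓡 3) f^[0] x (v 0 x) = v 0 x := by
      change mfderiv (𝓡 3) (𝓡 3) id x (v 0 x) = v 0 x
      rw [mfderiv_id]; rfl
    rw [h1, orbitProd, Finset.prod_range_zero]
    exact (one_smul ℝ _).symm
  | succ n ih =>
    have h1 : mfderiv (𝓡 3) (𝓡 3) f^[n + 1] x =
        (mfderiv (𝓡 3) (𝓡 3) f (f^[n] x)) ∘L (mfderiv (𝓡 3) (𝓡 3) f^[n] x) := by
      rw [Function.iterate_succ']
      exact mfderiv_comp x (f.contMDiff.mdifferentiableAt one_ne_zero)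
        ((f.contMDiff_iterate n).mdifferentiableAt one_ne_zero)
    have h2 : orbitProd f (lam 0) (n + 1) x = orbitProd f (lam 0) n x * lam 0 (f^[n] x) :=
      Finset.prod_range_succ _ _
    have h3 : f^[n + 1] x = f (f^[n] x) := Function.iterate_succ_apply' _ _ _
    have h4 : ∀ w, mfderiv (𝓡 3) (𝓡 3) f^[n + 1] x w =
        mfderiv (𝓡 3) (𝓡 3) f (f^[n] x) (mfderiv (𝓡 3) (𝓡 3) f^[n] x w) := fun w => by
      rw [h1]; rfl
    rw [h4, h3, h2, mul_smul]
    rcases ih with ih | ih <;> rcases h.mfderiv_apply 0 (f^[n] x) with h5 | h5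
    · left; rw [ih, map_smul, h5]
    · right; rw [ih, map_smul, h5, smul_neg]
    · right; rw [ih, map_neg, map_smul, h5]
    · left; rw [ih, map_neg, map_smul, h5, smul_neg, neg_neg]

lemma norm_differential_iterate_le (h : IsAdaptedFrame f g E v lam e) {C : ℝ}
    (hC : ∀ x, ‖differential e x (v 0 x)‖ ≤ C) (n : ℕ) {x : M} {w : TangentSpace (𝓡 3) x}
    (hw : w ∈ E 0 x) (hw1 : g.len x w = 1) :
    ‖differential (e ∘ f^[n]) x w‖ ≤ C * orbitProd f (lam 0) n x := by
  have h1 : differential (e ∘ f^[n]) x =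
      differential e (f^[n] x) ∘L mfderiv (𝓡 3) (𝓡 3) f^[n] x :=
    mfderiv_comp x (h.contMDiff.mdifferentiableAt one_ne_zero)
      ((f.contMDiff_iterate n).mdifferentiableAt one_ne_zero)
  have h2 : ‖differential (e ∘ f^[n]) x (v 0 x)‖ ≤ C * orbitProd f (lam 0) n x := by
    have hp := orbitProd_pos (f := f) (h.lam_pos 0) n x
    have h3 : ‖differential e (f^[n] x) (orbitProd f (lam 0) n x • v 0 (f^[n] x))‖ ≤
        C * orbitProd f (lam 0) n x := by
      rw [map_smul, norm_smul, Real.norm_of_nonneg hp.le, mul_comm]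
      exact mul_le_mul_of_nonneg_right (hC _) hp.le
    rw [h1, ContinuousLinearMap.comp_apply]
    rcases h.mfderiv_iterate_apply n x with h4 | h4
    · rw [h4]; exact h3
    · rw [h4, map_neg, norm_neg]; exact h3
  rcases (h.unitSection 0).eq_or_eq_neg hw hw1 with h3 | h3
  · rw [← h3]; exact h2
  · rw [h3, map_neg, norm_neg] at h2; exact h2

lemma exists_norm_differential_le [CompactSpace M] (h : IsAdaptedFrame f g E v lam e) :
    ∃ C > 0, ∀ x, ‖differential e x (v 0 x)‖ ≤ C := by
  have h1 : Continuous fun x => ‖differential e x (v 0 x)‖ :=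
    (h.unitSection 0).continuous (h.lineField 0)
      (G := fun q : TangentBundle (𝓡 3) M => ‖differential e q.1 q.2‖)
      h.contMDiff.continuous_differential.norm fun x w => by rw [map_neg, norm_neg]
  obtain ⟨C, hC⟩ := (isCompact_range h1).bddAbove
  exact ⟨max C 1, lt_max_of_lt_right one_pos, fun x =>
    (hC (mem_range_self x)).trans (le_max_left _ _)⟩

/-- Points on a curve tangent to the stable field are stably related. -/
lemma stableRel_of_isSolutionOn (h : IsAdaptedFrame f g E v lam e) {C : ℝ} (hC0 : 0 ≤ C)
    (hC : ∀ x, ‖differential e x (v 0 x)‖ ≤ C) {x₀ : M} {B : Set 𝔼}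
    (hB : B ⊆ (extChartAt (𝓡 3) x₀).target) {X : 𝔼 → 𝔼}
    (hX : ∀ p ∈ B, chartFrame x₀ p (X p) ∈ E 0 ((extChartAt (𝓡 3) x₀).symm p) ∧
      g.len _ (chartFrame x₀ p (X p)) = 1)
    {γ : ℝ → 𝔼} {a b : ℝ} (hγ : IsSolutionOn X B γ a b) {s t : ℝ} (hs : s ∈ Icc a b)
    (ht : t ∈ Icc a b) : StableRel e f (lam 0) (C * |t - s|) ((extChartAt (𝓡 3) x₀).symm (γ s))
      ((extChartAt (𝓡 3) x₀).symm (γ t)) := by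
  wlog hst : s ≤ t generalizing s t
  · have := (this ht hs (le_of_not_ge hst)).symm
    rwa [abs_sub_comm] at this
  set φ := extChartAt (𝓡 3) x₀
  -- The witnessing set is the arc itself: the image of the arc under `e ∘ f^[n]` has speed at most
  -- `C` times the product of the rates, hence at most `C * K`.
  refine ⟨(fun τ => φ.symm (γ τ)) '' Icc s t, ⟨s, left_mem_Icc.2 hst, rfl⟩,
    ⟨t, right_mem_Icc.2 hst, rfl⟩, fun n K hK => ?_⟩
  have hγ' := hγ.mono hs.1 ht.2
  have hder : ∀ τ ∈ Icc s t, HasDerivWithinAt (fun τ => e (f^[n] (φ.symm (γ τ))))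
      (differential (e ∘ f^[n]) (φ.symm (γ τ)) (chartFrame x₀ (γ τ) (X (γ τ)))) (Icc s t) τ := by
    intro τ hτ
    have h1 : MDifferentiableAt (𝓡 3) 𝓘(ℝ, F) (e ∘ f^[n]) (φ.symm (γ τ)) :=
      (h.contMDiff.comp (f.contMDiff_iterate n)).mdifferentiableAt one_ne_zero
    have h2 := HasMFDerivAt.comp_chart_symm (hB (hγ' τ hτ).1) h1.hasMFDerivAt
    exact h2.comp_hasDerivWithinAt τ (hγ' τ hτ).2
  have hbd : ∀ τ ∈ Icc s t, ‖differential (e ∘ f^[n]) (φ.symm (γ τ))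
      (chartFrame x₀ (γ τ) (X (γ τ)))‖ ≤ C * K := by
    intro τ hτ
    have h1 := hX _ (hγ' τ hτ).1
    exact (h.norm_differential_iterate_le hC n h1.1 h1.2).trans
      (mul_le_mul_of_nonneg_left (hK _ ⟨τ, hτ, rfl⟩) hC0)
  have hK0 : 0 ≤ K := (orbitProd_pos (f := f) (h.lam_pos 0) n _).le.trans
    (hK _ ⟨s, left_mem_Icc.2 hst, rfl⟩)
  rintro _ ⟨τ, hτ, rfl⟩ _ ⟨τ', hτ', rfl⟩
  refine ((convex_Icc s t).norm_image_sub_le_of_norm_hasDerivWithin_le hder hbd hτ' hτ).trans ?_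
  rw [Real.norm_eq_abs, mul_right_comm]
  have h1 : |τ - τ'| ≤ |t - s| := by
    rw [abs_of_nonneg (sub_nonneg.2 hst)]
    exact abs_le.2 ⟨by linarith [hτ.1, hτ'.2], by linarith [hτ.2, hτ'.1]⟩
  gcongr

end IsAdaptedFrame

end StableCurves

/-! ### Charts transverse to the center-unstable field -/

section StableBoxes

variable {M : Type*} [TopologicalSpace M] [ChartedSpace (EuclideanSpace ℝ (Fin 3)) M]
  [IsManifold (𝓡 3) ∞ M]

local notation "𝔼" => EuclideanSpace ℝ (Fin 3)

variable {F : Type*} [NormedAddCommGroup F] [InnerProductSpace ℝ F] [FiniteDimensional ℝ F]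
  {f : M ≃ₘ^1⟮𝓡 3, 𝓡 3⟯ M} {g : RiemMetric M} {E : Fin 3 → PlaneField M}
  {v : Fin 3 → ∀ x : M, TangentSpace (𝓡 3) x} {lam : Fin 3 → M → ℝ} {e : M → F}

/-- A ball in the chart at `x₀` with a unit vector field `X` that spans the stable field, a field
of covectors `θ` whose kernel is the center-unstable field, and a transverse vector `w`. -/
structure IsStableBox (g : RiemMetric M) (E : Fin 3 → PlaneField M)
    (v : Fin 3 → ∀ x : M, TangentSpace (𝓡 3) x) (e : M → F) (x₀ : M) (R : ℝ) (X : 𝔼 → 𝔼)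
    (θ : 𝔼 → 𝔼 →L[ℝ] ℝ) (w : 𝔼) (η₀ : ℝ) : Prop
    extends IsTransverseBox (extChartAt (𝓡 3) x₀ x₀) R X θ w where
  subset_target : Metric.closedBall (extChartAt (𝓡 3) x₀ x₀) R ⊆ (extChartAt (𝓡 3) x₀).target
  eta_pos : 0 < η₀
  unit : ∀ p ∈ Metric.closedBall (extChartAt (𝓡 3) x₀ x₀) R,
    g.len _ (chartFrame x₀ p (X p)) = 1
  span : ∀ p ∈ Metric.closedBall (extChartAt (𝓡 3) x₀ x₀) R,
    E 0 ((extChartAt (𝓡 3) x₀).symm p) = Submodule.span ℝ {chartFrame x₀ p (X p)}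
  form_eq_zero_iff : ∀ p ∈ Metric.closedBall (extChartAt (𝓡 3) x₀ x₀) R, ∀ u, θ p u = 0 ↔
    chartFrame x₀ p u ∈ E 1 ((extChartAt (𝓡 3) x₀).symm p) ⊔ E 2 ((extChartAt (𝓡 3) x₀).symm p)
  coordGap_le : ∀ p ∈ Metric.closedBall (extChartAt (𝓡 3) x₀ x₀) R,
    ∀ p' ∈ Metric.closedBall (extChartAt (𝓡 3) x₀ x₀) R,
      |θ (extChartAt (𝓡 3) x₀ x₀) (p' - p)| ≤ η₀ * ‖p' - p‖ →
      coordGap e v ((extChartAt (𝓡 3) x₀).symm p) ((extChartAt (𝓡 3) x₀).symm p') 0 ≤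
        coordGap e v ((extChartAt (𝓡 3) x₀).symm p) ((extChartAt (𝓡 3) x₀).symm p') 1 +
        coordGap e v ((extChartAt (𝓡 3) x₀).symm p) ((extChartAt (𝓡 3) x₀).symm p') 2

namespace IsStableBox

variable {x₀ : M} {R η₀ : ℝ} {X : 𝔼 → 𝔼} {θ : 𝔼 → 𝔼 →L[ℝ] ℝ} {w : 𝔼}

lemma mem_stable (b : IsStableBox g E v e x₀ R X θ w η₀) {p : 𝔼}
    (hp : p ∈ Metric.closedBall (extChartAt (𝓡 3) x₀ x₀) R) :
    chartFrame x₀ p (X p) ∈ E 0 ((extChartAt (𝓡 3) x₀).symm p) := by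
  rw [b.span p hp]; exact Submodule.mem_span_singleton_self _

lemma stableRel (b : IsStableBox g E v e x₀ R X θ w η₀) (h : IsAdaptedFrame f g E v lam e)
    {C : ℝ} (hC0 : 0 ≤ C) (hC : ∀ x, ‖differential e x (v 0 x)‖ ≤ C) {γ : ℝ → 𝔼} {a b' : ℝ}
    (hγ : IsSolutionOn X (Metric.closedBall (extChartAt (𝓡 3) x₀ x₀) R) γ a b') {s t : ℝ}
    (hs : s ∈ Icc a b') (ht : t ∈ Icc a b') :
    StableRel e f (lam 0) (C * |t - s|) ((extChartAt (𝓡 3) x₀).symm (γ s))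
      ((extChartAt (𝓡 3) x₀).symm (γ t)) :=
  h.stableRel_of_isSolutionOn hC0 hC b.subset_target (fun p hp => ⟨b.mem_stable hp, b.unit p hp⟩)
    hγ hs ht

/-- Points of equal height on two short solutions through a common point are joined by stable arcs
of total constant at most `ε`, while `θ` at the center annihilates their difference and so puts it
into the center-unstable cone. Rigidity identifies them. Here the dynamics takes the place of a
Lipschitz condition. -/
lemma separatesSolutions (b : IsStableBox g E v e x₀ R X θ w η₀)
    (h : IsAdaptedFrame f g E v lam e) {C : ℝ} (hC0 : 0 ≤ C)
    (hC : ∀ x, ‖differential e x (v 0 x)‖ ≤ C) {ε : ℝ}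
    (hsep : ∀ x y, StableRel e f (lam 0) ε x y →
      coordGap e v x y 0 ≤ coordGap e v x y 1 + coordGap e v x y 2 → x = y) {r : ℝ}
    (hr : C * r + C * r ≤ ε) :
    SeparatesSolutions X (Metric.closedBall (extChartAt (𝓡 3) x₀ x₀) R)
      (θ (extChartAt (𝓡 3) x₀ x₀)) r := by
  intro a b' har ha hb hbr c c' hc hc' h0 s hs t ht hst
  have h0' : (0 : ℝ) ∈ Icc a b' := ⟨ha, hb⟩
  have h1 := b.stableRel h hC0 hC hc hs h0'
  have h2 := b.stableRel h hC0 hC hc' h0' ht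
  rw [h0] at h1
  have h3 := h1.trans (h.lam_pos 0) (by positivity) (by positivity) h2
  have hs' : |0 - s| ≤ r := abs_le.2 ⟨by linarith [hs.2], by linarith [hs.1]⟩
  have ht' : |t - 0| ≤ r := abs_le.2 ⟨by linarith [ht.1], by linarith [ht.2]⟩
  have h4 := h3.mono (h.lam_pos 0) (l' := ε) (le_trans (by gcongr) hr)
  have hgap := b.coordGap_le _ (hc s hs).1 _ (hc' t ht).1 (by
    rw [map_sub, hst, sub_self, abs_zero]
    exact mul_nonneg b.eta_pos.le (norm_nonneg _))
  exact (extChartAt (𝓡 3) x₀).symm.injOn (b.subset_target (hc s hs).1)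
    (b.subset_target (hc' t ht).1) (hsep _ _ h4 hgap)

end IsStableBox

/-- The form `θ` is the stable coordinate in a continuous local frame, normalised on the constant
vector `w`, the value of the stable field at the center. At the center `θ` takes the value one on
the field, so the bound `1 / 2` and the cone estimate persist on a small ball. -/
theorem IsAdaptedFrame.exists_isStableBox (h : IsAdaptedFrame f g E v lam e) (x₀ : M) :
    ∃ R X θ w η₀, IsStableBox g E v e x₀ R X θ w η₀ := by
  choose r hr hball X hXc hX using fun i => (h.lineField i).exists_chart_field g x₀
  set φ := extChartAt (𝓡 3) x₀
  set p₀ := φ x₀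
  have hpt : p₀ ∈ φ.target := mem_extChartAt_target x₀
  let r₁ := min (r 0) (min (r 1) (r 2))
  have hr₁ : 0 < r₁ := lt_min (hr 0) (lt_min (hr 1) (hr 2))
  have hsub : ∀ i, Metric.closedBall p₀ r₁ ⊆ Metric.closedBall p₀ (r i) := by
    intro i
    refine Metric.closedBall_subset_closedBall ?_
    fin_cases i
    · exact min_le_left _ _
    · exact (min_le_right _ _).trans (min_le_left _ _)
    · exact (min_le_right _ _).trans (min_le_right _ _)
  have hsp : ∀ i, ∀ p ∈ Metric.closedBall p₀ r₁,
      E i (φ.symm p) = Submodule.span ℝ {chartFrame x₀ p (X i p)} :=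
    fun i p hp => (hX i p (hsub i hp)).2
  have htgt : ∀ p ∈ Metric.closedBall p₀ r₁, p ∈ φ.target := fun p hp => hball 0 (hsub 0 hp)
  have hind : ∀ p ∈ Metric.closedBall p₀ r₁, LinearIndependent ℝ fun i => X i p := by
    intro p hp
    have h1 : LinearIndependent ℝ fun i => chartFrame x₀ p (X i p) := by
      refine linearIndependent_of_top_le_span_of_card_eq_finrank ?_ (by
        show Fintype.card (Fin 3) = Module.finrank ℝ 𝔼
        simp)
      have h2 := (h.linearIndependent (φ.symm p)).span_eq_top_of_card_eq_finrank (by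
        show Fintype.card (Fin 3) = Module.finrank ℝ 𝔼
        simp)
      rw [← h2, Submodule.span_le]
      rintro _ ⟨i, rfl⟩
      have h3 := ((h.unitSection i) (φ.symm p)).1
      rw [hsp i p hp] at h3
      refine Submodule.span_mono ?_ h3
      rw [singleton_subset_iff]
      exact ⟨i, rfl⟩
    exact h1.of_comp (chartFrame x₀ p).toLinearMap
  let J : 𝔼 → 𝔼 →L[ℝ] ℝ := fun p =>
    (EuclideanSpace.proj 0 : 𝔼 →L[ℝ] ℝ) ∘L leftInv (frameMap fun i => X i p)
  have hJc : ContinuousOn J (Metric.closedBall p₀ r₁) := by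
    intro p hp
    have h1 : ContinuousWithinAt (fun p => (fun i => X i p)) (Metric.closedBall p₀ r₁) p :=
      continuousWithinAt_pi.2 fun i => ((hXc i).mono (hsub i)) p hp
    have h2 : ContinuousWithinAt (fun p => leftInv (frameMap fun i => X i p))
        (Metric.closedBall p₀ r₁) p :=
      ContinuousAt.comp_continuousWithinAt
        (f := fun p => frameMap fun i => X i p) (g := leftInv)
        (continuousAt_leftInv (frameMap_injective (hind p hp)))
        (continuous_frameMap.continuousAt.comp_continuousWithinAt h1)
    exact continuousWithinAt_const.clm_comp h2
  have hJ : ∀ p ∈ Metric.closedBall p₀ r₁, ∀ c : 𝔼, J p (∑ i, c i • X i p) = c 0 := by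
    intro p hp c
    have h1 := leftInv_apply (frameMap_injective (hind p hp)) c
    rw [frameMap_apply] at h1
    change leftInv (frameMap fun i => X i p) (∑ i, c i • X i p) 0 = c 0
    rw [h1]
  have hJX : ∀ p ∈ Metric.closedBall p₀ r₁, J p (X 0 p) = 1 := by
    intro p hp
    have := hJ p hp !₂[1, 0, 0]
    rw [Fin.sum_univ_three] at this
    simpa using this
  have hJker : ∀ p ∈ Metric.closedBall p₀ r₁, ∀ u, J p u = 0 ↔
      chartFrame x₀ p u ∈ E 1 (φ.symm p) ⊔ E 2 (φ.symm p) := by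
    intro p hp u
    constructor
    · intro hu
      have h2 := (hind p hp).span_eq_top_of_card_eq_finrank (by simp)
      obtain ⟨c, rfl⟩ := (Submodule.mem_span_range_iff_exists_fun ℝ).1 (h2.ge (mem_univ u))
      have h3 : c 0 = 0 := (hJ p hp (WithLp.toLp 2 c)).symm.trans hu
      rw [Fin.sum_univ_three, h3, zero_smul, zero_add, map_add, map_smul, map_smul, hsp 1 p hp,
        hsp 2 p hp]
      exact Submodule.add_mem_sup
        (Submodule.smul_mem _ _ (Submodule.mem_span_singleton_self _))
        (Submodule.smul_mem _ _ (Submodule.mem_span_singleton_self _))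
    · intro hu
      obtain ⟨y, hy, z, hz, hyz⟩ := Submodule.mem_sup.1 hu
      rw [hsp 1 p hp] at hy
      rw [hsp 2 p hp] at hz
      obtain ⟨α, rfl⟩ := Submodule.mem_span_singleton.1 hy
      obtain ⟨β, rfl⟩ := Submodule.mem_span_singleton.1 hz
      have h3 : u = α • X 1 p + β • X 2 p := by
        refine (bijective_chartFrame (htgt p hp)).1 ?_
        rw [← hyz, map_add, map_smul, map_smul]
      have := hJ p hp !₂[0, α, β]
      rw [Fin.sum_univ_three] at this
      rw [h3]
      simpa using this
  have hc₁ : p₀ ∈ Metric.closedBall p₀ r₁ := Metric.mem_closedBall_self hr₁.le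
  set w := X 0 p₀
  have hJw : ContinuousOn (fun p => J p w) (Metric.closedBall p₀ r₁) := hJc.clm_apply
    continuousOn_const
  have hnhds : Metric.closedBall p₀ r₁ ∈ 𝓝 p₀ := Metric.closedBall_mem_nhds _ hr₁
  have hJw1 : J p₀ w = 1 := hJX p₀ hc₁
  let θ : 𝔼 → 𝔼 →L[ℝ] ℝ := fun p => (J p w)⁻¹ • J p
  have hev1 : ∀ᶠ p in 𝓝 p₀, 0 < J p w := by
    refine (hJw.continuousAt hnhds).eventually (lt_mem_nhds ?_)
    change 0 < J p₀ w
    rw [hJw1]; exact one_pos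
  have hev2 : ∀ᶠ q : 𝔼 × 𝔼 in 𝓝 (p₀, p₀), 1 / 2 < θ q.1 (X 0 q.2) := by
    have h1 : ContinuousAt (fun q : 𝔼 × 𝔼 => θ q.1 (X 0 q.2)) (p₀, p₀) := by
      have h2 : ContinuousAt θ p₀ :=
        ((hJw.continuousAt hnhds).inv₀ (by rw [hJw1]; exact one_ne_zero)).smul
          (hJc.continuousAt hnhds)
      have h3 : ContinuousAt (X 0) p₀ := ((hXc 0).mono (hsub 0)).continuousAt hnhds
      exact (ContinuousAt.comp (f := Prod.fst) (x := (p₀, p₀)) h2 continuousAt_fst).clm_apply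
        (ContinuousAt.comp (f := Prod.snd) (x := (p₀, p₀)) h3 continuousAt_snd)
    refine h1.eventually (lt_mem_nhds ?_)
    change 1 / 2 < (J p₀ w)⁻¹ * J p₀ w
    rw [hJw1]; norm_num
  have hθker : ∀ p ∈ Metric.closedBall p₀ r₁, 0 < J p w → ∀ u, θ p u = 0 ↔
      chartFrame x₀ p u ∈ E 1 (φ.symm p) ⊔ E 2 (φ.symm p) := by
    intro p hp hpos u
    rw [← hJker p hp u]
    change (J p w)⁻¹ * J p u = 0 ↔ _
    simp [hpos.ne']
  obtain ⟨η₀, hη₀, hgap⟩ := h.exists_coordGap_le x₀ (θ p₀) fun u hu =>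
    (hθker p₀ hc₁ hev1.self_of_nhds u).1 hu
  have hsymm : Tendsto (fun q : 𝔼 × 𝔼 => (φ.symm q.1, φ.symm q.2)) (𝓝 (p₀, p₀))
      (𝓝 (x₀, x₀)) := by
    have h1 : Tendsto φ.symm (𝓝 p₀) (𝓝 x₀) := by
      have := continuousAt_extChartAt_symm (I := 𝓡 3) x₀
      rwa [ContinuousAt, extChartAt_to_inv x₀] at this
    rw [nhds_prod_eq, nhds_prod_eq]
    exact (h1.comp tendsto_fst).prodMk (h1.comp tendsto_snd)
  have hev3 := hsymm.eventually hgap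
  have hall : ∀ᶠ q : 𝔼 × 𝔼 in 𝓝 (p₀, p₀), _ :=
    (hev2.and hev3).and (continuousAt_fst.eventually hev1)
  rw [nhds_prod_eq, (Metric.nhds_basis_closedBall.prod_self).eventually_iff] at hall
  obtain ⟨R, hR, hall⟩ := hall
  have hRle : min R r₁ ≤ r₁ := min_le_right _ _
  have hin : ∀ p ∈ Metric.closedBall p₀ (min R r₁), p ∈ Metric.closedBall p₀ r₁ :=
    fun p hp => Metric.closedBall_subset_closedBall hRle hp
  have hin' : ∀ p ∈ Metric.closedBall p₀ (min R r₁), p ∈ Metric.closedBall p₀ R :=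
    fun p hp => Metric.closedBall_subset_closedBall (min_le_left _ _) hp
  have hpos : ∀ p ∈ Metric.closedBall p₀ (min R r₁), 0 < J p w := fun p hp =>
    (hall (x := (p, p)) ⟨hin' p hp, hin' p hp⟩).2
  refine ⟨min R r₁, X 0, θ, w, η₀, ⟨⟨lt_min hR hr₁, ((hXc 0).mono (hsub 0)).mono hin,
    ((hJw.mono hin).inv₀ fun p hp => (hpos p hp).ne').smul (hJc.mono hin), fun p hp => ?_,
    fun p hp q hq => (hall (x := (p, q)) ⟨hin' p hp, hin' q hq⟩).1.1.le⟩,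
    fun p hp => htgt p (hin p hp), hη₀, fun p hp => (hX 0 p (hsub 0 (hin p hp))).1,
    fun p hp => hsp 0 p (hin p hp), fun p hp => hθker p (hin p hp) (hpos p hp),
    fun p hp p' hp' hle => ?_⟩⟩
  · change (J p w)⁻¹ * J p w = 1
    exact inv_mul_cancel₀ (hpos p hp).ne'
  · refine (hall (x := (p, p')) ⟨hin' p hp, hin' p' hp'⟩).1.2 ?_
    change |θ p₀ (φ (φ.symm p') - φ (φ.symm p))| ≤ η₀ * ‖φ (φ.symm p') - φ (φ.symm p)‖
    rw [φ.right_inv (htgt p (hin p hp)), φ.right_inv (htgt p' (hin p' hp'))]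
    exact hle

end StableBoxes

/-! ### Surfaces tangent to the center-unstable field -/

section TangentSurfaces

variable {M : Type*} [TopologicalSpace M] [ChartedSpace (EuclideanSpace ℝ (Fin 3)) M]

local notation "𝔼" => EuclideanSpace ℝ (Fin 3)

/-- The map `k` preserves the distribution `P`. -/
def PreservesField (P : PlaneField M) (k : M → M) : Prop :=
  ContMDiff (𝓡 3) (𝓡 3) 1 k ∧ ∀ x w, mfderiv (𝓡 3) (𝓡 3) k x w ∈ P (k x) ↔ w ∈ P x

lemma PreservesField.iterate {P : PlaneField M} {k : M → M} (hk : PreservesField P k) (n : ℕ) :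
    PreservesField P k^[n] := by
  induction n with
  | zero =>
    refine ⟨contMDiff_id, fun x w => ?_⟩
    change mfderiv (𝓡 3) (𝓡 3) id x w ∈ P x ↔ _
    rw [mfderiv_id]; rfl
  | succ n ih =>
    rw [Function.iterate_succ']
    refine ⟨hk.1.comp ih.1, fun x w => ?_⟩
    rw [mfderiv_comp x (hk.1.mdifferentiableAt one_ne_zero) (ih.1.mdifferentiableAt one_ne_zero),
      ← ih.2 x w]
    exact hk.2 (k^[n] x) _

lemma PreservesField.of_isInvariantField {P : PlaneField M} (f : M ≃ₘ^1⟮𝓡 3, 𝓡 3⟯ M)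
    (hP : IsInvariantField f P) : PreservesField P f := by
  refine ⟨f.contMDiff, fun x w => ?_⟩
  rw [← hP x]
  have hinj : Function.Injective (mfderiv (𝓡 3) (𝓡 3) f x) :=
    (f.mfderivToContinuousLinearEquiv one_ne_zero x).injective
  exact ⟨fun ⟨u, hu, huw⟩ => hinj huw ▸ hu, fun hw => ⟨w, hw, rfl⟩⟩

lemma PreservesField.symm {P : PlaneField M} {f : M ≃ₘ^1⟮𝓡 3, 𝓡 3⟯ M}
    (hf : PreservesField P f) : PreservesField P f.symm := by
  refine ⟨f.symm.contMDiff, fun x w => ?_⟩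
  rw [← hf.2 (f.symm x)]
  have h1 : mfderiv (𝓡 3) (𝓡 3) (f ∘ f.symm) x = mfderiv (𝓡 3) (𝓡 3) f (f.symm x) ∘L
      mfderiv (𝓡 3) (𝓡 3) f.symm x :=
    mfderiv_comp x (f.contMDiff.mdifferentiableAt one_ne_zero)
      (f.symm.contMDiff.mdifferentiableAt one_ne_zero)
  have h2 : f ∘ f.symm = id := funext f.apply_symm_apply
  have h3 : tangentMap (𝓡 3) (𝓡 3) (f ∘ f.symm) ⟨x, w⟩ = ⟨x, w⟩ := by
    rw [h2, tangentMap_id]; rfl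
  have h4 : (⟨f (f.symm x), mfderiv (𝓡 3) (𝓡 3) f (f.symm x) (mfderiv (𝓡 3) (𝓡 3) f.symm x w)⟩ :
      TangentBundle (𝓡 3) M) = ⟨x, w⟩ := by
    rw [← h3]
    exact congrArg (Bundle.TotalSpace.mk _) (congrArg (fun L => L w) h1).symm
  -- Since `f (f.symm x)` and `x` are only propositionally equal, membership is transported along an
  -- equality in the total space.
  have h5 : ∀ q q' : TangentBundle (𝓡 3) M, q = q' → (q.2 ∈ P q.1 ↔ q'.2 ∈ P q'.1) := by
    rintro q _ rfl; rfl
  exact h5 _ _ h4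

lemma IsInvariantField.sup {f : M → M} {P Q : PlaneField M} (hP : IsInvariantField f P)
    (hQ : IsInvariantField f Q) : IsInvariantField f (fun x => P x ⊔ Q x) := fun x => by
  rw [Submodule.map_sup, hP x, hQ x]

lemma IsSurfaceTangentTo.preimage {P : PlaneField M} {S : Set M} (hS : IsSurfaceTangentTo P S)
    {k : M → M} (hk : PreservesField P k) : IsSurfaceTangentTo P (k ⁻¹' S) := by
  intro x hx
  obtain ⟨V, hV, hxV, u, hu, hSV, hker⟩ := hS (k x) hx
  refine ⟨k ⁻¹' V, hV.preimage hk.1.continuous, hxV, u ∘ k,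
    hu.comp hk.1.contMDiffOn fun y hy => hy, ?_, fun y hy => ?_⟩
  · ext y
    exact Set.ext_iff.1 hSV (k y)
  · have h1 : mfderiv (𝓡 3) 𝓘(ℝ, ℝ) (u ∘ k) y =
        mfderiv (𝓡 3) 𝓘(ℝ, ℝ) u (k y) ∘L mfderiv (𝓡 3) (𝓡 3) k y :=
      mfderiv_comp y (((hu _ hy.2).contMDiffAt (hV.mem_nhds hy.2)).mdifferentiableAt one_ne_zero)
        (hk.1.mdifferentiableAt one_ne_zero)
    ext w
    have h2 := Submodule.ext_iff.1 (hker (k y) hy) (mfderiv (𝓡 3) (𝓡 3) k y w)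
    rw [hk.2 y w] at h2
    rw [← h2, h1]
    rfl

variable [IsManifold (𝓡 3) ∞ M]

lemma ContMDiffAt.hasStrictFDerivAt_comp_chart_symm {F : Type*} [NormedAddCommGroup F]
    [NormedSpace ℝ F] {u : M → F} {x₀ : M} {p : 𝔼} (hp : p ∈ (extChartAt (𝓡 3) x₀).target)
    (hu : ContMDiffAt (𝓡 3) 𝓘(ℝ, F) 1 u ((extChartAt (𝓡 3) x₀).symm p)) :
    HasStrictFDerivAt (u ∘ (extChartAt (𝓡 3) x₀).symm)
      (differential u ((extChartAt (𝓡 3) x₀).symm p) ∘L chartFrame x₀ p) p := by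
  have : IsManifold (𝓡 3) 1 M := IsManifold.of_le (n := ∞) (by simp)
  have h1 : ContMDiffAt 𝓘(ℝ, 𝔼) (𝓡 3) 1 (extChartAt (𝓡 3) x₀).symm p :=
    (contMDiffOn_extChartAt_symm x₀).contMDiffAt ((isOpen_extChartAt_target x₀).mem_nhds hp)
  have h2 : ContDiffAt ℝ 1 (u ∘ (extChartAt (𝓡 3) x₀).symm) p := (hu.comp p h1).contDiffAt
  have h3 := h2.hasStrictFDerivAt one_ne_zero
  have h5 := HasMFDerivAt.comp_chart_symm hp (hu.mdifferentiableAt one_ne_zero).hasMFDerivAt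
  rw [h3.hasFDerivAt.unique h5] at h3
  exact h3

variable {F : Type*} [NormedAddCommGroup F] [InnerProductSpace ℝ F] [FiniteDimensional ℝ F]
  {f : M ≃ₘ^1⟮𝓡 3, 𝓡 3⟯ M} {g : RiemMetric M} {E : Fin 3 → PlaneField M}
  {v : Fin 3 → ∀ x : M, TangentSpace (𝓡 3) x} {lam : Fin 3 → M → ℝ} {e : M → F}

/-- The part of a set that lies in a closed ball in a chart. -/
def chartPiece (x₀ : M) (R : ℝ) (S : Set M) : Set 𝔼 :=
  Metric.closedBall (extChartAt (𝓡 3) x₀ x₀) R ∩ (extChartAt (𝓡 3) x₀).symm ⁻¹' S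

namespace IsStableBox

variable {x₀ : M} {R η₀ : ℝ} {X : 𝔼 → 𝔼} {θ : 𝔼 → 𝔼 →L[ℝ] ℝ} {w : 𝔼} {S : Set M}

lemma isClosed_chartPiece (b : IsStableBox g E v e x₀ R X θ w η₀) (hS : IsClosed S) :
    IsClosed (chartPiece x₀ R S) :=
  ((continuousOn_extChartAt_symm x₀).mono b.subset_target).preimage_isClosed_of_isClosed
    Metric.isClosed_closedBall hS

/-- A local equation of a surface tangent to the center-unstable field, normalised at a point. -/
lemma exists_equation (b : IsStableBox g E v e x₀ R X θ w η₀)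
    (hS : IsSurfaceTangentTo (fun x => E 1 x ⊔ E 2 x) S) {p : 𝔼} (hp : p ∈ chartPiece x₀ R S) :
    ∃ (V : Set 𝔼) (u : 𝔼 → ℝ), IsOpen V ∧ p ∈ V ∧ V ⊆ (extChartAt (𝓡 3) x₀).target ∧
      ContinuousOn u V ∧ (∀ q ∈ V, (extChartAt (𝓡 3) x₀).symm q ∈ S ↔ u q = 0) ∧
      HasStrictFDerivAt u (θ p) p := by
  set φ := extChartAt (𝓡 3) x₀
  obtain ⟨V, hV, hpV, h, hh, hSV, hker⟩ := hS (φ.symm p) hp.2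
  have hpt : p ∈ φ.target := b.subset_target hp.1
  have hs : HasStrictFDerivAt (h ∘ φ.symm) (differential h (φ.symm p) ∘L chartFrame x₀ p) p :=
    ContMDiffAt.hasStrictFDerivAt_comp_chart_symm hpt
      ((hh _ hpV).contMDiffAt (hV.mem_nhds hpV))
  set A := differential h (φ.symm p) ∘L chartFrame x₀ p
  have hA : ∀ z, A z = 0 ↔ θ p z = 0 := by
    intro z
    rw [b.form_eq_zero_iff p hp.1 z]
    exact Submodule.ext_iff.1 (hker _ ⟨hp.2, hpV⟩) (chartFrame x₀ p z)
  have hw1 := b.form_apply p hp.1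
  have hAw : A w ≠ 0 := fun h0 => by
    rw [(hA w).1 h0] at hw1; exact zero_ne_one hw1
  -- Two functionals with the same kernel are proportional, and `θ p w = 1` fixes the factor.
  have hAθ : (A w)⁻¹ • A = θ p := by
    ext z
    have h1 : A (z - θ p z • w) = 0 := (hA _).2 (by
      rw [map_sub, map_smul, hw1, smul_eq_mul, mul_one, sub_self])
    rw [map_sub, map_smul, smul_eq_mul, sub_eq_zero] at h1
    rw [smul_apply, h1, smul_eq_mul]
    field_simp
  refine ⟨φ.target ∩ φ.symm ⁻¹' V, fun q => (A w)⁻¹ • (h ∘ φ.symm) q,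
    (continuousOn_extChartAt_symm x₀).isOpen_inter_preimage (isOpen_extChartAt_target x₀) hV,
    ⟨hpt, hpV⟩, inter_subset_left, ?_, fun q hq => ?_, ?_⟩
  · have h1 : ContinuousOn (h ∘ φ.symm) (φ.target ∩ φ.symm ⁻¹' V) :=
      hh.continuousOn.comp ((continuousOn_extChartAt_symm x₀).mono inter_subset_left)
        fun q hq => hq.2
    exact h1.const_smul (A w)⁻¹
  · have h1 := Set.ext_iff.1 hSV (φ.symm q)
    have h2 : φ.symm q ∈ V := hq.2
    simp only [mem_inter_iff, h2, and_true, mem_ofPred_eq, true_and] at h1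
    rw [h1]
    simp [hAw]
  · rw [← hAθ]
    exact hs.const_smul (A w)⁻¹

/-- Along the line `r ↦ p + u - r • w` the local equation differs from `θ p₁ u - r` by at most `η /
2 * ‖u‖`, so it changes sign on an interval of that radius around `θ p₁ u`. The other half of `η`
pays for moving the form from `p₁` to `p`. -/
lemma exists_local_tangentSteps (b : IsStableBox g E v e x₀ R X θ w η₀)
    (hS : IsSurfaceTangentTo (fun x => E 1 x ⊔ E 2 x) S) {p₁ : 𝔼}
    (hp₁ : p₁ ∈ chartPiece x₀ R S) {η : ℝ} (hη : 0 < η) :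
    ∃ ρ > 0, ∀ p ∈ chartPiece x₀ R S, dist p p₁ < ρ → ∀ u : 𝔼, ‖u‖ ≤ ρ →
      ∃ r : ℝ, |r - θ p u| ≤ η * ‖u‖ ∧ (extChartAt (𝓡 3) x₀).symm (p + u - r • w) ∈ S := by
  obtain ⟨V, h, hV, hpV, hVt, hhc, hVS, hs⟩ := b.exists_equation hS hp₁
  set K := 1 + (‖θ p₁‖ + η / 2) * ‖w‖ with hK
  have hK0 : 0 < K := by positivity
  have hl : ∀ᶠ q : 𝔼 × 𝔼 in 𝓝 (p₁, p₁), ‖h q.1 - h q.2 - θ p₁ (q.1 - q.2)‖ ≤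
      (η / 2 / K) * ‖q.1 - q.2‖ := hs.isLittleO.def (by positivity)
  have hlV : ∀ᶠ q : 𝔼 × 𝔼 in 𝓝 (p₁, p₁), q.1 ∈ V ∧ q.2 ∈ V :=
    (continuousAt_fst.eventually (hV.mem_nhds hpV)).and
      (continuousAt_snd.eventually (hV.mem_nhds hpV))
  have hall := hl.and hlV
  rw [nhds_prod_eq, (Metric.nhds_basis_ball.prod_self).eventually_iff] at hall
  obtain ⟨d, hd, hall⟩ := hall
  obtain ⟨d', hd', hθ⟩ := Metric.continuousOn_iff.1 b.continuousOn_form p₁ hp₁.1 (η / 2)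
    (half_pos hη)
  refine ⟨min d' (d / (2 * (K + 1))), lt_min hd' (by positivity), fun p hp hpp u hu => ?_⟩
  have hd2 : d / (2 * (K + 1)) ≤ d / 2 := by
    apply div_le_div_of_nonneg_left hd.le two_pos; linarith
  have hpd : p ∈ Metric.ball p₁ d := by
    rw [Metric.mem_ball]
    exact hpp.trans_le ((min_le_right _ _).trans (hd2.trans (by linarith)))
  have hp0 : h p = 0 := (hVS p (hall (x := (p, p)) ⟨hpd, hpd⟩).2.1).1 hp.2
  have hθp : |θ p u - θ p₁ u| ≤ η / 2 * ‖u‖ := by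
    have h1 := (hθ p hp.1 (hpp.trans_le (min_le_left _ _))).le
    rw [dist_eq_norm] at h1
    rw [← sub_apply, ← Real.norm_eq_abs]
    exact (ContinuousLinearMap.le_opNorm _ _).trans (by gcongr)
  have hr : ∀ r ∈ Icc (θ p₁ u - η / 2 * ‖u‖) (θ p₁ u + η / 2 * ‖u‖),
      p + u - r • w ∈ Metric.ball p₁ d ∧ |h (p + u - r • w) - (θ p₁ u - r)| ≤ η / 2 * ‖u‖ := by
    intro r hr
    have hrb : |r| ≤ (‖θ p₁‖ + η / 2) * ‖u‖ := by
      have h1 := (θ p₁).le_opNorm u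
      rw [Real.norm_eq_abs] at h1
      have h2 := abs_le.1 h1
      exact abs_le.2 ⟨by linarith [hr.1], by linarith [hr.2]⟩
    have hun : ‖u - r • w‖ ≤ K * ‖u‖ := by
      refine (norm_sub_le _ _).trans ?_
      rw [norm_smul, Real.norm_eq_abs]
      have := mul_le_mul_of_nonneg_right hrb (norm_nonneg w)
      rw [hK]; linarith
    have hmem : p + u - r • w ∈ Metric.ball p₁ d := by
      rw [Metric.mem_ball, dist_eq_norm]
      have h1 : p + u - r • w - p₁ = (p - p₁) + (u - r • w) := by abel
      have h2 : ‖p - p₁‖ < d / 2 := by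
        rw [← dist_eq_norm]; exact hpp.trans_le ((min_le_right _ _).trans hd2)
      have h3 : K * ‖u‖ ≤ d / 2 := by
        calc K * ‖u‖ ≤ (K + 1) * (d / (2 * (K + 1))) := by
              gcongr
              · linarith
              · exact hu.trans (min_le_right _ _)
          _ = d / 2 := by field_simp
      rw [h1]
      exact (norm_add_le _ _).trans_lt (by linarith)
    refine ⟨hmem, ?_⟩
    have h1 := (hall (x := (p + u - r • w, p)) ⟨hmem, hpd⟩).1
    simp only [hp0, sub_zero] at h1
    have h2 : p + u - r • w - p = u - r • w := by abel
    rw [h2, map_sub, map_smul, b.form_apply p₁ hp₁.1, smul_eq_mul, mul_one,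
      Real.norm_eq_abs] at h1
    refine h1.trans ?_
    calc η / 2 / K * ‖u - r • w‖ ≤ η / 2 / K * (K * ‖u‖) := by gcongr
      _ = η / 2 * ‖u‖ := by field_simp
  have hcont : ContinuousOn (fun r : ℝ => h (p + u - r • w))
      (Icc (θ p₁ u - η / 2 * ‖u‖) (θ p₁ u + η / 2 * ‖u‖)) := by
    refine hhc.comp (by fun_prop) fun r hr' => ?_
    exact (hall (x := (p + u - r • w, p)) ⟨(hr r hr').1, hpd⟩).2.1
  have hnn : 0 ≤ η / 2 * ‖u‖ := by positivity
  have hle : θ p₁ u - η / 2 * ‖u‖ ≤ θ p₁ u + η / 2 * ‖u‖ := by linarith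
  have h0 : (0 : ℝ) ∈ Icc (h (p + u - (θ p₁ u + η / 2 * ‖u‖) • w))
      (h (p + u - (θ p₁ u - η / 2 * ‖u‖) • w)) := by
    have h1 := abs_le.1 (hr _ (left_mem_Icc.2 hle)).2
    have h2 := abs_le.1 (hr _ (right_mem_Icc.2 hle)).2
    exact ⟨by linarith, by linarith⟩
  obtain ⟨r, hr', hr0⟩ := intermediate_value_Icc' hle hcont h0
  refine ⟨r, ?_, (hVS _ (hall (x := (p + u - r • w, p)) ⟨(hr r hr').1, hpd⟩).2.1).2 hr0⟩
  have h1 := abs_le.1 hθp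
  exact abs_le.2 ⟨by linarith [hr'.1], by linarith [hr'.2]⟩

/-- Closed surfaces tangent to the center-unstable field can be followed in all directions. -/
lemma hasTangentSteps_chartPiece (b : IsStableBox g E v e x₀ R X θ w η₀) (hSc : IsClosed S)
    (hS : IsSurfaceTangentTo (fun x => E 1 x ⊔ E 2 x) S) :
    HasTangentSteps θ w (chartPiece x₀ R S)
      (Metric.closedBall (extChartAt (𝓡 3) x₀ x₀) (R / 2)) := by
  intro η hη
  have hR := b.pos
  set p₀ := extChartAt (𝓡 3) x₀ x₀
  obtain ⟨C, hC0, hC⟩ := b.exists_form_bound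
  have hcpt : IsCompact (chartPiece x₀ R S) :=
    (isCompact_closedBall p₀ R).of_isClosed_subset (b.isClosed_chartPiece hSc) inter_subset_left
  have hloc : ∀ p₁ ∈ chartPiece x₀ R S, ∃ t ∈ 𝓝 p₁, ∃ ρ > 0, ∀ p ∈ chartPiece x₀ R S, p ∈ t →
      ∀ u : 𝔼, ‖u‖ ≤ ρ → ∃ r : ℝ, |r - θ p u| ≤ η * ‖u‖ ∧
        (extChartAt (𝓡 3) x₀).symm (p + u - r • w) ∈ S := by
    intro p₁ hp₁
    obtain ⟨ρ, hρ, h⟩ := b.exists_local_tangentSteps hS hp₁ hη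
    exact ⟨Metric.ball p₁ ρ, Metric.ball_mem_nhds _ hρ, ρ, hρ, fun p hp hpt => h p hp hpt⟩
  obtain ⟨ρ, hρ, hglob⟩ : ∃ ρ > 0, ∀ p ∈ chartPiece x₀ R S, ∀ u : 𝔼, ‖u‖ ≤ ρ → ∃ r : ℝ,
      |r - θ p u| ≤ η * ‖u‖ ∧ (extChartAt (𝓡 3) x₀).symm (p + u - r • w) ∈ S := by
    suffices h : ∃ ρ > 0, ∀ p ∈ chartPiece x₀ R S, p ∈ chartPiece x₀ R S → ∀ u : 𝔼, ‖u‖ ≤ ρ →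
        ∃ r : ℝ, |r - θ p u| ≤ η * ‖u‖ ∧
          (extChartAt (𝓡 3) x₀).symm (p + u - r • w) ∈ S by
      obtain ⟨ρ, hρ, h⟩ := h
      exact ⟨ρ, hρ, fun p hp => h p hp hp⟩
    -- Compactness of the piece turns the local step sizes into a single one.
    refine hcpt.induction_on (p := fun t => ∃ ρ > 0, ∀ p ∈ t, p ∈ chartPiece x₀ R S → ∀ u : 𝔼,
        ‖u‖ ≤ ρ → ∃ r : ℝ, |r - θ p u| ≤ η * ‖u‖ ∧
          (extChartAt (𝓡 3) x₀).symm (p + u - r • w) ∈ S)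
      ⟨1, one_pos, fun p hp => hp.elim⟩ ?_ ?_ ?_
    · rintro s t hst ⟨ρ, hρ, h⟩
      exact ⟨ρ, hρ, fun p hp => h p (hst hp)⟩
    · rintro s t ⟨ρ, hρ, h⟩ ⟨ρ', hρ', h'⟩
      refine ⟨min ρ ρ', lt_min hρ hρ', ?_⟩
      rintro p (hp | hp) hpS u hu
      · exact h p hp hpS u (hu.trans (min_le_left _ _))
      · exact h' p hp hpS u (hu.trans (min_le_right _ _))
    · intro p₁ hp₁
      obtain ⟨t, ht, ρ, hρ, h⟩ := hloc p₁ hp₁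
      exact ⟨t, mem_nhdsWithin_of_mem_nhds ht, ρ, hρ, fun p hp hpS => h p hpS hp⟩
  -- The base point lies in the half ball and a step has length at most `K * ‖u‖`, so the new point
  -- stays in the full ball.
  set K := 1 + (C + η) * ‖w‖ with hK
  have hK0 : 0 < K := by positivity
  refine ⟨min ρ (R / 2 / K), lt_min hρ (by positivity), fun p hp u hu => ?_⟩
  obtain ⟨r, hr, hrS⟩ := hglob p hp.1 u (hu.trans (min_le_left _ _))
  refine ⟨r, hr, ?_, hrS⟩
  have h1 : |θ p u| ≤ C * ‖u‖ := by
    rw [← Real.norm_eq_abs]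
    exact ((θ p).le_opNorm u).trans (mul_le_mul_of_nonneg_right (hC p hp.1.1) (norm_nonneg _))
  have hrb : |r| ≤ (C + η) * ‖u‖ := by
    have h2 := abs_le.1 h1
    have h3 := abs_le.1 hr
    exact abs_le.2 ⟨by linarith, by linarith⟩
  have hun : ‖u - r • w‖ ≤ R / 2 := by
    calc ‖u - r • w‖ ≤ ‖u‖ + ‖r • w‖ := norm_sub_le _ _
      _ ≤ K * ‖u‖ := by
        rw [norm_smul, Real.norm_eq_abs]
        have := mul_le_mul_of_nonneg_right hrb (norm_nonneg w)
        rw [hK]; linarith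
      _ ≤ K * (R / 2 / K) := by gcongr; exact hu.trans (min_le_right _ _)
      _ = R / 2 := by field_simp
  have hp2 : ‖p - p₀‖ ≤ R / 2 := by rw [← dist_eq_norm]; exact hp.2
  rw [Metric.mem_closedBall, dist_eq_norm]
  have h4 : p + u - r • w - p₀ = (p - p₀) + (u - r • w) := by abel
  rw [h4]
  exact (norm_add_le _ _).trans (by linarith)

end IsStableBox

namespace IsAdaptedFrame

/-- Nearby points on a surface tangent to the center-unstable field differ by a vector in the
center-unstable cone. -/
lemma exists_coordGap_le_of_surface [CompactSpace M] (h : IsAdaptedFrame f g E v lam e)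
    {T : Set M} (hTc : IsClosed T) (hT : IsSurfaceTangentTo (fun x => E 1 x ⊔ E 2 x) T) :
    ∃ ε > 0, ∀ x y, ‖e x - e y‖ < ε → x ∈ T → y ∈ T →
      coordGap e v x y 0 ≤ coordGap e v x y 1 + coordGap e v x y 2 := by
  refine exists_uniform_near_diagonal (P := fun x y => x ∈ T → y ∈ T →
      coordGap e v x y 0 ≤ coordGap e v x y 1 + coordGap e v x y 2)
    h.contMDiff.continuous h.injective fun x₀ => ?_
  by_cases hx : x₀ ∈ T
  · obtain ⟨R, X, θ, w, η₀, b⟩ := h.exists_isStableBox x₀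
    set φ := extChartAt (𝓡 3) x₀
    have hp : φ x₀ ∈ chartPiece x₀ R T := ⟨b.center_mem, by
      rw [mem_preimage, extChartAt_to_inv x₀]; exact hx⟩
    obtain ⟨V, u, hV, hpV, hVt, huc, hVS, hs⟩ := b.exists_equation hT hp
    have hl : ∀ᶠ q : 𝔼 × 𝔼 in 𝓝 (φ x₀, φ x₀), ‖u q.1 - u q.2 - θ (φ x₀) (q.1 - q.2)‖ ≤
      η₀ * ‖q.1 - q.2‖ := hs.isLittleO.def b.eta_pos
    have hφ : ContinuousAt φ x₀ := continuousAt_extChartAt x₀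
    have h1 : Tendsto (fun q : M × M => (φ q.2, φ q.1)) (𝓝 (x₀, x₀)) (𝓝 (φ x₀, φ x₀)) := by
      rw [nhds_prod_eq, nhds_prod_eq]
      exact ((hφ.tendsto.comp tendsto_snd).prodMk (hφ.tendsto.comp tendsto_fst))
    have hs1 := extChartAt_source_mem_nhds (I := 𝓡 3) x₀
    have hs2 : ∀ᶠ x in 𝓝 x₀, φ x ∈ V ∩ Metric.closedBall (φ x₀) R :=
      hφ.eventually (inter_mem (hV.mem_nhds hpV) (Metric.closedBall_mem_nhds _ b.pos))
    filter_upwards [h1.eventually hl, prod_mem_nhds hs1 hs1, prod_mem_nhds hs2 hs2]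
      with q hq hqs hqV hq1 hq2
    have e1 : φ.symm (φ q.1) = q.1 := φ.left_inv hqs.1
    have e2 : φ.symm (φ q.2) = q.2 := φ.left_inv hqs.2
    -- The local equation vanishes at both points, so its expansion bounds `θ` on their difference
    -- by `η₀` times the norm.
    have hgap := b.coordGap_le (φ q.1) hqV.1.2 (φ q.2) hqV.2.2 (by
      have h2 : u (φ q.1) = 0 := (hVS _ hqV.1.1).1 (e1.symm ▸ hq1)
      have h3 : u (φ q.2) = 0 := (hVS _ hqV.2.1).1 (e2.symm ▸ hq2)
      rw [h2, h3, sub_zero, zero_sub, norm_neg, Real.norm_eq_abs] at hq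
      exact hq)
    change coordGap e v (φ.symm (φ q.1)) (φ.symm (φ q.2)) 0 ≤ coordGap e v (φ.symm (φ q.1))
      (φ.symm (φ q.2)) 1 + coordGap e v (φ.symm (φ q.1)) (φ.symm (φ q.2)) 2 at hgap
    rwa [e1, e2] at hgap
  · filter_upwards [continuousAt_fst.eventually (hTc.isOpen_compl.mem_nhds hx)] with q hq hq1
    exact absurd hq1 hq

/-- A closed surface tangent to the center-unstable field contains no two stably related points. -/
lemma exists_separation_surface [CompactSpace M] (h : IsAdaptedFrame f g E v lam e) {κ : ℝ}
    (hκ : ∀ x, lam 0 x ≤ κ) (hκ1 : κ ≤ 1)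
    {T : Set M} (hTc : IsClosed T) (hT : IsSurfaceTangentTo (fun x => E 1 x ⊔ E 2 x) T) :
    ∃ ε > 0, ∀ x ∈ T, ∀ y ∈ T, StableRel e f (lam 0) ε x y → x = y := by
  obtain ⟨ε₁, hε₁, h1⟩ := h.exists_separation hκ hκ1
  obtain ⟨ε₂, hε₂, h2⟩ := h.exists_coordGap_le_of_surface hTc hT
  refine ⟨min ε₁ (ε₂ / 2), lt_min hε₁ (half_pos hε₂), fun x hx y hy hxy => ?_⟩
  refine h1 x y (hxy.mono (h.lam_pos 0) (min_le_left _ _)) (h2 x y ?_ hx hy)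
  have h3 := hxy.norm_iterate_le (h.lam_pos 0) hκ 0
  rw [pow_zero, mul_one] at h3
  exact (h3.trans (min_le_right _ _)).trans_lt (half_lt_self hε₂)

/-- Every point close to a closed surface tangent to the center-unstable field is stably related
to a point of the surface, uniformly in the surface. -/
lemma exists_uniform_hits [CompactSpace M] (h : IsAdaptedFrame f g E v lam e) {l : ℝ}
    (hl : 0 < l) : ∃ ε > 0, ∀ S : Set M, IsClosed S →
      IsSurfaceTangentTo (fun x => E 1 x ⊔ E 2 x) S → ∀ y z, z ∈ S → ‖e y - e z‖ < ε →
        ∃ q ∈ S, StableRel e f (lam 0) l y q := by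
  obtain ⟨C, hC0, hC⟩ := h.exists_norm_differential_le
  -- The quantifier over surfaces is moved inside the property of pairs, so that compactness of the
  -- diagonal yields one `ε` for all of them.
  suffices hmain : ∃ ε > 0, ∀ y z, ‖e y - e z‖ < ε → ∀ S : Set M, IsClosed S →
      IsSurfaceTangentTo (fun x => E 1 x ⊔ E 2 x) S → z ∈ S →
        ∃ q ∈ S, StableRel e f (lam 0) l y q by
    obtain ⟨ε, hε, hm⟩ := hmain
    exact ⟨ε, hε, fun S hSc hS y z hz hyz => hm y z hyz S hSc hS hz⟩
  refine exists_uniform_near_diagonal h.contMDiff.continuous h.injective fun x₀ => ?_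
  obtain ⟨R, X, θ, w, η₀, b⟩ := h.exists_isStableBox x₀
  obtain ⟨Cθ, hCθ0, hCθ⟩ := b.exists_form_bound
  obtain ⟨r₁, hr₁, hhit⟩ := b.exists_hit
  obtain ⟨r₀, hr₀, hsteps⟩ := b.exists_uniform_tangentSteps
  obtain ⟨r, hr, hsteps⟩ := hsteps 1 one_pos
  set φ := extChartAt (𝓡 3) x₀
  have hφ : ContinuousAt φ x₀ := continuousAt_extChartAt x₀
  have hR := b.pos
  -- The chart distance `d` must allow a tangent step of size `r`. The resulting offset is at most
  -- `(Cθ + 1) * d`; it must not exceed `r₁`, and the arc of length twice the offset must have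
  -- constant at most `l`.
  set d := min r (min (r₁ / (Cθ + 1)) (l / (2 * C * (Cθ + 1))))
  have hd : 0 < d := lt_min hr (lt_min (by positivity) (by positivity))
  have hsrc : ∀ᶠ x in 𝓝 x₀, x ∈ φ.source := extChartAt_source_mem_nhds x₀
  have hball : ∀ᶠ x in 𝓝 x₀, x ∈ φ.source ∧ φ x ∈ Metric.closedBall (φ x₀)
      (min r₁ (min r₀ (min R (d / 2)))) :=
    hsrc.and
      (hφ.eventually (Metric.closedBall_mem_nhds _
        (lt_min hr₁ (lt_min hr₀ (lt_min hR (half_pos hd))))))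
  filter_upwards [prod_mem_nhds hball hball] with q hq S hSc hS hqS
  obtain ⟨⟨hy1, hy2⟩, hz1, hz2⟩ := hq
  rw [Metric.mem_closedBall, le_min_iff, le_min_iff, le_min_iff] at hy2 hz2
  have e1 : φ.symm (φ q.1) = q.1 := φ.left_inv hy1
  have e2 : φ.symm (φ q.2) = q.2 := φ.left_inv hz1
  have hst := b.hasTangentSteps_chartPiece hSc hS
  have hcl := b.isClosed_chartPiece hSc
  have hzS : φ q.2 ∈ chartPiece x₀ R S := ⟨hz2.2.2.1, by
    change φ.symm (φ q.2) ∈ S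
    rwa [e2]⟩
  have hu : ‖φ q.1 - φ q.2‖ ≤ d := by
    rw [← dist_eq_norm]
    have := dist_triangle_right (φ q.1) (φ q.2) (φ x₀)
    linarith [hy2.2.2.2, hz2.2.2.2]
  obtain ⟨ρ, hρ, hρS⟩ := hsteps _ hcl hst (φ q.2) ⟨hzS, hz2.2.1⟩ (φ q.1 - φ q.2)
    (hu.trans (min_le_left _ _))
  rw [add_sub_cancel] at hρS
  have h1 : |θ (φ q.2) (φ q.1 - φ q.2)| ≤ Cθ * ‖φ q.1 - φ q.2‖ := by
    rw [← Real.norm_eq_abs]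
    exact ((θ _).le_opNorm _).trans
      (mul_le_mul_of_nonneg_right (hCθ _ hzS.1) (norm_nonneg _))
  have hρb : |ρ| ≤ (Cθ + 1) * d := by
    have h2 := abs_le.1 h1
    have h3 := abs_le.1 hρ
    refine le_trans ?_ (mul_le_mul_of_nonneg_left hu (by positivity))
    exact abs_le.2 ⟨by linarith, by linarith⟩
  have hρ1 : |ρ| ≤ r₁ := by
    refine hρb.trans ?_
    calc (Cθ + 1) * d ≤ (Cθ + 1) * (r₁ / (Cθ + 1)) := by
          gcongr; exact (min_le_right _ _).trans (min_le_left _ _)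
      _ = r₁ := by field_simp
  have hρ2 : C * (2 * |ρ|) ≤ l := by
    calc C * (2 * |ρ|) ≤ C * (2 * ((Cθ + 1) * (l / (2 * C * (Cθ + 1))))) := by
          gcongr
          refine hρb.trans ?_
          gcongr
          exact (min_le_right _ _).trans (min_le_right _ _)
      _ = l := by field_simp
  obtain ⟨τ, hτ, -, γ, hγ0, hγτ, hsol⟩ := hhit _ hcl hst (φ q.1) ρ hy2.1 hρ1 hρS
  refine ⟨φ.symm (γ τ), hγτ.2, ?_⟩
  have hτ0 : (0 : ℝ) ∈ Icc 0 τ := left_mem_Icc.2 hτ.1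
  have hττ : τ ∈ Icc 0 τ := right_mem_Icc.2 hτ.1
  have hrel : StableRel e f (lam 0) (C * |τ - 0|) (φ.symm (γ 0)) (φ.symm (γ τ)) := by
    rcases hsol with hsol | hsol
    · exact b.stableRel h hC0.le hC hsol hτ0 hττ
    · refine h.stableRel_of_isSolutionOn hC0.le hC b.subset_target (fun p hp => ?_) hsol hτ0 hττ
      rw [map_neg, g.len_neg]
      exact ⟨Submodule.neg_mem _ (b.mem_stable hp), b.unit p hp⟩
  rw [hγ0, e1, sub_zero, abs_of_nonneg hτ.1] at hrel
  exact hrel.mono (h.lam_pos 0) (le_trans (by gcongr; exact hτ.2) hρ2)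

end IsAdaptedFrame

end TangentSurfaces

/-! ### Arcs in charts and flow boxes of uniform size -/

section StableFamily

variable {M : Type*} [TopologicalSpace M] [ChartedSpace (EuclideanSpace ℝ (Fin 3)) M]
  [IsManifold (𝓡 3) ∞ M]

local notation "𝔼" => EuclideanSpace ℝ (Fin 3)

/-- The curve `c` is differentiable with unit velocity in the line field `E`. -/
def IsTangentArc (g : RiemMetric M) (E : PlaneField M) (c : ℝ → M) (a b : ℝ) : Prop :=
  ∀ t ∈ Icc a b, ∃ L : TangentSpace 𝓘(ℝ, ℝ) t →L[ℝ] TangentSpace (𝓡 3) (c t),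
    HasMFDerivWithinAt 𝓘(ℝ, ℝ) (𝓡 3) c (Icc a b) t L ∧ L (1 : ℝ) ∈ E (c t) ∧
      g.len (c t) (L (1 : ℝ)) = 1

/-- An equality in the total space, because the base points agree only propositionally; properties
of tangent vectors are transported along it. -/
lemma mk_chartFrame_mfderiv {x₀ y : M} (hy : y ∈ (extChartAt (𝓡 3) x₀).source)
    (z : TangentSpace (𝓡 3) y) :
    (⟨(extChartAt (𝓡 3) x₀).symm (extChartAt (𝓡 3) x₀ y), chartFrame x₀ (extChartAt (𝓡 3) x₀ y)
      (mfderiv (𝓡 3) 𝓘(ℝ, 𝔼) (extChartAt (𝓡 3) x₀) y z)⟩ : TangentBundle (𝓡 3) M) = ⟨y, z⟩ := by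
  set 𝒯 := trivializationAt 𝔼 (TangentSpace (𝓡 3) (M := M)) x₀
  have hy' : y ∈ (chartAt 𝔼 x₀).source := by rwa [← extChartAt_source (𝓡 3)]
  have h1 : ∀ (w : 𝔼) (b : M), b = y → (⟨b, 𝒯.symmL ℝ b w⟩ : TangentBundle (𝓡 3) M) =
      ⟨y, 𝒯.symmL ℝ y w⟩ := by rintro w _ rfl; rfl
  refine (h1 _ _ ((extChartAt (𝓡 3) x₀).left_inv hy)).trans ?_
  congr 1
  have h2 := TangentBundle.continuousLinearMapAt_trivializationAt (I := 𝓡 3) hy'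
  rw [← h2]
  exact Bundle.Trivialization.symmL_continuousLinearMapAt 𝒯 (by
    rwa [TangentBundle.trivializationAt_baseSet]) z

lemma IsSolutionOn.isTangentArc {g : RiemMetric M} {E : PlaneField M} {x₀ : M} {B : Set 𝔼}
    (hB : B ⊆ (extChartAt (𝓡 3) x₀).target) {X : 𝔼 → 𝔼}
    (hX : ∀ p ∈ B, chartFrame x₀ p (X p) ∈ E ((extChartAt (𝓡 3) x₀).symm p) ∧
      g.len _ (chartFrame x₀ p (X p)) = 1)
    {γ : ℝ → 𝔼} {a b : ℝ} (hγ : IsSolutionOn X B γ a b) :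
    IsTangentArc g E (fun t => (extChartAt (𝓡 3) x₀).symm (γ t)) a b := by
  intro t ht
  have h1 := (hγ t ht).2.hasFDerivWithinAt.hasMFDerivWithinAt
  have h2 := (hasMFDerivAt_chart_symm (hB (hγ t ht).1)).comp_hasMFDerivWithinAt t h1
  refine ⟨_, h2, ?_⟩
  have h3 : (chartFrame x₀ (γ t) ∘L ContinuousLinearMap.toSpanSingleton ℝ (X (γ t))) (1 : ℝ) =
      chartFrame x₀ (γ t) (X (γ t)) := by
    rw [ContinuousLinearMap.comp_apply, ContinuousLinearMap.toSpanSingleton_apply, one_smul]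
  have h4 := hX _ (hγ t ht).1
  rw [← h3] at h4
  exact h4

/-- At each time the velocity is the field or its negative. The height has a nowhere vanishing
derivative, which by Darboux's theorem has constant sign, so the choice is the same throughout;
continuity of the velocity is not needed. -/
lemma IsTangentArc.isSolutionOn {g : RiemMetric M} {E : PlaneField M} {x₀ : M} {B : Set 𝔼}
    {X : 𝔼 → 𝔼} {c : ℝ → M} {a b : ℝ} (hc : IsTangentArc g E c a b)
    (hcs : ∀ t ∈ Icc a b, c t ∈ (extChartAt (𝓡 3) x₀).source)
    (hcB : ∀ t ∈ Icc a b, extChartAt (𝓡 3) x₀ (c t) ∈ B)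
    (hX : ∀ p ∈ B, g.len _ (chartFrame x₀ p (X p)) = 1 ∧
      E ((extChartAt (𝓡 3) x₀).symm p) = Submodule.span ℝ {chartFrame x₀ p (X p)})
    {ℓ : 𝔼 →L[ℝ] ℝ} (hℓ : ∀ p ∈ B, 0 < ℓ (X p)) :
    IsSolutionOn X B (fun t => extChartAt (𝓡 3) x₀ (c t)) a b ∨
      IsSolutionOn (fun p => -X p) B (fun t => extChartAt (𝓡 3) x₀ (c t)) a b := by
  set φ := extChartAt (𝓡 3) x₀
  have hd : ∀ t ∈ Icc a b, ∃ d, HasDerivWithinAt (fun t => φ (c t)) d (Icc a b) t ∧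
      (d = X (φ (c t)) ∨ d = -X (φ (c t))) := by
    intro t ht
    obtain ⟨L, hL, hLE, hL1⟩ := hc t ht
    have hs := hcs t ht
    have h1 : MDifferentiableAt (𝓡 3) 𝓘(ℝ, 𝔼) φ (c t) :=
      mdifferentiableAt_extChartAt (by rwa [← extChartAt_source (𝓡 3)])
    have h2 := h1.hasMFDerivAt.comp_hasMFDerivWithinAt t hL
    have h3 : HasFDerivWithinAt (φ ∘ c) ((mfderiv (𝓡 3) 𝓘(ℝ, 𝔼) φ (c t) ∘L L : ℝ →L[ℝ] 𝔼))
      (Icc a b) t := h2.hasFDerivWithinAt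
    set d : 𝔼 := mfderiv (𝓡 3) 𝓘(ℝ, 𝔼) φ (c t) (L (1 : ℝ))
    refine ⟨d, h3.hasDerivWithinAt, ?_⟩
    have h4 := mk_chartFrame_mfderiv hs (L (1 : ℝ))
    have h5 : ∀ q q' : TangentBundle (𝓡 3) M, q = q' → q'.2 ∈ E q'.1 ∧ g.len q'.1 q'.2 = 1 →
        q.2 ∈ E q.1 ∧ g.len q.1 q.2 = 1 := by rintro q _ rfl h; exact h
    have h6 := h5 _ _ h4 ⟨hLE, hL1⟩
    change chartFrame x₀ (φ (c t)) d ∈ E (φ.symm (φ (c t))) ∧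
      g.len _ (chartFrame x₀ (φ (c t)) d) = 1 at h6
    have h7 := hX _ (hcB t ht)
    have hbij := (bijective_chartFrame (φ.map_source hs)).1
    rcases g.eq_or_eq_neg (u := chartFrame x₀ (φ (c t)) (X (φ (c t)))) (h7.2 ▸ h6.1)
      (Submodule.mem_span_singleton_self _) (h6.2.trans h7.1.symm) with h8 | h8
    · exact Or.inl (hbij h8)
    · exact Or.inr (hbij (h8.trans (map_neg _ _).symm))
  choose! d hd hdX using hd
  have hℓd : ∀ t ∈ Icc a b, HasDerivWithinAt (fun t => ℓ (φ (c t))) (ℓ (d t)) (Icc a b) t :=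
    fun t ht => ℓ.hasFDerivAt.comp_hasDerivWithinAt t (hd t ht)
  have hne : ∀ t ∈ Icc a b, ℓ (d t) ≠ 0 := by
    intro t ht
    have h1 := hℓ _ (hcB t ht)
    rcases hdX t ht with h | h
    · rw [h]; exact h1.ne'
    · rw [h, map_neg]; exact (neg_neg_of_pos h1).ne
  rcases hasDerivWithinAt_forall_lt_or_forall_gt_of_forall_ne (convex_Icc a b) hℓd hne with h | h
  · right
    intro t ht
    have h1 := hℓ _ (hcB t ht)
    have h2 : d t = -X (φ (c t)) := (hdX t ht).resolve_left fun h3 => by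
      have := h t ht; rw [h3] at this; exact lt_asymm this h1
    exact ⟨hcB t ht, by have h4 := hd t ht; rw [h2] at h4; exact h4⟩
  · left
    intro t ht
    have h1 := hℓ _ (hcB t ht)
    have h2 : d t = X (φ (c t)) := (hdX t ht).resolve_right fun h3 => by
      have := h t ht; rw [h3, map_neg] at this; linarith
    exact ⟨hcB t ht, by have h4 := hd t ht; rw [h2] at h4; exact h4⟩

variable {F : Type*} [NormedAddCommGroup F] [InnerProductSpace ℝ F] [FiniteDimensional ℝ F]
  {f : M ≃ₘ^1⟮𝓡 3, 𝓡 3⟯ M} {g : RiemMetric M} {E : Fin 3 → PlaneField M}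
  {v : Fin 3 → ∀ x : M, TangentSpace (𝓡 3) x} {lam : Fin 3 → M → ℝ} {e : M → F}

/-- A box around `x₀` together with the local flow `ψ` of its vector field. -/
structure IsStableFlowBox (g : RiemMetric M) (E : Fin 3 → PlaneField M)
    (v : Fin 3 → ∀ x : M, TangentSpace (𝓡 3) x) (e : M → F) (x₀ : M) (R : ℝ) (X : 𝔼 → 𝔼)
    (θ : 𝔼 → 𝔼 →L[ℝ] ℝ) (w : 𝔼) (η₀ r : ℝ) (ψ : 𝔼 → ℝ → 𝔼) : Prop
    extends IsStableBox g E v e x₀ R X θ w η₀ where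
  radius_pos : 0 < r
  radius_le : r ≤ R / 2
  flow_zero : ∀ y ∈ Metric.closedBall (extChartAt (𝓡 3) x₀ x₀) r, ψ y 0 = y
  isSolutionOn_flow : ∀ y ∈ Metric.closedBall (extChartAt (𝓡 3) x₀ x₀) r,
    IsSolutionOn X (Metric.closedBall (extChartAt (𝓡 3) x₀ x₀) R) (ψ y) (-r) r
  continuousOn_flow : ContinuousOn (fun q : 𝔼 × ℝ => ψ q.1 q.2)
    (Metric.closedBall (extChartAt (𝓡 3) x₀ x₀) r ×ˢ Icc (-r) r)
  separates : SeparatesSolutions X (Metric.closedBall (extChartAt (𝓡 3) x₀ x₀) R)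
    (θ (extChartAt (𝓡 3) x₀ x₀)) r

namespace IsStableFlowBox

variable {x₀ : M} {R η₀ r : ℝ} {X : 𝔼 → 𝔼} {θ : 𝔼 → 𝔼 →L[ℝ] ℝ} {w : 𝔼} {ψ : 𝔼 → ℝ → 𝔼}

lemma eqOn_flow (b : IsStableFlowBox g E v e x₀ R X θ w η₀ r ψ) {y : 𝔼}
    (hy : y ∈ Metric.closedBall (extChartAt (𝓡 3) x₀ x₀) r) {c : ℝ → 𝔼} {s t : ℝ}
    (hc : IsSolutionOn X (Metric.closedBall (extChartAt (𝓡 3) x₀ x₀) R) c s t) (h0 : c 0 = y)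
    (hrs : -r ≤ s) (hs : s ≤ 0) (ht : 0 ≤ t) (htr : t ≤ r) : EqOn c (ψ y) (Icc s t) :=
  b.toIsTransverseBox.eqOn_of_isSolutionOn b.separates hrs hs ht htr hc
    ((b.isSolutionOn_flow y hy).mono hrs htr) (h0.trans (b.flow_zero y hy).symm)

lemma eqOn_flow_neg (b : IsStableFlowBox g E v e x₀ R X θ w η₀ r ψ) {y : 𝔼}
    (hy : y ∈ Metric.closedBall (extChartAt (𝓡 3) x₀ x₀) r) {c : ℝ → 𝔼} {s t : ℝ}
    (hc : IsSolutionOn (fun p => -X p) (Metric.closedBall (extChartAt (𝓡 3) x₀ x₀) R) c s t)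
    (h0 : c 0 = y) (hrs : -r ≤ s) (hs : s ≤ 0) (ht : 0 ≤ t) (htr : t ≤ r) :
    EqOn c (fun u => ψ y (-u)) (Icc s t) := by
  intro u hu
  have h1 := hc.comp_neg
  simp only [neg_neg] at h1
  have h2 := b.eqOn_flow hy h1 (by rw [neg_zero, h0]) (by linarith) (by linarith) (by linarith)
    (by linarith) (show -u ∈ Icc (-t) (-s) from ⟨by linarith [hu.2], by linarith [hu.1]⟩)
  simpa using h2

lemma flow_add (b : IsStableFlowBox g E v e x₀ R X θ w η₀ r ψ) {y : 𝔼} {s t : ℝ}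
    (hy : y ∈ Metric.closedBall (extChartAt (𝓡 3) x₀ x₀) r)
    (hys : ψ y s ∈ Metric.closedBall (extChartAt (𝓡 3) x₀ x₀) r) (hs : |s| ≤ r) (ht : |t| ≤ r)
    (hst : |s + t| ≤ r) : ψ (ψ y s) t = ψ y (s + t) := by
  rw [abs_le] at hs ht hst
  have h1 := ((b.isSolutionOn_flow y hy).comp_add s).mono (a' := min 0 t) (b' := max 0 t)
    (le_min (by linarith) (by linarith)) (max_le (by linarith) (by linarith))
  have h2 := b.eqOn_flow hys h1 (by simp) (le_min (by linarith) (by linarith)) (min_le_left _ _)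
    (le_max_left _ _) (max_le (by linarith) (by linarith))
    (show t ∈ Icc (min 0 t) (max 0 t) from ⟨min_le_right _ _, le_max_right _ _⟩)
  rw [← h2, add_comm]

lemma injOn_flow (b : IsStableFlowBox g E v e x₀ R X θ w η₀ r ψ) {y : 𝔼}
    (hy : y ∈ Metric.closedBall (extChartAt (𝓡 3) x₀ x₀) r) : InjOn (ψ y) (Icc (-r) r) := by
  have key : ∀ s ∈ Icc (-r) r, ∀ t ∈ Icc (-r) r, s ≤ t → ψ y s = ψ y t → s = t := by
    intro s hs t ht hst h
    have h1 := (b.isSolutionOn_flow y hy).lower_bound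
      (fun q hq => b.half_le _ b.center_mem q hq) hs ht hst
    rw [h, sub_self] at h1
    linarith
  intro s hs t ht h
  rcases le_total s t with hst | hst
  · exact key s hs t ht hst h
  · exact (key t ht s hs hst h.symm).symm

end IsStableFlowBox

/-- Two arcs of duration at most `ε / (2 * C)` have total constant at most `ε`, which is the range
in which solutions are separated. -/
theorem IsAdaptedFrame.exists_isStableFlowBox [CompactSpace M] (h : IsAdaptedFrame f g E v lam e)
    {κ : ℝ} (hκ : ∀ x, lam 0 x ≤ κ) (hκ1 : κ ≤ 1) (x₀ : M) :
    ∃ R X θ w η₀ r ψ, IsStableFlowBox g E v e x₀ R X θ w η₀ r ψ := by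
  obtain ⟨R, X, θ, w, η₀, b⟩ := h.exists_isStableBox x₀
  obtain ⟨ε, hε, hsep⟩ := h.exists_separation hκ hκ1
  obtain ⟨C, hC0, hC⟩ := h.exists_norm_differential_le
  have hR := b.pos
  have hr₀ : 0 < min (R / 2) (ε / (2 * C)) := lt_min (by positivity) (by positivity)
  have hs : SeparatesSolutions X (Metric.closedBall (extChartAt (𝓡 3) x₀ x₀) R)
      (θ (extChartAt (𝓡 3) x₀ x₀)) (min (R / 2) (ε / (2 * C))) := by
    refine b.separatesSolutions h hC0.le hC hsep ?_
    calc _ = 2 * C * min (R / 2) (ε / (2 * C)) := by ring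
      _ ≤ 2 * C * (ε / (2 * C)) := by gcongr; exact min_le_right _ _
      _ = ε := by field_simp
  obtain ⟨r, hr, hrr₀, hrR, ψ, hψ, hψc⟩ := b.toIsTransverseBox.exists_flow hr₀ hs
  exact ⟨R, X, θ, w, η₀, r, ψ, b, hr, hrr₀.trans (min_le_left _ _), fun y hy => (hψ y hy).1,
    fun y hy => (hψ y hy).2, hψc, fun a b' har ha hb hbr => hs a b' (by linarith) ha hb
      (by linarith)⟩

/-- Every point has a flow box that contains a ball of uniform size around it. -/
theorem IsAdaptedFrame.exists_uniform_isStableFlowBox [CompactSpace M]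
    (h : IsAdaptedFrame f g E v lam e) {κ : ℝ} (hκ : ∀ x, lam 0 x ≤ κ) (hκ1 : κ ≤ 1) :
    ∃ ρ > 0, ∀ x, ∃ x₀ R X θ w η₀ r ψ, IsStableFlowBox g E v e x₀ R X θ w η₀ r ψ ∧ ρ ≤ r ∧
      ∀ z, ‖e x - e z‖ < ρ → z ∈ (extChartAt (𝓡 3) x₀).source ∧
        extChartAt (𝓡 3) x₀ z ∈ Metric.ball (extChartAt (𝓡 3) x₀ x₀) r := by
  obtain ⟨ρ, hρ, hmain⟩ := exists_uniform_const (P := fun ρ q => ∃ x₀ R X θ w η₀ r ψ,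
      IsStableFlowBox g E v e x₀ R X θ w η₀ r ψ ∧ ρ ≤ r ∧
      ∀ z, ‖e q.1 - e z‖ < ρ → z ∈ (extChartAt (𝓡 3) x₀).source ∧
        extChartAt (𝓡 3) x₀ z ∈ Metric.ball (extChartAt (𝓡 3) x₀ x₀) r) (by
    rintro c c' q hcc ⟨x₀, R, X, θ, w, η₀, r, ψ, b, hr, hz⟩
    exact ⟨x₀, R, X, θ, w, η₀, r, ψ, b, hcc.trans hr, fun z h => hz z (h.trans_le hcc)⟩) (by
    intro x₀
    obtain ⟨R, X, θ, w, η₀, r, ψ, b⟩ := h.exists_isStableFlowBox hκ hκ1 x₀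
    have hin : ∀ᶠ z in 𝓝 x₀, z ∈ (extChartAt (𝓡 3) x₀).source ∧
        extChartAt (𝓡 3) x₀ z ∈ Metric.ball (extChartAt (𝓡 3) x₀ x₀) r := by
      have hsrc : ∀ᶠ z in 𝓝 x₀, z ∈ (extChartAt (𝓡 3) x₀).source := extChartAt_source_mem_nhds x₀
      exact hsrc.and ((continuousAt_extChartAt x₀).eventually
        (Metric.ball_mem_nhds _ b.radius_pos))
    -- Neighbourhoods of `x₀` become balls for the ambient distance, the only distance in which
    -- sizes can be compared between charts.
    have hemb := (h.contMDiff.continuous.isClosedEmbedding h.injective).isEmbedding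
    rw [hemb.nhds_eq_comap, (Metric.nhds_basis_ball.comap e).eventually_iff] at hin
    obtain ⟨d, hd, hin⟩ := hin
    refine ⟨min r (d / 2), lt_min b.radius_pos (half_pos hd), ?_⟩
    have hq : ∀ᶠ q : M × M in 𝓝 (x₀, x₀), dist (e q.1) (e x₀) < d / 2 :=
      (h.contMDiff.continuous.comp continuous_fst).continuousAt.eventually
        (Metric.ball_mem_nhds _ (half_pos hd))
    filter_upwards [hq] with q hq
    refine ⟨x₀, R, X, θ, w, η₀, r, ψ, b, min_le_left _ _, fun z hz => hin ?_⟩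
    rw [mem_preimage, Metric.mem_ball]
    have h1 := hz.trans_le (min_le_right _ _)
    rw [← dist_eq_norm, dist_comm] at h1
    linarith [dist_triangle (e z) (e q.1) (e x₀)])
  exact ⟨ρ, hρ, fun x => (hmain x).self_of_nhds⟩

end StableFamily

/-! ### Local stable leaves -/

section LocalStableLeaves

variable {M : Type*} [TopologicalSpace M] [ChartedSpace (EuclideanSpace ℝ (Fin 3)) M]
  [IsManifold (𝓡 3) ∞ M]

local notation "𝔼" => EuclideanSpace ℝ (Fin 3)

lemma IsSolutionOn.smul_sign {G : Type*} [NormedAddCommGroup G] [NormedSpace ℝ G] {X : G → G}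
    {B : Set G} {c : ℝ → G} {r σ : ℝ} (h : IsSolutionOn X B c (-r) r) (hσ : σ = 1 ∨ σ = -1) :
    IsSolutionOn (fun p => σ • X p) B (fun t => c (σ * t)) (-r) r := by
  rcases hσ with rfl | rfl
  · simpa using h
  · simpa using h.comp_neg

lemma IsSolutionOn.contDiffOn {G : Type*} [NormedAddCommGroup G] [NormedSpace ℝ G] {X : G → G}
    {B : Set G} {c : ℝ → G} {a b : ℝ} (h : IsSolutionOn X B c a b) (hX : ContinuousOn X B) :
    ContDiffOn ℝ 1 c (Ioo a b) := by
  have hd : ∀ t ∈ Ioo a b, HasDerivWithinAt c (X (c t)) (Ioo a b) t := fun t ht =>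
    (h t (Ioo_subset_Icc_self ht)).2.mono Ioo_subset_Icc_self
  rw [contDiffOn_one_iff_derivWithin isOpen_Ioo.uniqueDiffOn]
  refine ⟨fun t ht => (hd t ht).differentiableWithinAt, ?_⟩
  have h1 : ContinuousOn (fun t => X (c t)) (Ioo a b) :=
    hX.comp (h.continuousOn.mono Ioo_subset_Icc_self) fun t ht =>
      (h t (Ioo_subset_Icc_self ht)).1
  exact h1.congr fun t ht => (hd t ht).derivWithin (isOpen_Ioo.uniqueDiffOn t ht)

variable {F : Type*} [NormedAddCommGroup F] [InnerProductSpace ℝ F] [FiniteDimensional ℝ F]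
  {f : M ≃ₘ^1⟮𝓡 3, 𝓡 3⟯ M} {g : RiemMetric M} {E : Fin 3 → PlaneField M}
  {v : Fin 3 → ∀ x : M, TangentSpace (𝓡 3) x} {lam : Fin 3 → M → ℝ} {e : M → F}

/-- The curve `c` is a local stable leaf of size `ρ` through `x`, with velocity `v 0 x`. -/
structure IsLocalLeaf (f : M ≃ₘ^1⟮𝓡 3, 𝓡 3⟯ M) (g : RiemMetric M) (E : Fin 3 → PlaneField M)
    (v : Fin 3 → ∀ x : M, TangentSpace (𝓡 3) x) (lam : Fin 3 → M → ℝ) (e : M → F)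
    (C ρ : ℝ) (x : M) (c : ℝ → M) : Prop where
  zero : c 0 = x
  contMDiffOn : ContMDiffOn 𝓘(ℝ, ℝ) (𝓡 3) 1 c (Ioo (-ρ) ρ)
  isTangentArc : IsTangentArc g (E 0) c (-ρ) ρ
  tangentMap_zero : tangentMap 𝓘(ℝ, ℝ) (𝓡 3) c ⟨0, (1 : ℝ)⟩ = ⟨x, v 0 x⟩
  hasDerivAt : HasDerivAt (fun t => e (c t)) (differential e x (v 0 x)) 0
  stableRel : ∀ s ∈ Icc (-ρ) ρ, ∀ t ∈ Icc (-ρ) ρ,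
    StableRel e f (lam 0) (C * |t - s|) (c s) (c t)
  injOn : InjOn c (Icc (-ρ) ρ)

/-- The leaf is the flow line of the box, run backwards when the field of the box is opposite to `v
0 x`. -/
lemma IsStableFlowBox.isLocalLeaf {x₀ : M} {R η₀ r : ℝ} {X : 𝔼 → 𝔼} {θ : 𝔼 → 𝔼 →L[ℝ] ℝ} {w : 𝔼}
    {ψ : 𝔼 → ℝ → 𝔼} (b : IsStableFlowBox g E v e x₀ R X θ w η₀ r ψ)
    (h : IsAdaptedFrame f g E v lam e) {C : ℝ} (hC0 : 0 ≤ C)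
    (hC : ∀ x, ‖differential e x (v 0 x)‖ ≤ C) {x : M} (hxs : x ∈ (extChartAt (𝓡 3) x₀).source)
    (hxr : extChartAt (𝓡 3) x₀ x ∈ Metric.closedBall (extChartAt (𝓡 3) x₀ x₀) r) {ρ : ℝ}
    (hρ : 0 < ρ) (hρr : ρ ≤ r) : ∃ c, IsLocalLeaf f g E v lam e C ρ x c := by
  set φ := extChartAt (𝓡 3) x₀
  have hrR : r ≤ R := by linarith [b.radius_le, b.pos]
  have hxR : φ x ∈ Metric.closedBall (φ x₀) R := Metric.closedBall_subset_closedBall hrR hxr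
  have hx : φ.symm (φ x) = x := φ.left_inv hxs
  obtain ⟨σ, hσ, hσv⟩ : ∃ σ : ℝ, (σ = 1 ∨ σ = -1) ∧
      chartFrame x₀ (φ x) (σ • X (φ x)) = v 0 (φ.symm (φ x)) := by
    rcases (h.unitSection 0).eq_or_eq_neg (b.mem_stable hxR) (b.unit _ hxR) with h1 | h1
    · exact ⟨1, Or.inl rfl, by rw [one_smul]; exact h1.symm⟩
    · exact ⟨-1, Or.inr rfl, by rw [neg_one_smul, map_neg]; exact h1.symm⟩
  set X' : 𝔼 → 𝔼 := fun p => σ • X p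
  set γ : ℝ → 𝔼 := fun t => ψ (φ x) (σ * t)
  have hsol : IsSolutionOn X' (Metric.closedBall (φ x₀) R) γ (-ρ) ρ :=
    ((b.isSolutionOn_flow _ hxr).smul_sign hσ).mono (by linarith) hρr
  have hX' : ∀ p ∈ Metric.closedBall (φ x₀) R,
      chartFrame x₀ p (X' p) ∈ E 0 (φ.symm p) ∧ g.len _ (chartFrame x₀ p (X' p)) = 1 := by
    intro p hp
    change chartFrame x₀ p (σ • X p) ∈ _ ∧ g.len _ (chartFrame x₀ p (σ • X p)) = 1
    rw [map_smul, g.len_smul, b.unit p hp, mul_one]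
    exact ⟨Submodule.smul_mem _ _ (b.mem_stable hp), by rcases hσ with rfl | rfl <;> simp⟩
  have hγ0 : γ 0 = φ x := by
    change ψ (φ x) (σ * 0) = φ x
    rw [mul_zero, b.flow_zero _ hxr]
  have h0 : (0 : ℝ) ∈ Ioo (-ρ) ρ := ⟨by linarith, hρ⟩
  have hd0 : HasDerivAt γ (X' (γ 0)) 0 :=
    (hsol 0 (Ioo_subset_Icc_self h0)).2.hasDerivAt (Icc_mem_nhds h0.1 h0.2)
  have hv0 : ∀ q : 𝔼, q = φ x → (⟨φ.symm q, chartFrame x₀ q (X' q)⟩ : TangentBundle (𝓡 3) M) =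
      ⟨x, v 0 x⟩ := by
    rintro q rfl
    have h1 : ∀ y, y = x → (⟨y, v 0 y⟩ : TangentBundle (𝓡 3) M) = ⟨x, v 0 x⟩ := by
      rintro y rfl; rfl
    exact (congrArg (Bundle.TotalSpace.mk _) hσv).trans (h1 _ hx)
  have hT := hv0 _ hγ0
  refine ⟨fun t => φ.symm (γ t), ⟨by rw [hγ0, hx], ?_, hsol.isTangentArc b.subset_target hX', ?_,
    ?_, fun s hs t ht => h.stableRel_of_isSolutionOn hC0 hC b.subset_target hX' hsol hs ht, ?_⟩⟩
  · have h1 : ContMDiffOn 𝓘(ℝ, 𝔼) (𝓡 3) 1 φ.symm φ.target := by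
      have : IsManifold (𝓡 3) 1 M := IsManifold.of_le (n := ∞) (by simp)
      exact contMDiffOn_extChartAt_symm x₀
    have h2 : ContMDiffOn 𝓘(ℝ, ℝ) 𝓘(ℝ, 𝔼) 1 γ (Ioo (-ρ) ρ) :=
      (hsol.contDiffOn (b.continuousOn_field.const_smul σ)).contMDiffOn
    exact h1.comp h2 fun t ht => b.subset_target (hsol t (Ioo_subset_Icc_self ht)).1
  · have h1 := (hasMFDerivAt_chart_symm (b.subset_target
      (hsol 0 (Ioo_subset_Icc_self h0)).1)).comp (0 : ℝ) hd0.hasFDerivAt.hasMFDerivAt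
    have h2 : mfderiv 𝓘(ℝ, ℝ) (𝓡 3) (fun t => φ.symm (γ t)) 0 (1 : ℝ) =
        chartFrame x₀ (γ 0) (X' (γ 0)) := by
      have h3 : (chartFrame x₀ (γ 0) ∘L ContinuousLinearMap.toSpanSingleton ℝ (X' (γ 0)))
          (1 : ℝ) = chartFrame x₀ (γ 0) (X' (γ 0)) := by
        rw [ContinuousLinearMap.comp_apply, ContinuousLinearMap.toSpanSingleton_apply, one_smul]
      rw [← h3]
      exact congrArg (fun L => L (1 : ℝ)) h1.mfderiv
    exact (congrArg (Bundle.TotalSpace.mk _) h2).trans hT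
  · have h1 := HasMFDerivAt.comp_chart_symm (u := e) (b.subset_target
      (hsol 0 (Ioo_subset_Icc_self h0)).1)
      (h.contMDiff.mdifferentiableAt one_ne_zero).hasMFDerivAt
    have h2 : HasDerivAt (fun t => e (φ.symm (γ t)))
        (differential e (φ.symm (γ 0)) (chartFrame x₀ (γ 0) (X' (γ 0)))) 0 :=
      h1.comp_hasDerivAt 0 hd0
    rwa [congrArg (fun q : TangentBundle (𝓡 3) M => differential e q.1 q.2) hT] at h2
  · intro s hs t ht hst
    have h1 : γ s = γ t := φ.symm.injOn (b.subset_target (hsol s hs).1)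
      (b.subset_target (hsol t ht).1) hst
    have h2 := b.injOn_flow hxr (show σ * s ∈ Icc (-r) r by
      rcases hσ with rfl | rfl <;> constructor <;> linarith [hs.1, hs.2])
      (show σ * t ∈ Icc (-r) r by
      rcases hσ with rfl | rfl <;> constructor <;> linarith [ht.1, ht.2]) h1
    rcases hσ with rfl | rfl <;> linarith

/-- Local leaves in a flow box follow the flow. -/
lemma IsLocalLeaf.eq_flow {x₀ : M} {R η₀ r : ℝ} {X : 𝔼 → 𝔼} {θ : 𝔼 → 𝔼 →L[ℝ] ℝ} {w : 𝔼}
    {ψ : 𝔼 → ℝ → 𝔼} (b : IsStableFlowBox g E v e x₀ R X θ w η₀ r ψ)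
    (h : IsAdaptedFrame f g E v lam e) {C ρ : ℝ} {x : M} {c : ℝ → M}
    (hc : IsLocalLeaf f g E v lam e C ρ x c) (hρ : 0 < ρ) (hρr : ρ ≤ r)
    (hin : ∀ t ∈ Icc (-ρ) ρ, c t ∈ (extChartAt (𝓡 3) x₀).source ∧
      extChartAt (𝓡 3) x₀ (c t) ∈ Metric.ball (extChartAt (𝓡 3) x₀ x₀) r) :
    ∃ σ : ℝ, (σ = 1 ∨ σ = -1) ∧ differential e x (v 0 x) =
      σ • differential e ((extChartAt (𝓡 3) x₀).symm (extChartAt (𝓡 3) x₀ x))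
        (chartFrame x₀ (extChartAt (𝓡 3) x₀ x) (X (extChartAt (𝓡 3) x₀ x))) ∧
      ∀ t ∈ Icc (-ρ) ρ, extChartAt (𝓡 3) x₀ (c t) = ψ (extChartAt (𝓡 3) x₀ x) (σ * t) := by
  set φ := extChartAt (𝓡 3) x₀
  have hrR : r ≤ R := by linarith [b.radius_le, b.pos]
  have h0 : (0 : ℝ) ∈ Ioo (-ρ) ρ := ⟨by linarith, hρ⟩
  have h0' := Ioo_subset_Icc_self h0
  have hxr : φ x ∈ Metric.closedBall (φ x₀) r := by
    have h1 := (hin 0 h0').2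
    rw [hc.zero] at h1
    exact Metric.ball_subset_closedBall h1
  have hxR : φ x ∈ Metric.closedBall (φ x₀) R := Metric.closedBall_subset_closedBall hrR hxr
  have hder : ∀ X' : 𝔼 → 𝔼, IsSolutionOn X' (Metric.closedBall (φ x₀) R) (fun t => φ (c t))
      (-ρ) ρ → differential e x (v 0 x) = differential e (φ.symm (φ x))
        (chartFrame x₀ (φ x) (X' (φ x))) := by
    intro X' hs
    have hd0 : HasDerivAt (fun t => φ (c t)) (X' (φ (c 0))) 0 :=
      (hs 0 h0').2.hasDerivAt (Icc_mem_nhds h0.1 h0.2)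
    have h1 := HasMFDerivAt.comp_chart_symm (u := e) (b.subset_target (hs 0 h0').1)
      (h.contMDiff.mdifferentiableAt one_ne_zero).hasMFDerivAt
    have h2 : HasDerivAt (fun t => e (φ.symm (φ (c t)))) (differential e (φ.symm (φ (c 0)))
        (chartFrame x₀ (φ (c 0)) (X' (φ (c 0))))) 0 :=
      HasFDerivAt.comp_hasDerivAt (f := fun t => φ (c t)) 0 h1 hd0
    have h3 : (fun t => e (c t)) =ᶠ[𝓝 0] fun t => e (φ.symm (φ (c t))) := by
      filter_upwards [Icc_mem_nhds h0.1 h0.2] with t ht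
      rw [φ.left_inv (hin t ht).1]
    have h4 := hc.hasDerivAt.unique (h2.congr_of_eventuallyEq h3)
    rw [hc.zero] at h4
    exact h4
  rcases hc.isTangentArc.isSolutionOn (X := X) (B := Metric.closedBall (φ x₀) R)
    (fun t ht => (hin t ht).1) (fun t ht => Metric.closedBall_subset_closedBall hrR
      (Metric.ball_subset_closedBall (hin t ht).2)) (fun p hp => ⟨b.unit p hp, b.span p hp⟩)
      (ℓ := θ (φ x₀)) (fun p hp => by linarith [b.half_le _ b.center_mem p hp]) with hs | hs
  · refine ⟨1, Or.inl rfl, by rw [one_smul]; exact hder _ hs, fun t ht => ?_⟩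
    rw [one_mul]
    exact b.eqOn_flow hxr hs (by rw [hc.zero]) (by linarith) (by linarith) hρ.le hρr ht
  · refine ⟨-1, Or.inr rfl, ?_, fun t ht => ?_⟩
    · rw [hder _ hs, map_neg, map_neg, neg_one_smul]
    · rw [neg_one_mul]
      exact b.eqOn_flow_neg hxr hs (by rw [hc.zero]) (by linarith) (by linarith) hρ.le hρr ht

/-- Local stable leaves of a uniform size, given locally by flows. -/
theorem IsAdaptedFrame.exists_localLeaves [CompactSpace M] (h : IsAdaptedFrame f g E v lam e)
    {κ : ℝ} (hκ : ∀ x, lam 0 x ≤ κ) (hκ1 : κ ≤ 1) {C : ℝ} (hC0 : 0 < C)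
    (hC : ∀ x, ‖differential e x (v 0 x)‖ ≤ C) :
    ∃ ρ > 0, ∃ Γ : M → ℝ → M, (∀ x, IsLocalLeaf f g E v lam e C ρ x (Γ x)) ∧
      ∀ x₁, ∃ x₀ R X θ w η₀ r ψ, IsStableFlowBox g E v e x₀ R X θ w η₀ r ψ ∧ ρ ≤ r ∧
        ∀ᶠ y in 𝓝 x₁, (∀ t ∈ Icc (-ρ) ρ, Γ y t ∈ (extChartAt (𝓡 3) x₀).source ∧
          extChartAt (𝓡 3) x₀ (Γ y t) ∈ Metric.ball (extChartAt (𝓡 3) x₀ x₀) r) ∧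
          ∃ σ : ℝ, (σ = 1 ∨ σ = -1) ∧ differential e y (v 0 y) =
            σ • differential e ((extChartAt (𝓡 3) x₀).symm (extChartAt (𝓡 3) x₀ y))
              (chartFrame x₀ (extChartAt (𝓡 3) x₀ y) (X (extChartAt (𝓡 3) x₀ y))) ∧
            ∀ t ∈ Icc (-ρ) ρ,
              extChartAt (𝓡 3) x₀ (Γ y t) = ψ (extChartAt (𝓡 3) x₀ y) (σ * t) := by
  obtain ⟨ρ₁, hρ₁, hbox⟩ := h.exists_uniform_isStableFlowBox hκ hκ1
  -- Leaves of this size move by at most `ρ₁ / 4` in the ambient space, so all leaves through points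
  -- within `ρ₁ / 2` of `x₁` stay in the flow box of `x₁`.
  set ρ := min ρ₁ (ρ₁ / (4 * C))
  have hρ : 0 < ρ := lt_min hρ₁ (by positivity)
  have hCρ : C * ρ ≤ ρ₁ / 4 := by
    calc C * ρ ≤ C * (ρ₁ / (4 * C)) := by gcongr; exact min_le_right _ _
      _ = ρ₁ / 4 := by field_simp
  have hleaf : ∀ x, ∃ c, IsLocalLeaf f g E v lam e C ρ x c := by
    intro x
    obtain ⟨x₀, R, X, θ, w, η₀, r, ψ, b, hr, hz⟩ := hbox x
    have h1 := hz x (by rw [sub_self, norm_zero]; exact hρ₁)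
    exact b.isLocalLeaf h hC0.le hC h1.1 (Metric.ball_subset_closedBall h1.2) hρ
      ((min_le_left _ _).trans hr)
  choose Γ hΓ using hleaf
  refine ⟨ρ, hρ, Γ, hΓ, fun x₁ => ?_⟩
  obtain ⟨x₀, R, X, θ, w, η₀, r, ψ, b, hr, hz⟩ := hbox x₁
  refine ⟨x₀, R, X, θ, w, η₀, r, ψ, b, (min_le_left _ _).trans hr, ?_⟩
  have hy : ∀ᶠ y in 𝓝 x₁, dist (e y) (e x₁) < ρ₁ / 2 :=
    h.contMDiff.continuous.continuousAt.eventually (Metric.ball_mem_nhds _ (half_pos hρ₁))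
  filter_upwards [hy] with y hy
  have h0 : (0 : ℝ) ∈ Icc (-ρ) ρ := ⟨by linarith, hρ.le⟩
  have hin : ∀ t ∈ Icc (-ρ) ρ, Γ y t ∈ (extChartAt (𝓡 3) x₀).source ∧
      extChartAt (𝓡 3) x₀ (Γ y t) ∈ Metric.ball (extChartAt (𝓡 3) x₀ x₀) r := by
    intro t ht
    refine hz _ ?_
    have h1 := ((hΓ y).stableRel 0 h0 t ht).norm_iterate_le (h.lam_pos 0) hκ 0
    rw [pow_zero, mul_one, sub_zero, (hΓ y).zero] at h1
    have h2 : ‖e y - e (Γ y t)‖ ≤ C * |t| := h1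
    have h3 : C * |t| ≤ C * ρ := by gcongr; exact abs_le.2 ht
    rw [← dist_eq_norm] at h2 ⊢
    rw [dist_comm] at hy
    linarith [dist_triangle (e x₁) (e y) (e (Γ y t))]
  exact ⟨hin, (hΓ y).eq_flow b h hρ ((min_le_left _ _).trans hr) hin⟩

end LocalStableLeaves

/-! ### Flow lines through a surface and the leaf map -/

section TubularNeighbourhood

variable {M : Type*} [TopologicalSpace M] [ChartedSpace (EuclideanSpace ℝ (Fin 3)) M]
  [IsManifold (𝓡 3) ∞ M]

local notation "𝔼" => EuclideanSpace ℝ (Fin 3)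

lemma IsTransverseBox.subball {G : Type*} [NormedAddCommGroup G] [NormedSpace ℝ G]
    {p₀ p₁ w : G} {R R' : ℝ} {X : G → G} {θ : G → G →L[ℝ] ℝ} (h : IsTransverseBox p₀ R X θ w)
    (hR' : 0 < R') (hsub : Metric.closedBall p₁ R' ⊆ Metric.closedBall p₀ R) :
    IsTransverseBox p₁ R' X θ w :=
  ⟨hR', h.continuousOn_field.mono hsub, h.continuousOn_form.mono hsub,
    fun p hp => h.form_apply p (hsub hp), fun p hp q hq => h.half_le p (hsub hp) q (hsub hq)⟩

variable {F : Type*} [NormedAddCommGroup F] [InnerProductSpace ℝ F] [FiniteDimensional ℝ F]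
  {f : M ≃ₘ^1⟮𝓡 3, 𝓡 3⟯ M} {g : RiemMetric M} {E : Fin 3 → PlaneField M}
  {v : Fin 3 → ∀ x : M, TangentSpace (𝓡 3) x} {lam : Fin 3 → M → ℝ} {e : M → F}

/-- The flow lines that start on a surface tangent to the center-unstable field fill a
neighbourhood of each of their points. -/
lemma IsStableFlowBox.eventually_exists_flow_eq {x₀ : M} {R η₀ r : ℝ} {X : 𝔼 → 𝔼}
    {θ : 𝔼 → 𝔼 →L[ℝ] ℝ} {w : 𝔼} {ψ : 𝔼 → ℝ → 𝔼}
    (b : IsStableFlowBox g E v e x₀ R X θ w η₀ r ψ) {S : Set M} (hSc : IsClosed S)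
    (hS : IsSurfaceTangentTo (fun x => E 1 x ⊔ E 2 x) S) {p₁ : 𝔼} {s₁ : ℝ}
    (hp₁S : p₁ ∈ chartPiece x₀ R S)
    (hp₁ : p₁ ∈ Metric.ball (extChartAt (𝓡 3) x₀ x₀) r) (hs₁ : |s₁| < r)
    (hz₁ : ψ p₁ s₁ ∈ Metric.ball (extChartAt (𝓡 3) x₀ x₀) r) {O : Set (𝔼 × ℝ)}
    (hO : O ∈ 𝓝 (p₁, s₁)) :
    ∀ᶠ z in 𝓝 (ψ p₁ s₁), ∃ q ∈ O, q.1 ∈ chartPiece x₀ R S ∧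
      q.1 ∈ Metric.ball (extChartAt (𝓡 3) x₀ x₀) r ∧ ψ q.1 q.2 = z := by
  set p₀ := extChartAt (𝓡 3) x₀ x₀
  have hr := b.radius_pos
  have hrR := b.radius_le
  have hR := b.pos
  have hp₁' := Metric.ball_subset_closedBall hp₁
  have hz₁' := Metric.ball_subset_closedBall hz₁
  have hsI : |(-s₁)| ≤ r := by rw [abs_neg]; exact hs₁.le
  have hnhds : ∀ p ∈ Metric.ball p₀ r, ∀ s, |s| < r →
      ContinuousAt (fun q : 𝔼 × ℝ => ψ q.1 q.2) (p, s) := by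
    intro p hp s hs
    refine b.continuousOn_flow.continuousAt (prod_mem_nhds ?_ ?_)
    · exact mem_of_superset (Metric.isOpen_ball.mem_nhds hp) Metric.ball_subset_closedBall
    · exact Icc_mem_nhds (abs_lt.1 hs).1 (abs_lt.1 hs).2
  have hback : ψ (ψ p₁ s₁) (-s₁) = p₁ := by
    rw [b.flow_add hp₁' hz₁' hs₁.le hsI (by rw [add_neg_cancel, abs_zero]; exact hr.le),
      add_neg_cancel, b.flow_zero _ hp₁']
  have hκ : Tendsto (fun z => ψ z (-s₁)) (𝓝 (ψ p₁ s₁)) (𝓝 p₁) := by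
    have h1 : ContinuousAt (fun z => ψ z (-s₁)) (ψ p₁ s₁) :=
      ContinuousAt.comp (f := fun z => (z, -s₁)) (g := fun q : 𝔼 × ℝ => ψ q.1 q.2)
        (hnhds _ hz₁ _ (by rw [abs_neg]; exact hs₁)) (by fun_prop)
    rw [ContinuousAt, hback] at h1
    exact h1
  have hlim : Tendsto (fun q : 𝔼 × ℝ => (ψ q.1 q.2, s₁ - q.2)) (𝓝 (p₁, 0)) (𝓝 (p₁, s₁)) := by
    have h1 := hnhds p₁ hp₁ 0 (by rw [abs_zero]; exact hr)
    rw [ContinuousAt, b.flow_zero _ hp₁'] at h1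
    have h2 : Tendsto (fun q : 𝔼 × ℝ => s₁ - q.2) (𝓝 (p₁, 0)) (𝓝 s₁) := by
      have : ContinuousAt (fun q : 𝔼 × ℝ => s₁ - q.2) (p₁, 0) := by fun_prop
      simpa [ContinuousAt] using this
    exact h1.prodMk_nhds h2
  have hball : Metric.ball p₀ r ×ˢ (univ : Set ℝ) ∈ 𝓝 (p₁, s₁) :=
    prod_mem_nhds (Metric.isOpen_ball.mem_nhds hp₁) univ_mem
  obtain ⟨d, hd, hdO⟩ := Metric.mem_nhds_iff.1 (hlim (inter_mem hO hball))
  -- The hitting lemma works near the center of a box, so the box is recentered at `p₁`.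
  set R' := R / 2 - dist p₁ p₀
  have hR' : 0 < R' := by
    have : dist p₁ p₀ < r := hp₁
    simp only [R']; linarith
  have hsub : Metric.closedBall p₁ R' ⊆ Metric.closedBall p₀ (R / 2) :=
    Metric.closedBall_subset_closedBall' (by simp [R'])
  have hsubR : Metric.closedBall p₁ R' ⊆ Metric.closedBall p₀ R :=
    hsub.trans (Metric.closedBall_subset_closedBall (by linarith))
  obtain ⟨rh, hrh, hhit⟩ := (b.toIsTransverseBox.subball hR' hsubR).exists_hit
  have hst := b.hasTangentSteps_chartPiece hSc hS
  have hcl := b.isClosed_chartPiece hSc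
  have hst' : HasTangentSteps θ w (chartPiece x₀ R S) (Metric.closedBall p₁ (R' / 2)) := by
    intro η hη
    obtain ⟨ρ, hρ, h⟩ := hst η hη
    exact ⟨ρ, hρ, fun p hp => h p ⟨hp.1, hsub
      (Metric.closedBall_subset_closedBall (by linarith) hp.2)⟩⟩
  obtain ⟨ρs, hρs, hstep⟩ := hst' 1 one_pos
  set K := 2 * (‖θ p₁‖ + 1) with hK
  have hK0 : 0 < K := by positivity
  set m := min (min d (r - |s₁|)) (min (2 * rh) r)
  have hm : 0 < m := lt_min (lt_min hd (by linarith)) (lt_min (by linarith) hr)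
  have hev : ∀ᶠ z in 𝓝 (ψ p₁ s₁), dist (ψ z (-s₁)) p₁ < min (min ρs rh) (min d (m / K)) :=
    hκ.eventually (Metric.ball_mem_nhds _
      (lt_min (lt_min hρs hrh) (lt_min hd (by positivity))))
  filter_upwards [hev, hκ.eventually (Metric.isOpen_ball.mem_nhds hp₁),
    Metric.isOpen_ball.mem_nhds hz₁] with z hz hz'r hzr
  -- Flowing back for time `s₁` brings `z` to a point `z'` near `p₁`. A short time `a` then leads
  -- from `z'` to the surface, and time `s₁ - a` leads from there to `z`.
  set z' := ψ z (-s₁)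
  have hzr' := Metric.ball_subset_closedBall hzr
  have hz'r' : z' ∈ Metric.closedBall p₀ r := Metric.ball_subset_closedBall hz'r
  rw [lt_min_iff, lt_min_iff, lt_min_iff] at hz
  obtain ⟨⟨hzρs, hzrh⟩, hzd, hzm⟩ := hz
  have hfwd : ψ z' s₁ = z := by
    have := b.flow_add hzr' hz'r' hsI hs₁.le (by rw [neg_add_cancel, abs_zero]; exact hr.le)
    rw [this, neg_add_cancel, b.flow_zero _ hzr']
  obtain ⟨ρ, hρ, hρS⟩ := hstep p₁ ⟨hp₁S, Metric.mem_closedBall_self (by linarith)⟩ (z' - p₁)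
    (by rw [← dist_eq_norm]; exact hzρs.le)
  rw [add_sub_cancel] at hρS
  have hρm : 2 * |ρ| < m := by
    have h1 := (θ p₁).le_opNorm (z' - p₁)
    rw [Real.norm_eq_abs] at h1
    have h2 : |ρ| ≤ (‖θ p₁‖ + 1) * ‖z' - p₁‖ := by
      have h3 := abs_le.1 h1
      have h4 := abs_le.1 hρ
      exact abs_le.2 ⟨by linarith, by linarith⟩
    rw [dist_eq_norm] at hzm
    calc 2 * |ρ| ≤ K * ‖z' - p₁‖ := by rw [hK]; linarith
      _ < K * (m / K) := by gcongr
      _ = m := by field_simp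
  have hm1 : m ≤ d := (min_le_left _ _).trans (min_le_left _ _)
  have hm2 : m ≤ r - |s₁| := (min_le_left _ _).trans (min_le_right _ _)
  have hm3 : m ≤ 2 * rh := (min_le_right _ _).trans (min_le_left _ _)
  have hm4 : m ≤ r := (min_le_right _ _).trans (min_le_right _ _)
  obtain ⟨τ, hτ, -, γ, hγ0, hγτ, hsol⟩ := hhit _ hcl hst' z' ρ hzrh.le (by linarith) hρS
  obtain ⟨a, ha, hγa⟩ : ∃ a, |a| ≤ τ ∧ γ τ = ψ z' a := by
    have hττ : τ ∈ Icc 0 τ := right_mem_Icc.2 hτ.1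
    rcases hsol with hsol | hsol
    · exact ⟨τ, (abs_of_nonneg hτ.1).le, b.eqOn_flow hz'r' (hsol.mono_set hsubR) hγ0
        (by linarith) le_rfl hτ.1 (by linarith [hτ.2]) hττ⟩
    · exact ⟨-τ, by rw [abs_neg]; exact (abs_of_nonneg hτ.1).le,
        b.eqOn_flow_neg hz'r' (hsol.mono_set hsubR) hγ0
        (by linarith) le_rfl hτ.1 (by linarith [hτ.2]) hττ⟩
  have ham : |a| < m := ha.trans_lt (hτ.2.trans_lt hρm)
  have hO' := hdO (show (z', a) ∈ Metric.ball (p₁, (0 : ℝ)) d by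
    rw [Metric.mem_ball, Prod.dist_eq, max_lt_iff]
    refine ⟨hzd, ?_⟩
    rw [Real.dist_eq, sub_zero]
    exact ham.trans_le hm1)
  have hpr : ψ z' a ∈ Metric.ball p₀ r := hO'.2.1
  refine ⟨(ψ z' a, s₁ - a), hO'.1, hγa ▸ hγτ, hpr, ?_⟩
  have h1 : |s₁ - a| ≤ r := (abs_sub _ _).trans (by linarith)
  change ψ (ψ z' a) (s₁ - a) = z
  rw [b.flow_add hz'r' (Metric.ball_subset_closedBall hpr) (by linarith) h1
    (by rw [add_sub_cancel]; exact hs₁.le), add_sub_cancel, hfwd]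

/-- The coordinate of `b` on the line spanned by `a`. -/
noncomputable def lineRatio (a b : F) : ℝ := inner ℝ a b / inner ℝ a a

omit [FiniteDimensional ℝ F] in
lemma lineRatio_smul {a : F} (ha : a ≠ 0) (t : ℝ) : lineRatio a (t • a) = t := by
  have : inner ℝ a a ≠ (0 : ℝ) := inner_self_ne_zero.2 ha
  rw [lineRatio, inner_smul_right]
  field_simp

omit [FiniteDimensional ℝ F] in
lemma lineRatio_sign_smul {a b : F} {σ : ℝ} (hσ : σ = 1 ∨ σ = -1) :
    lineRatio (σ • a) b = σ * lineRatio a b := by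
  rcases hσ with rfl | rfl
  · simp
  · simp [lineRatio, neg_div]

/-- The map that moves the base point of a stable vector along the local stable leaf. -/
noncomputable def leafMap (e : M → F) (v : Fin 3 → ∀ x : M, TangentSpace (𝓡 3) x)
    (Γ : M → ℝ → M) (q : TangentBundle (𝓡 3) M) : M :=
  Γ q.1 (lineRatio (differential e q.1 (v 0 q.1)) (differential e q.1 q.2))

namespace IsAdaptedFrame

omit [FiniteDimensional ℝ F] in
lemma differential_ne_zero (h : IsAdaptedFrame f g E v lam e) (x : M) :
    differential e x (v 0 x) ≠ 0 := fun h0 =>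
  (h.linearIndependent x).ne_zero 0
    ((injective_iff_map_eq_zero _).1 (h.injective_differential x) _ h0)

-- The scalar is recovered from inner products in the ambient space, which makes it a continuous
-- expression once `v` is replaced by a chart field.
omit [FiniteDimensional ℝ F] in
lemma leafMap_smul (h : IsAdaptedFrame f g E v lam e) (Γ : M → ℝ → M) (x : M) (t : ℝ) :
    leafMap e v Γ ⟨x, t • v 0 x⟩ = Γ x t := by
  unfold leafMap
  rw [map_smul, lineRatio_smul (h.differential_ne_zero x)]

omit [FiniteDimensional ℝ F] in
lemma eq_smul_of_mem (h : IsAdaptedFrame f g E v lam e) {x : M} {u : TangentSpace (𝓡 3) x}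
    (hu : u ∈ E 0 x) : ∃ t : ℝ, u = t • v 0 x ∧ g.len x u = |t| := by
  rw [(h.unitSection 0 x).2.2] at hu
  obtain ⟨t, rfl⟩ := Submodule.mem_span_singleton.1 hu
  exact ⟨t, rfl, by rw [g.len_smul, (h.unitSection 0 x).2.1, mul_one]⟩

end IsAdaptedFrame

/-- The coordinate of a tangent vector on the stable line, as oriented by a field in a chart. -/
noncomputable def chartRatio (e : M → F) (x₀ : M) (X : 𝔼 → 𝔼) (q : TangentBundle (𝓡 3) M) : ℝ :=
  lineRatio (differential e ((extChartAt (𝓡 3) x₀).symm (extChartAt (𝓡 3) x₀ q.1))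
    (chartFrame x₀ (extChartAt (𝓡 3) x₀ q.1) (X (extChartAt (𝓡 3) x₀ q.1))))
    (differential e q.1 q.2)

omit [FiniteDimensional ℝ F] in
/-- In a flow box, the leaf map is given by the flow. -/
lemma IsAdaptedFrame.leafMap_eq_flow (h : IsAdaptedFrame f g E v lam e) {x₀ : M} {X : 𝔼 → 𝔼}
    {ψ : 𝔼 → ℝ → 𝔼} {ρ : ℝ} {Γ : M → ℝ → M} {q : TangentBundle (𝓡 3) M} (hq : q.2 ∈ E 0 q.1)
    (hlen : g.len q.1 q.2 ≤ ρ) {σ : ℝ} (hσ : σ = 1 ∨ σ = -1)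
    (hσv : differential e q.1 (v 0 q.1) =
      σ • differential e ((extChartAt (𝓡 3) x₀).symm (extChartAt (𝓡 3) x₀ q.1))
        (chartFrame x₀ (extChartAt (𝓡 3) x₀ q.1) (X (extChartAt (𝓡 3) x₀ q.1))))
    (hΓ : ∀ t ∈ Icc (-ρ) ρ,
      extChartAt (𝓡 3) x₀ (Γ q.1 t) = ψ (extChartAt (𝓡 3) x₀ q.1) (σ * t)) :
    |chartRatio e x₀ X q| = g.len q.1 q.2 ∧ differential e q.1 q.2 = chartRatio e x₀ X q •
      differential e ((extChartAt (𝓡 3) x₀).symm (extChartAt (𝓡 3) x₀ q.1))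
        (chartFrame x₀ (extChartAt (𝓡 3) x₀ q.1) (X (extChartAt (𝓡 3) x₀ q.1))) ∧ ∃ t ∈ Icc (-ρ) ρ, leafMap e v Γ q = Γ q.1 t ∧
      extChartAt (𝓡 3) x₀ (leafMap e v Γ q) =
        ψ (extChartAt (𝓡 3) x₀ q.1) (chartRatio e x₀ X q) := by
  obtain ⟨x, u⟩ := q
  obtain ⟨t, ht, hlt⟩ := h.eq_smul_of_mem hq
  change u = t • v 0 x at ht
  subst ht
  have hσσ : σ * σ = 1 := by rcases hσ with rfl | rfl <;> norm_num
  -- The sign of `v 0` relative to the chart field enters both the coordinate and the flow time. It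
  -- cancels, so the flow description no longer involves `v`.
  have h1 : chartRatio e x₀ X ⟨x, t • v 0 x⟩ = σ * t := by
    have h2 : differential e ((extChartAt (𝓡 3) x₀).symm (extChartAt (𝓡 3) x₀ x))
        (chartFrame x₀ (extChartAt (𝓡 3) x₀ x) (X (extChartAt (𝓡 3) x₀ x))) =
        σ • differential e x (v 0 x) := by
      rw [hσv, smul_smul, hσσ, one_smul]
    unfold chartRatio
    rw [h2, lineRatio_sign_smul hσ, map_smul, lineRatio_smul (h.differential_ne_zero x)]
  change g.len x (t • v 0 x) = |t| at hlt
  have htρ : t ∈ Icc (-ρ) ρ := abs_le.1 (hlt ▸ hlen)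
  refine ⟨?_, ?_, t, htρ, h.leafMap_smul Γ x t, ?_⟩
  · rw [h1, abs_mul, hlt]
    rcases hσ with rfl | rfl <;> simp
  · change differential e x (t • v 0 x) = _
    rw [h1, map_smul, hσv, smul_smul, mul_comm]
  · rw [h1, h.leafMap_smul Γ x t]
    exact hΓ t htρ

end TubularNeighbourhood

/-! ### Stable tubular neighbourhoods -/

section TubularNeighbourhoodTheorem

variable {M : Type*} [TopologicalSpace M] [ChartedSpace (EuclideanSpace ℝ (Fin 3)) M]
  [IsManifold (𝓡 3) ∞ M]

local notation "𝔼" => EuclideanSpace ℝ (Fin 3)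

variable {F : Type*} [NormedAddCommGroup F] [InnerProductSpace ℝ F] [FiniteDimensional ℝ F]
  {f : M ≃ₘ^1⟮𝓡 3, 𝓡 3⟯ M} {g : RiemMetric M} {E : Fin 3 → PlaneField M}
  {v : Fin 3 → ∀ x : M, TangentSpace (𝓡 3) x} {lam : Fin 3 → M → ℝ} {e : M → F}

omit [FiniteDimensional ℝ F] in
/-- A local leaf, traversed in either direction, is a unit speed curve tangent to the stable
field. -/
lemma IsLocalLeaf.isUnitSpeedTangentCurve {C ρ : ℝ} {x : M} {c : ℝ → M}
    (hc : IsLocalLeaf f g E v lam e C ρ x c) {σ : ℝ} (hσ : σ = 1 ∨ σ = -1) {δ : ℝ} (hδ0 : 0 < δ)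
    (hδ : δ ≤ ρ) :
    IsUnitSpeedTangentCurve g (E 0) δ (fun s => c (σ * s)) ∧
      tangentMap 𝓘(ℝ, ℝ) (𝓡 3) (fun s => c (σ * s)) ⟨0, (1 : ℝ)⟩ = ⟨x, σ • v 0 x⟩ := by
  have hmem : ∀ s ∈ Ioo (-δ) δ, σ * s ∈ Ioo (-ρ) ρ := by
    rintro s ⟨h1, h2⟩
    rcases hσ with rfl | rfl <;> constructor <;> linarith
  have hder : ∀ s ∈ Ioo (-δ) δ,
      mfderiv 𝓘(ℝ, ℝ) (𝓡 3) c (σ * s) (1 : ℝ) ∈ E 0 (c (σ * s)) ∧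
      g.len (c (σ * s)) (mfderiv 𝓘(ℝ, ℝ) (𝓡 3) c (σ * s) (1 : ℝ)) = 1 ∧
      mfderiv 𝓘(ℝ, ℝ) (𝓡 3) (fun s => c (σ * s)) s (1 : ℝ) =
        σ • mfderiv 𝓘(ℝ, ℝ) (𝓡 3) c (σ * s) (1 : ℝ) := by
    intro s hs
    have hs' := hmem s hs
    obtain ⟨L, hL, hLE, hL1⟩ := hc.isTangentArc (σ * s) (Ioo_subset_Icc_self hs')
    have hL' := hL.hasMFDerivAt (Icc_mem_nhds hs'.1 hs'.2)
    rw [hL'.mfderiv]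
    refine ⟨hLE, hL1, ?_⟩
    have h1 : HasMFDerivAt 𝓘(ℝ, ℝ) 𝓘(ℝ, ℝ) (fun s : ℝ => σ * s) s
        (ContinuousLinearMap.toSpanSingleton ℝ (σ * 1)) :=
      ((hasDerivAt_id s).const_mul σ).hasFDerivAt.hasMFDerivAt
    have h2 := (HasMFDerivAt.comp (g := c) s hL' h1).mfderiv
    have h3 : ∀ L : ℝ →L[ℝ] 𝔼, (L ∘L ContinuousLinearMap.toSpanSingleton ℝ (σ * 1)) (1 : ℝ) =
        σ • L 1 := by
      intro L
      rw [ContinuousLinearMap.comp_apply, ContinuousLinearMap.toSpanSingleton_apply, one_smul,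
        mul_one, ← L.map_smul, smul_eq_mul, mul_one]
    exact (congrArg (fun L => L (1 : ℝ)) h2).trans (h3 L)
  refine ⟨⟨?_, fun s hs => ?_⟩, ?_⟩
  · have h1 : ContMDiff 𝓘(ℝ, ℝ) 𝓘(ℝ, ℝ) 1 fun s : ℝ => σ * s :=
      (contDiff_const.mul contDiff_id).contMDiff
    exact hc.contMDiffOn.comp h1.contMDiffOn hmem
  · obtain ⟨h1, h2, h3⟩ := hder s hs
    rw [h3, g.len_smul, h2, mul_one]
    exact ⟨Submodule.smul_mem _ _ h1, by rcases hσ with rfl | rfl <;> simp⟩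
  · have h1 := (hder 0 ⟨by linarith, hδ0⟩).2.2
    have h2 : ∀ a : ℝ, a = 0 → tangentMap 𝓘(ℝ, ℝ) (𝓡 3) c ⟨a, (1 : ℝ)⟩ = ⟨x, v 0 x⟩ := by
      rintro _ rfl; exact hc.tangentMap_zero
    have h3 := congrArg (fun q : TangentBundle (𝓡 3) M =>
      (⟨q.1, σ • q.2⟩ : TangentBundle (𝓡 3) M)) (h2 (σ * 0) (mul_zero σ))
    exact (congrArg (Bundle.TotalSpace.mk _) h1).trans h3

omit [FiniteDimensional ℝ F] in
lemma IsAdaptedFrame.tangentBundle_ext (h : IsAdaptedFrame f g E v lam e)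
    {q q' : TangentBundle (𝓡 3) M} (h1 : q.1 = q'.1)
    (h2 : differential e q.1 q.2 = differential e q'.1 q'.2) : q = q' := by
  obtain ⟨x, u⟩ := q
  obtain ⟨x', u'⟩ := q'
  change x = x' at h1
  subst h1
  exact congrArg (Bundle.TotalSpace.mk x) (h.injective_differential x h2)

/-- Small stable tubular neighbourhoods of a surface tangent to the center-unstable field. -/
theorem IsAdaptedFrame.exists_isStableTubularNhd (h : IsAdaptedFrame f g E v lam e) {C ρ : ℝ}
    (hC0 : 0 < C) {Γ : M → ℝ → M} (hΓ : ∀ x, IsLocalLeaf f g E v lam e C ρ x (Γ x))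
    (hbox : ∀ x₁, ∃ x₀ R X θ w η₀ r ψ, IsStableFlowBox g E v e x₀ R X θ w η₀ r ψ ∧ ρ ≤ r ∧
        ∀ᶠ y in 𝓝 x₁, (∀ t ∈ Icc (-ρ) ρ, Γ y t ∈ (extChartAt (𝓡 3) x₀).source ∧
          extChartAt (𝓡 3) x₀ (Γ y t) ∈ Metric.ball (extChartAt (𝓡 3) x₀ x₀) r) ∧
          ∃ σ : ℝ, (σ = 1 ∨ σ = -1) ∧ differential e y (v 0 y) =
            σ • differential e ((extChartAt (𝓡 3) x₀).symm (extChartAt (𝓡 3) x₀ y))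
              (chartFrame x₀ (extChartAt (𝓡 3) x₀ y) (X (extChartAt (𝓡 3) x₀ y))) ∧
            ∀ t ∈ Icc (-ρ) ρ,
              extChartAt (𝓡 3) x₀ (Γ y t) = ψ (extChartAt (𝓡 3) x₀ y) (σ * t))
    {T : Set M} (hTc : IsClosed T) (hT : IsSurfaceTangentTo (fun x => E 1 x ⊔ E 2 x) T) {ε : ℝ}
    (hsep : ∀ x ∈ T, ∀ y ∈ T, StableRel e f (lam 0) ε x y → x = y) {δ : ℝ} (hδ0 : 0 < δ)
    (hδρ : δ < ρ) (hδε : C * δ + C * δ ≤ ε) :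
    ∃ U π, IsStableTubularNhd g (E 0) T δ U ∧ IsOpen U ∧ T ⊆ U ∧ (∀ y ∈ U, π y ∈ T) ∧
      (∀ y ∈ U, StableRel e f (lam 0) (C * δ) (π y) y) ∧ ContinuousOn π U := by
  set D := discBundle g (E 0) T δ
  set Φ := leafMap e v Γ
  have hρ : 0 < ρ := hδ0.trans hδρ
  have h0ρ : (0 : ℝ) ∈ Icc (-ρ) ρ := ⟨by linarith, hρ.le⟩
  have hrel : ∀ q ∈ D, StableRel e f (lam 0) (C * δ) q.1 (Φ q) := by
    rintro ⟨x, u⟩ ⟨hx, hu, hlen⟩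
    obtain ⟨t, ht, hlt⟩ := h.eq_smul_of_mem hu
    change u = t • v 0 x at ht
    subst ht
    change g.len x (t • v 0 x) < δ at hlen
    change g.len x (t • v 0 x) = |t| at hlt
    rw [hlt] at hlen
    have h1 := (hΓ x).stableRel 0 h0ρ t (abs_le.1 (hlen.le.trans hδρ.le))
    rw [(hΓ x).zero, sub_zero, ← h.leafMap_smul Γ x t] at h1
    exact h1.mono (h.lam_pos 0) (by gcongr)
  -- If two fibres meet, their base points are stably related with constant `2 * C * δ ≤ ε` and
  -- hence equal. Within one leaf the parameter is determined by injectivity.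
  have hinj : InjOn Φ D := by
    rintro ⟨x, u⟩ hq ⟨x', u'⟩ hq' heq
    have h1 := hrel _ hq
    have h2 := hrel _ hq'
    rw [heq] at h1
    have h3 := (h1.trans (h.lam_pos 0) (by positivity) (by positivity) h2.symm).mono
      (h.lam_pos 0) hδε
    have h4 : x = x' := hsep x hq.1 x' hq'.1 h3
    subst h4
    obtain ⟨t, ht, hlt⟩ := h.eq_smul_of_mem hq.2.1
    obtain ⟨t', ht', hlt'⟩ := h.eq_smul_of_mem hq'.2.1
    change u = t • v 0 x at ht
    change u' = t' • v 0 x at ht'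
    subst ht ht'
    have h5 : g.len x (t • v 0 x) < δ := hq.2.2
    have h6 : g.len x (t' • v 0 x) < δ := hq'.2.2
    change g.len x (t • v 0 x) = |t| at hlt
    change g.len x (t' • v 0 x) = |t'| at hlt'
    rw [hlt] at h5
    rw [hlt'] at h6
    change leafMap e v Γ _ = leafMap e v Γ _ at heq
    rw [h.leafMap_smul, h.leafMap_smul] at heq
    rw [(hΓ x).injOn (abs_le.1 (h5.le.trans hδρ.le)) (abs_le.1 (h6.le.trans hδρ.le)) heq]
  have hproj : Continuous fun q : TangentBundle (𝓡 3) M => q.1 := FiberBundle.continuous_proj _ _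
  have hde := h.contMDiff.continuous_differential
  -- Near `q₁` the map agrees on `D` with the flow started at the chart point for the time
  -- `chartRatio`, read back in the manifold; every ingredient of this expression is continuous.
  have hcont : ContinuousOn Φ D := by
    intro q₁ hq₁
    obtain ⟨x₀, R, X, θ, w, η₀, r, ψ, b, hρr, hev⟩ := hbox q₁.1
    obtain ⟨hin, σ, hσ, hσv, hflow⟩ := hev.self_of_nhds
    set φ := extChartAt (𝓡 3) x₀
    have hrR : r ≤ R := by linarith [b.radius_le, b.pos]
    obtain ⟨hr1, -, t, ht, hΦt, hφΦ⟩ := h.leafMap_eq_flow hq₁.2.1 (hq₁.2.2.le.trans hδρ.le) hσ hσv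
      hflow
    have hx₁ : q₁.1 ∈ φ.source ∧ φ q₁.1 ∈ Metric.ball (φ x₀) r := by
      have := hin 0 h0ρ
      rwa [(hΓ _).zero] at this
    have hφc : ContinuousAt (fun q : TangentBundle (𝓡 3) M => φ q.1) q₁ :=
      ContinuousAt.comp (f := fun q : TangentBundle (𝓡 3) M => q.1)
        (continuousAt_extChartAt' hx₁.1) hproj.continuousAt
    have hVc : ContinuousAt (fun p => differential e (φ.symm p) (chartFrame x₀ p (X p)))
        (φ q₁.1) := by
      have h1 : ContinuousOn (fun p => differential e (φ.symm p) (chartFrame x₀ p (X p)))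
          (Metric.closedBall (φ x₀) R) :=
        hde.comp_continuousOn ((continuousOn_mk_chartFrame x₀).comp
          (continuousOn_id.prodMk b.continuousOn_field) fun p hp => ⟨b.subset_target hp, trivial⟩)
      refine h1.continuousAt (mem_of_superset (Metric.isOpen_ball.mem_nhds hx₁.2) ?_)
      exact Metric.ball_subset_closedBall.trans (Metric.closedBall_subset_closedBall hrR)
    have hV0 : differential e (φ.symm (φ q₁.1)) (chartFrame x₀ (φ q₁.1) (X (φ q₁.1))) ≠ 0 := by
      intro h0
      rw [h0, smul_zero] at hσv
      exact h.differential_ne_zero _ hσv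
    have hrat : ContinuousAt (chartRatio e x₀ X) q₁ := by
      have h1 : ContinuousAt (fun q : TangentBundle (𝓡 3) M =>
          differential e (φ.symm (φ q.1)) (chartFrame x₀ (φ q.1) (X (φ q.1)))) q₁ :=
        ContinuousAt.comp (f := fun q : TangentBundle (𝓡 3) M => φ q.1) hVc hφc
      exact (h1.inner hde.continuousAt).div (h1.inner h1) (inner_self_ne_zero.2 hV0)
    have hψc : ContinuousAt (fun q : 𝔼 × ℝ => ψ q.1 q.2) (φ q₁.1, chartRatio e x₀ X q₁) := by
      refine b.continuousOn_flow.continuousAt (prod_mem_nhds ?_ ?_)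
      · exact mem_of_superset (Metric.isOpen_ball.mem_nhds hx₁.2) Metric.ball_subset_closedBall
      · have h1 : |chartRatio e x₀ X q₁| < r := by
          rw [hr1]; exact hq₁.2.2.trans (hδρ.trans_le hρr)
        exact Icc_mem_nhds (abs_lt.1 h1).1 (abs_lt.1 h1).2
    have hsc : ContinuousAt φ.symm (ψ (φ q₁.1) (chartRatio e x₀ X q₁)) := by
      rw [← hφΦ]
      refine continuousAt_extChartAt_symm'' (φ.map_source ?_)
      rw [hΦt]
      exact (hin t ht).1
    have hG : ContinuousAt (fun q : TangentBundle (𝓡 3) M =>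
        φ.symm (ψ (φ q.1) (chartRatio e x₀ X q))) q₁ :=
      ContinuousAt.comp (f := fun q : TangentBundle (𝓡 3) M =>
        ψ (φ q.1) (chartRatio e x₀ X q)) hsc
        (ContinuousAt.comp (f := fun q : TangentBundle (𝓡 3) M =>
          (φ q.1, chartRatio e x₀ X q)) (g := fun q : 𝔼 × ℝ => ψ q.1 q.2) hψc
          (hφc.prodMk hrat))
    have heq : ∀ q ∈ D, ((∀ t ∈ Icc (-ρ) ρ, Γ q.1 t ∈ φ.source ∧
          φ (Γ q.1 t) ∈ Metric.ball (φ x₀) r) ∧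
          ∃ σ : ℝ, (σ = 1 ∨ σ = -1) ∧ differential e q.1 (v 0 q.1) =
            σ • differential e (φ.symm (φ q.1)) (chartFrame x₀ (φ q.1) (X (φ q.1))) ∧
            ∀ t ∈ Icc (-ρ) ρ, φ (Γ q.1 t) = ψ (φ q.1) (σ * t)) →
        Φ q = φ.symm (ψ (φ q.1) (chartRatio e x₀ X q)) := by
      rintro q hq ⟨hin, σ, hσ, hσv, hflow⟩
      obtain ⟨-, -, t, ht, hΦt, hφΦ⟩ := h.leafMap_eq_flow hq.2.1 (hq.2.2.le.trans hδρ.le) hσ hσv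
        hflow
      rw [← hφΦ, φ.left_inv]
      rw [hΦt]
      exact (hin t ht).1
    refine hG.continuousWithinAt.congr_of_eventuallyEq ?_ (heq q₁ hq₁ ⟨hin, σ, hσ, hσv, hflow⟩)
    filter_upwards [self_mem_nhdsWithin,
      mem_nhdsWithin_of_mem_nhds (hproj.continuousAt.eventually hev)] with q hq hq'
    exact heq q hq hq'
  -- Openness comes from the flow lines through the surface filling a neighbourhood. The map `S`
  -- below turns a starting point and a time back into a stable vector.
  have hopen : ∀ q₁ ∈ D, ∀ W ∈ 𝓝 q₁, ∀ᶠ y in 𝓝 (Φ q₁), ∃ q ∈ W ∩ D, Φ q = y := by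
    intro q₁ hq₁ W hW
    obtain ⟨x₀, R, X, θ, w, η₀, r, ψ, b, hρr, hev⟩ := hbox q₁.1
    obtain ⟨hin, σ, hσ, hσv, hflow⟩ := hev.self_of_nhds
    set φ := extChartAt (𝓡 3) x₀
    have hrR : r ≤ R := by linarith [b.radius_le, b.pos]
    obtain ⟨hr1, hdq, t, ht, hΦt, hφΦ⟩ := h.leafMap_eq_flow hq₁.2.1 (hq₁.2.2.le.trans hδρ.le) hσ
      hσv hflow
    have hx₁ : q₁.1 ∈ φ.source ∧ φ q₁.1 ∈ Metric.ball (φ x₀) r := by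
      have := hin 0 h0ρ
      rwa [(hΓ _).zero] at this
    have hs₁ : |chartRatio e x₀ X q₁| < δ := by rw [hr1]; exact hq₁.2.2
    have hx₁R : φ q₁.1 ∈ Metric.closedBall (φ x₀) R :=
      Metric.closedBall_subset_closedBall hrR (Metric.ball_subset_closedBall hx₁.2)
    have hleft : φ.symm (φ q₁.1) = q₁.1 := φ.left_inv hx₁.1
    have hp₁S : φ q₁.1 ∈ chartPiece x₀ R T := ⟨hx₁R, by
      change φ.symm (φ q₁.1) ∈ T
      rw [hleft]; exact hq₁.1⟩
    let S : 𝔼 × ℝ → TangentBundle (𝓡 3) M := fun a =>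
      ⟨φ.symm a.1, chartFrame x₀ a.1 (a.2 • X a.1)⟩
    have hSq : S (φ q₁.1, chartRatio e x₀ X q₁) = q₁ := by
      refine h.tangentBundle_ext hleft ?_
      change differential e (φ.symm (φ q₁.1)) (chartFrame x₀ (φ q₁.1)
        (chartRatio e x₀ X q₁ • X (φ q₁.1))) = _
      rw [map_smul, map_smul, hdq]
    have hSc : Tendsto S (𝓝 (φ q₁.1, chartRatio e x₀ X q₁)) (𝓝 q₁) := by
      have h1 : ContinuousAt S (φ q₁.1, chartRatio e x₀ X q₁) := by
        have h2 : ContinuousOn S (Metric.closedBall (φ x₀) R ×ˢ univ) :=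
          (continuousOn_mk_chartFrame x₀).comp
            (continuousOn_fst.prodMk (continuousOn_snd.smul
              (b.continuousOn_field.comp continuousOn_fst fun a ha => ha.1)))
            fun a ha => ⟨b.subset_target ha.1, trivial⟩
        refine h2.continuousAt (prod_mem_nhds (mem_of_superset
          (Metric.isOpen_ball.mem_nhds hx₁.2) ?_) univ_mem)
        exact Metric.ball_subset_closedBall.trans (Metric.closedBall_subset_closedBall hrR)
      rw [ContinuousAt, hSq] at h1
      exact h1
    have hO := inter_mem (inter_mem (f := 𝓝 (φ q₁.1, chartRatio e x₀ X q₁)) (mem_map.1 (hSc hW))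
      (mem_map.1 (hSc (hproj.continuousAt.eventually hev))))
      (show {a : 𝔼 × ℝ | |a.2| < δ} ∈ 𝓝 (φ q₁.1, chartRatio e x₀ X q₁) from
        (isOpen_lt (by fun_prop) (by fun_prop)).mem_nhds hs₁)
    have hz := b.eventually_exists_flow_eq hTc hT hp₁S hx₁.2 (hs₁.trans (hδρ.trans_le hρr))
      (by rw [← hφΦ, hΦt]; exact (hin t ht).2) hO
    change ∀ᶠ z in 𝓝 (ψ (φ q₁.1) (chartRatio e x₀ X q₁)), _ at hz
    rw [← hφΦ] at hz
    have hΦs : Φ q₁ ∈ φ.source := by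
      change leafMap e v Γ q₁ ∈ _
      rw [hΦt]; exact (hin t ht).1
    have hφc : ContinuousAt φ (Φ q₁) := continuousAt_extChartAt' hΦs
    filter_upwards [hφc.eventually hz, (isOpen_extChartAt_source x₀).mem_nhds hΦs]
      with y hy hys
    obtain ⟨⟨p, s⟩, ⟨⟨hW', hev'⟩, hs⟩, hpS, hpr, hψ⟩ := hy
    have hpR : p ∈ Metric.closedBall (φ x₀) R := hpS.1
    have hright : φ (φ.symm p) = p := φ.right_inv (b.subset_target hpR)
    have hSE : (S (p, s)).2 ∈ E 0 (S (p, s)).1 := by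
      change chartFrame x₀ p (s • X p) ∈ E 0 (φ.symm p)
      rw [map_smul]
      exact Submodule.smul_mem _ _ (b.mem_stable hpR)
    have hSl : g.len (S (p, s)).1 (S (p, s)).2 < δ := by
      change g.len (φ.symm p) (chartFrame x₀ p (s • X p)) < δ
      rw [map_smul, g.len_smul, b.unit p hpR, mul_one]
      exact hs
    have hSD : S (p, s) ∈ D := ⟨hpS.2, hSE, hSl⟩
    refine ⟨S (p, s), ⟨hW', hSD⟩, ?_⟩
    obtain ⟨hin', σ', hσ', hσv', hflow'⟩ := hev'
    obtain ⟨-, -, t', ht', hΦt', hφΦ'⟩ := h.leafMap_eq_flow hSE (hSl.le.trans hδρ.le) hσ' hσv'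
      hflow'
    have hV0 : differential e (φ.symm p) (chartFrame x₀ p (X p)) ≠ 0 := by
      intro h0
      have h1 : chartFrame x₀ p (X p) = 0 :=
        (injective_iff_map_eq_zero _).1 (h.injective_differential _) _ h0
      have h2 := b.unit p hpR
      change g.len (φ.symm p) (chartFrame x₀ p (X p)) = 1 at h2
      rw [h1, g.len_zero] at h2
      exact zero_ne_one h2
    have hratio : chartRatio e x₀ X (S (p, s)) = s := by
      have h1 : ∀ p', p' = p → lineRatio (differential e (φ.symm p') (chartFrame x₀ p' (X p')))
          (differential e (φ.symm p) (chartFrame x₀ p (s • X p))) = s := by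
        rintro _ rfl
        rw [map_smul, map_smul, lineRatio_smul hV0]
      exact h1 _ hright
    rw [hratio] at hφΦ'
    change φ (Φ (S (p, s))) = ψ (φ (φ.symm p)) s at hφΦ'
    rw [hright] at hφΦ'
    refine φ.injOn ?_ hys (hφΦ'.trans hψ)
    change leafMap e v Γ (S (p, s)) ∈ φ.source
    rw [hΦt']
    exact (hin' t' ht').1
  have hemb : Topology.IsOpenEmbedding (D.domRestrict Φ) := by
    refine Topology.IsOpenEmbedding.of_continuous_injective_isOpenMap
      (continuousOn_iff_continuous_domRestrict.1 hcont) (injOn_iff_injective.1 hinj)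
      (isOpenMap_iff_nhds_le.2 fun d s hs => ?_)
    obtain ⟨W, hW, hWs⟩ := mem_nhds_subtype _ _ _ |>.1 (mem_map.1 hs)
    filter_upwards [hopen d.1 d.2 W hW] with y hy
    obtain ⟨q, ⟨hqW, hqD⟩, rfl⟩ := hy
    exact hWs (show (⟨q, hqD⟩ : D) ∈ Subtype.val ⁻¹' W from hqW)
  have hzero : ∀ x ∈ T, (⟨x, (0 : ℝ) • v 0 x⟩ : TangentBundle (𝓡 3) M) ∈ D ∧
      Φ ⟨x, (0 : ℝ) • v 0 x⟩ = x := by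
    intro x hx
    refine ⟨⟨hx, Submodule.smul_mem _ _ (h.unitSection 0 x).1, ?_⟩, ?_⟩
    · change g.len x ((0 : ℝ) • v 0 x) < δ
      rw [g.len_smul, abs_zero, zero_mul]; exact hδ0
    · change leafMap e v Γ _ = x
      rw [h.leafMap_smul, (hΓ x).zero]
  -- The empty surface is treated apart because `Function.invFunOn` needs an inhabited type.
  rcases T.eq_empty_or_nonempty with hTe | ⟨x₁, hx₁⟩
  · have hDe : D = ∅ := by
      ext q
      exact ⟨fun hq => by have := hq.1; rw [hTe] at this; exact this.elim, fun hq => hq.elim⟩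
    refine ⟨∅, id, ⟨Φ, hemb, by rw [← image_empty Φ, ← hDe], ?_⟩, isOpen_empty, hTe.subset,
      fun y hy => hy.elim, fun y hy => hy.elim, continuousOn_empty _⟩
    intro x hx
    rw [hTe] at hx
    exact hx.elim
  have : Nonempty (TangentBundle (𝓡 3) M) := ⟨⟨x₁, 0⟩⟩
  have hinv : ∀ q ∈ D, Function.invFunOn Φ D (Φ q) = q := fun q hq =>
    hinj.leftInvOn_invFunOn hq
  refine ⟨Φ '' D, fun y => (Function.invFunOn Φ D y).1, ⟨Φ, hemb, rfl, ?_⟩, ?_, ?_, ?_, ?_, ?_⟩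
  · intro x hx u hu hu1
    obtain ⟨t, rfl, ht⟩ := h.eq_smul_of_mem hu
    rw [hu1] at ht
    have ht1 : t = 1 ∨ t = -1 := eq_or_eq_neg_of_abs_eq ht.symm
    have hfun : (fun s : ℝ => Φ ⟨x, s • t • v 0 x⟩) = fun s => Γ x (t * s) := by
      funext s
      rw [smul_smul, mul_comm]
      exact h.leafMap_smul Γ x _
    rw [hfun]
    exact (hΓ x).isUnitSpeedTangentCurve ht1 hδ0 hδρ.le
  · refine isOpen_iff_mem_nhds.2 ?_
    rintro _ ⟨q, hq, rfl⟩
    filter_upwards [hopen q hq univ univ_mem] with y hy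
    obtain ⟨q', hq', rfl⟩ := hy
    exact ⟨q', hq'.2, rfl⟩
  · exact fun x hx => ⟨_, (hzero x hx).1, (hzero x hx).2⟩
  · rintro _ ⟨q, hq, rfl⟩
    simp only [hinv q hq]
    exact hq.1
  · rintro _ ⟨q, hq, rfl⟩
    simp only [hinv q hq]
    exact hrel q hq
  · rintro _ ⟨q, hq, rfl⟩
    refine ContinuousAt.continuousWithinAt
      (ContinuousAt.comp (f := Function.invFunOn Φ D) hproj.continuousAt ?_)
    rw [ContinuousAt, hinv q hq]
    -- Openness of `Φ` is continuity of its inverse, and the projection is this inverse followed by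
    -- the base point map.
    refine fun W hW => mem_map.2 ?_
    filter_upwards [hopen q hq W hW] with y hy
    obtain ⟨q', hq', rfl⟩ := hy
    rw [mem_preimage, hinv q' hq'.2]
    exact hq'.1

end TubularNeighbourhoodTheorem

/-! ### Limits of tangent surfaces -/

section LimitSurfaces

variable {M : Type*} [TopologicalSpace M] [ChartedSpace (EuclideanSpace ℝ (Fin 3)) M]
  [IsManifold (𝓡 3) ∞ M]

local notation "𝔼" => EuclideanSpace ℝ (Fin 3)

variable {F : Type*} [NormedAddCommGroup F] [InnerProductSpace ℝ F] [FiniteDimensional ℝ F]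
  {f : M ≃ₘ^1⟮𝓡 3, 𝓡 3⟯ M} {g : RiemMetric M} {E : Fin 3 → PlaneField M}
  {v : Fin 3 → ∀ x : M, TangentSpace (𝓡 3) x} {lam : Fin 3 → M → ℝ} {e : M → F}

namespace IsStableBox

variable {x₀ : M} {R η₀ : ℝ} {X : 𝔼 → 𝔼} {θ : 𝔼 → 𝔼 →L[ℝ] ℝ} {w : 𝔼}

/-- Tangent steps pass to limits of surfaces. -/
lemma exists_hasTangentSteps_limit (b : IsStableBox g E v e x₀ R X θ w η₀) {S : ℕ → Set M}
    (hSc : ∀ k, IsClosed (S k))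
    (hS : ∀ k, IsSurfaceTangentTo (fun x => E 1 x ⊔ E 2 x) (S k)) {T : Set M}
    (hT : ∀ y ∈ T, ∃ s : ℕ → M, (∀ k, s k ∈ S k) ∧ Tendsto s atTop (𝓝 y))
    (hlim : ∀ 𝒰 : Ultrafilter ℕ, (𝒰 : Filter ℕ) ≤ atTop → ∀ (s : ℕ → M) (z : M),
      (∀ᶠ k in (𝒰 : Filter ℕ), s k ∈ S k) → Tendsto s 𝒰 (𝓝 z) → z ∈ T) :
    ∃ r₁ > 0, r₁ ≤ R / 2 ∧ HasTangentSteps θ w (chartPiece x₀ R T)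
      (Metric.closedBall (extChartAt (𝓡 3) x₀ x₀) r₁) := by
  obtain ⟨r₀, hr₀, hsteps⟩ := b.exists_uniform_tangentSteps
  obtain ⟨Cθ, hCθ0, hCθ⟩ := b.exists_form_bound
  have hR := b.pos
  set φ := extChartAt (𝓡 3) x₀
  refine ⟨min (r₀ / 2) (R / 2), lt_min (by positivity) (by positivity), min_le_right _ _,
    fun η hη => ?_⟩
  -- The step size depends only on the box and on `η`, so it serves all surfaces `S k` at once.
  obtain ⟨r, hr, hsteps⟩ := hsteps η hη
  refine ⟨r, hr, fun p hp u hu => ?_⟩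
  have hpt : p ∈ φ.target := b.subset_target hp.1.1
  have hpd : dist p (φ x₀) ≤ min (r₀ / 2) (R / 2) := hp.2
  obtain ⟨s, hsS, hs⟩ := hT (φ.symm p) hp.1.2
  let 𝒰 : Ultrafilter ℕ := hyperfilter ℕ
  have h𝒰 : (𝒰 : Filter ℕ) ≤ atTop := by
    rw [← Nat.cofinite_eq_atTop]; exact hyperfilter_le_cofinite
  have hsrc : φ.symm p ∈ φ.source := φ.map_target hpt
  have hφs : Tendsto (fun k => φ (s k)) 𝒰 (𝓝 p) := by
    have h1 : ContinuousAt φ (φ.symm p) := continuousAt_extChartAt' hsrc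
    rw [ContinuousAt, φ.right_inv hpt] at h1
    exact h1.comp (hs.mono_left h𝒰)
  have hin : ∀ᶠ k in (𝒰 : Filter ℕ), φ (s k) ∈ chartPiece x₀ R (S k) ∩
      Metric.closedBall (φ x₀) r₀ := by
    have h1 : ∀ᶠ k in (𝒰 : Filter ℕ), s k ∈ φ.source :=
      (hs.mono_left h𝒰).eventually ((isOpen_extChartAt_source x₀).mem_nhds hsrc)
    have h2 : ∀ᶠ k in (𝒰 : Filter ℕ), dist (φ (s k)) p < min (r₀ / 2) (R / 2) :=
      hφs.eventually (Metric.ball_mem_nhds _ (lt_min (by positivity) (by positivity)))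
    filter_upwards [h1, h2] with k hk1 hk2
    have h3 := dist_triangle (φ (s k)) p (φ x₀)
    have h4 := min_le_left (r₀ / 2) (R / 2)
    have h5 := min_le_right (r₀ / 2) (R / 2)
    refine ⟨⟨Metric.mem_closedBall.2 (by linarith), ?_⟩, Metric.mem_closedBall.2 (by linarith)⟩
    change φ.symm (φ (s k)) ∈ S k
    rw [φ.left_inv hk1]
    exact hsS k
  have hex : ∀ k, ∃ ρ : ℝ, φ (s k) ∈ chartPiece x₀ R (S k) ∩ Metric.closedBall (φ x₀) r₀ →
      |ρ - θ (φ (s k)) u| ≤ η * ‖u‖ ∧ φ (s k) + u - ρ • w ∈ chartPiece x₀ R (S k) := by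
    intro k
    by_cases hk : φ (s k) ∈ chartPiece x₀ R (S k) ∩ Metric.closedBall (φ x₀) r₀
    · obtain ⟨ρ, hρ⟩ := hsteps _ (b.isClosed_chartPiece (hSc k))
        (b.hasTangentSteps_chartPiece (hSc k) (hS k)) _ hk u hu
      exact ⟨ρ, fun _ => hρ⟩
    · exact ⟨0, fun h => absurd h hk⟩
  choose ρ hρ using hex
  set B := (Cθ + η) * ‖u‖
  have hbd : ∀ᶠ k in (𝒰 : Filter ℕ), ρ k ∈ Icc (-B) B := by
    filter_upwards [hin] with k hk
    have h1 := abs_le.1 (hρ k hk).1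
    have h2 : |θ (φ (s k)) u| ≤ Cθ * ‖u‖ := by
      rw [← Real.norm_eq_abs]
      exact ((θ _).le_opNorm u).trans
        (mul_le_mul_of_nonneg_right (hCθ _ hk.1.1) (norm_nonneg _))
    have h3 := abs_le.1 h2
    simp only [B]
    constructor <;> linarith
  -- The offsets are bounded, so they converge along the ultrafilter; the limit is an offset for `T`
  -- with the same error.
  obtain ⟨ρ₀, -, hρ₀⟩ := isCompact_Icc.ultrafilter_le_nhds (𝒰.map ρ) (le_principal_iff.2 hbd)
  have hρlim : Tendsto ρ 𝒰 (𝓝 ρ₀) := hρ₀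
  have hz : Tendsto (fun k => φ (s k) + u - ρ k • w) 𝒰 (𝓝 (p + u - ρ₀ • w)) :=
    (hφs.add_const u).sub (hρlim.smul_const w)
  have hzR : ∀ᶠ k in (𝒰 : Filter ℕ), φ (s k) + u - ρ k • w ∈ Metric.closedBall (φ x₀) R :=
    hin.mono fun k hk => (hρ k hk).2.1
  have hzlim : p + u - ρ₀ • w ∈ Metric.closedBall (φ x₀) R :=
    Metric.isClosed_closedBall.mem_of_tendsto hz hzR
  refine ⟨ρ₀, ?_, hzlim, ?_⟩
  · have hθ : Tendsto (fun k => θ (φ (s k)) u) 𝒰 (𝓝 (θ p u)) := by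
      have h1 : Tendsto (fun k => θ (φ (s k))) 𝒰 (𝓝 (θ p)) :=
        (b.continuousOn_form p hp.1.1).tendsto.comp
          (tendsto_nhdsWithin_iff.2 ⟨hφs, hin.mono fun k hk => hk.1.1⟩)
      exact ((ContinuousLinearMap.apply ℝ ℝ u).continuous.tendsto _).comp h1
    exact le_of_tendsto (hρlim.sub hθ).abs (hin.mono fun k hk => (hρ k hk).1)
  · refine hlim 𝒰 h𝒰 (fun k => φ.symm (φ (s k) + u - ρ k • w)) _
      (hin.mono fun k hk => (hρ k hk).2.2) ?_
    exact (((continuousOn_extChartAt_symm x₀).mono b.subset_target) _ hzlim).tendsto.comp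
      (tendsto_nhdsWithin_iff.2 ⟨hz, hzR⟩)

end IsStableBox

/-- A limit of surfaces tangent to the center-unstable field that contains no two stably related
points is a surface tangent to that field. -/
theorem IsAdaptedFrame.isSurfaceTangentTo_limit [CompactSpace M]
    (h : IsAdaptedFrame f g E v lam e) {S : ℕ → Set M} (hSc : ∀ k, IsClosed (S k))
    (hS : ∀ k, IsSurfaceTangentTo (fun x => E 1 x ⊔ E 2 x) (S k)) {T : Set M} (hTc : IsClosed T)
    (hT : ∀ y ∈ T, ∃ s : ℕ → M, (∀ k, s k ∈ S k) ∧ Tendsto s atTop (𝓝 y))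
    (hlim : ∀ 𝒰 : Ultrafilter ℕ, (𝒰 : Filter ℕ) ≤ atTop → ∀ (s : ℕ → M) (z : M),
      (∀ᶠ k in (𝒰 : Filter ℕ), s k ∈ S k) → Tendsto s 𝒰 (𝓝 z) → z ∈ T)
    {l : ℝ} (hl : 0 < l) (hsep : ∀ x ∈ T, ∀ y ∈ T, StableRel e f (lam 0) l x y → x = y) :
    IsSurfaceTangentTo (fun x => E 1 x ⊔ E 2 x) T := by
  intro x₀ hx₀
  obtain ⟨R, X, θ, w, η₀, b⟩ := h.exists_isStableBox x₀
  obtain ⟨C, hC0, hC⟩ := h.exists_norm_differential_le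
  obtain ⟨r₁, hr₁, hr₁R, hsteps⟩ := b.exists_hasTangentSteps_limit hSc hS hT hlim
  have hR := b.pos
  set φ := extChartAt (𝓡 3) x₀
  set p₀ := φ x₀
  have hx₀s : x₀ ∈ φ.source := mem_extChartAt_source x₀
  have hp₀ : p₀ ∈ chartPiece x₀ R T := ⟨b.center_mem, by
    change φ.symm (φ x₀) ∈ T
    rw [φ.left_inv hx₀s]; exact hx₀⟩
  have hcl := b.isClosed_chartPiece hTc
  have b' := b.toIsTransverseBox.mono (R' := 2 * r₁) (by positivity) (by linarith)
  have hsub : Metric.closedBall p₀ (2 * r₁) ⊆ Metric.closedBall p₀ R :=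
    Metric.closedBall_subset_closedBall (by linarith)
  obtain ⟨rh, hrh, hhit⟩ := b'.exists_hit
  have hsteps' : HasTangentSteps θ w (chartPiece x₀ R T)
      (Metric.closedBall p₀ (2 * r₁ / 2)) := by
    rw [mul_div_cancel_left₀ r₁ two_ne_zero]; exact hsteps
  set r₂ := min (min r₁ rh) (l / (2 * C))
  have hr₂ : 0 < r₂ := lt_min (lt_min hr₁ hrh) (by positivity)
  have hr₂1 : r₂ ≤ r₁ := (min_le_left _ _).trans (min_le_left _ _)
  have hr₂h : r₂ ≤ rh := (min_le_left _ _).trans (min_le_right _ _)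
  -- A second point of `T` on the line through `p` parallel to `w` makes the stable arc through `p`
  -- hit `T` at a positive time. The hitting point is stably related to `p`, hence equal to it,
  -- although the height changes strictly along the arc.
  have huniq : ∀ p ∈ chartPiece x₀ R T ∩ Metric.closedBall p₀ r₂, ∀ ρ : ℝ, |ρ| ≤ r₂ →
      p + ρ • w ∈ chartPiece x₀ R T → ρ = 0 := by
    intro p hp ρ hρ hpρ
    by_contra hne
    obtain ⟨τ, hτ, hτ0, γ, hγ0, hγτ, hsol⟩ := hhit _ hcl hsteps' p (-ρ)
      (Metric.closedBall_subset_closedBall hr₂h hp.2) (by rw [abs_neg]; exact hρ.trans hr₂h)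
      (by rw [neg_smul, sub_neg_eq_add]; exact hpρ)
    have hτpos := hτ0 (neg_ne_zero.2 hne)
    rw [abs_neg] at hτ
    have hl0 : (0 : ℝ) ∈ Icc 0 τ := left_mem_Icc.2 hτ.1
    have hlτ : τ ∈ Icc 0 τ := right_mem_Icc.2 hτ.1
    have hrel : StableRel e f (lam 0) (C * |τ - 0|) (φ.symm (γ 0)) (φ.symm (γ τ)) := by
      rcases hsol with hsol | hsol
      · exact b.stableRel h hC0.le hC (hsol.mono_set hsub) hl0 hlτ
      · refine h.stableRel_of_isSolutionOn hC0.le hC b.subset_target (fun p hp => ?_)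
          (hsol.mono_set hsub) hl0 hlτ
        rw [map_neg, g.len_neg]
        exact ⟨Submodule.neg_mem _ (b.mem_stable hp), b.unit p hp⟩
    have hle : C * |τ - 0| ≤ l := by
      rw [sub_zero, abs_of_pos hτpos]
      calc C * τ ≤ C * (2 * (l / (2 * C))) := by
            gcongr
            exact hτ.2.trans (by gcongr; exact hρ.trans (min_le_right _ _))
        _ = l := by field_simp
    have heq := hsep _ (by rw [hγ0]; exact hp.1.2) _ hγτ.2 (hrel.mono (h.lam_pos 0) hle)
    have hγ0R : γ 0 ∈ Metric.closedBall p₀ R := by rw [hγ0]; exact hp.1.1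
    have heq' : γ 0 = γ τ := φ.symm.injOn (b.subset_target hγ0R) (b.subset_target hγτ.1) heq
    rcases hsol with hsol | hsol
    · have h1 := hsol.lower_bound (ℓ := θ p₀) (m := 1 / 2)
        (fun q hq => b'.half_le _ b'.center_mem q hq) hl0 hlτ hτ.1
      rw [← heq', sub_self] at h1
      linarith
    · have h1 := hsol.lower_bound (ℓ := -θ p₀) (m := 1 / 2)
        (fun q hq => by
          change 1 / 2 ≤ -(θ p₀ (-X q))
          rw [map_neg, neg_neg]
          exact b'.half_le _ b'.center_mem q hq) hl0 hlτ hτ.1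
      rw [← heq', sub_self] at h1
      linarith
  have hsteps₂ : HasTangentSteps θ w (chartPiece x₀ R T) (Metric.closedBall p₀ r₂) := by
    intro η hη
    obtain ⟨ρ, hρ, h1⟩ := hsteps η hη
    exact ⟨ρ, hρ, fun p hp => h1 p ⟨hp.1, Metric.closedBall_subset_closedBall hr₂1 hp.2⟩⟩
  obtain ⟨r, hr, hrR, u, hu, hur⟩ := b.toIsTransverseBox.exists_graph_function hp₀ hr₂
    (by linarith) hsteps₂ huniq
  have hrsub : Metric.ball p₀ r ⊆ Metric.closedBall p₀ R :=
    Metric.ball_subset_closedBall.trans (Metric.closedBall_subset_closedBall hrR)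
  have : IsManifold (𝓡 3) 1 M := IsManifold.of_le (n := ∞) (by simp)
  have hφc : ContMDiffOn (𝓡 3) 𝓘(ℝ, 𝔼) 1 φ φ.source := by
    have h1 := contMDiffOn_extChartAt (I := 𝓡 3) (n := 1) (x := x₀)
    rwa [← extChartAt_source (𝓡 3)] at h1
  have hmem : ∀ y ∈ φ.source ∩ φ ⁻¹' Metric.ball p₀ r, φ y ∈ chartPiece x₀ R T ↔ y ∈ T := by
    intro y hy
    refine ⟨fun h1 => ?_, fun h1 => ⟨hrsub hy.2, ?_⟩⟩
    · have h2 : φ.symm (φ y) ∈ T := h1.2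
      rwa [φ.left_inv hy.1] at h2
    · change φ.symm (φ y) ∈ T
      rwa [φ.left_inv hy.1]
  refine ⟨φ.source ∩ φ ⁻¹' Metric.ball p₀ r, (continuousOn_extChartAt x₀).isOpen_inter_preimage
    (isOpen_extChartAt_source x₀) Metric.isOpen_ball, ⟨hx₀s, Metric.mem_ball_self hr⟩, u ∘ φ,
    hu.contMDiffOn.comp (hφc.mono inter_subset_left) fun y hy => hy.2, ?_, ?_⟩
  · ext y
    constructor
    · exact fun hy => ⟨hy.2, (hur _ hy.2.2).1.1 ((hmem y hy.2).2 hy.1)⟩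
    · exact fun hy => ⟨(hmem y hy.1).1 ((hur _ hy.1.2).1.2 hy.2), hy.1⟩
  · rintro y ⟨hyT, hyV⟩
    have hyS := (hmem y hyV).2 hyT
    have h1 : HasMFDerivAt 𝓘(ℝ, 𝔼) 𝓘(ℝ, ℝ) u (φ y) (θ (φ y)) :=
      ((hur _ hyV.2).2 hyS).hasMFDerivAt
    have h2 : MDifferentiableAt (𝓡 3) 𝓘(ℝ, 𝔼) φ y :=
      mdifferentiableAt_extChartAt (by rw [← extChartAt_source (𝓡 3)]; exact hyV.1)
    have h3 : mfderiv (𝓡 3) 𝓘(ℝ, ℝ) (u ∘ φ) y =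
        (θ (φ y)).comp (mfderiv (𝓡 3) 𝓘(ℝ, 𝔼) φ y) :=
      (HasMFDerivAt.comp (g := u) (f := φ) y h1 h2.hasMFDerivAt).mfderiv
    ext z
    have h4 := b.form_eq_zero_iff (φ y) (hrsub hyV.2) (mfderiv (𝓡 3) 𝓘(ℝ, 𝔼) φ y z)
    have h5 : ∀ q q' : TangentBundle (𝓡 3) M, q = q' →
        (q.2 ∈ E 1 q.1 ⊔ E 2 q.1 ↔ q'.2 ∈ E 1 q'.1 ⊔ E 2 q'.1) := by rintro q _ rfl; rfl
    have h6 := h5 _ _ (mk_chartFrame_mfderiv hyV.1 z)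
    change chartFrame x₀ (φ y) (mfderiv (𝓡 3) 𝓘(ℝ, 𝔼) φ y z) ∈
      E 1 (φ.symm (φ y)) ⊔ E 2 (φ.symm (φ y)) ↔ z ∈ E 1 y ⊔ E 2 y at h6
    rw [← h6, h3]
    exact h4

end LimitSurfaces

/-! ### The torus, its images and the main theorem -/

section Torus

variable {M : Type*} [TopologicalSpace M] [ChartedSpace (EuclideanSpace ℝ (Fin 3)) M]

lemma IsCuTorus.isCompact {Ec Eu : PlaneField M} {T : Set M} (hT : IsCuTorus Ec Eu T) :
    IsCompact T := by
  obtain ⟨φ⟩ := hT.1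
  exact isCompact_iff_compactSpace.2 φ.symm.compactSpace

lemma IsCuTorus.nonempty {Ec Eu : PlaneField M} {T : Set M} (hT : IsCuTorus Ec Eu T) :
    T.Nonempty := by
  obtain ⟨φ⟩ := hT.1
  exact ⟨φ.symm 1, (φ.symm 1).2⟩

end Torus

/-- Limits of points of the sets `f^[k * n] '' T` lie in the intersection of the nested sets
`f^[k * n] '' U`. -/
lemma mem_iInter_image_of_tendsto {M : Type*} [TopologicalSpace M] [CompactSpace M] [T2Space M]
    {f : M → M} (hf : Continuous f) {n : ℕ} {T U : Set M} (hTU : T ⊆ U)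
    (hU : f^[n] '' closure U ⊆ U) (𝒰 : Ultrafilter ℕ) (h𝒰 : (𝒰 : Filter ℕ) ≤ atTop)
    (s : ℕ → M) (z : M) (hs : ∀ᶠ k in (𝒰 : Filter ℕ), s k ∈ f^[k * n] '' T)
    (hz : Tendsto s 𝒰 (𝓝 z)) : z ∈ ⋂ k : ℕ, f^[k * n] '' U := by
  have hsub : ∀ j, f^[j * n] '' U ⊆ U := by
    intro j
    induction j with
    | zero => simp
    | succ j ih =>
      rw [Nat.succ_mul, Function.iterate_add, image_comp]
      exact (image_mono ((image_mono subset_closure).trans hU)).trans ih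
  refine mem_iInter.2 fun m => ?_
  -- One extra iterate makes room for the closure: the closed set lies in the `m`-th image of `U`
  -- and contains `s k` for all large `k` with `k ≥ m + 1`.
  have hc : IsClosed (f^[m * n] '' (f^[n] '' closure U)) :=
    ((isClosed_closure.isCompact.image (hf.iterate n)).image (hf.iterate _)).isClosed
  refine image_mono hU (hc.mem_of_tendsto hz ?_)
  filter_upwards [hs, h𝒰 (eventually_ge_atTop (m + 1))] with k hk hmk
  obtain ⟨x, hx, hxs⟩ := hk
  obtain ⟨j, rfl⟩ := Nat.exists_eq_add_of_le hmk
  have h1 : (m + 1 + j) * n = m * n + (n + j * n) := by ring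
  rw [← hxs, h1, Function.iterate_add_apply, Function.iterate_add_apply]
  exact mem_image_of_mem _ (mem_image_of_mem _ (subset_closure (hsub j (mem_image_of_mem _
    (hTU hx)))))

theorem mainTheorem4 {M : Type*} [TopologicalSpace M] [T2Space M] [CompactSpace M]
    [ChartedSpace (EuclideanSpace ℝ (Fin 3)) M] [IsManifold (𝓡 3) ∞ M]
    (f : M ≃ₘ^1⟮𝓡 3, 𝓡 3⟯ M) (g : RiemMetric M) (Es Ec Eu : PlaneField M)
    (hf : IsPartiallyHyperbolic f g Es Ec Eu)
    (T : Set M) (hT : IsCuTorus Ec Eu T) :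
    ∃ δ₀ : ℝ, 0 < δ₀ ∧ ∀ δ : ℝ, 0 < δ → δ < δ₀ →
      ∃ U : Set M, IsStableTubularNhd g Es T δ U ∧
        ∃ n : ℕ, 0 < n ∧ f^[n] '' closure U ⊆ U ∧
          ∃ T₀ : Set M, T₀ = ⋂ k : ℕ, f^[k * n] '' U ∧
            IsCuTorus Ec Eu T₀ ∧ f^[n] '' T₀ = T₀ := by
  obtain ⟨N, e, he, hemb, himm⟩ := exists_embedding_euclidean_of_compact (I := 𝓡 3) (M := M)
  have hinj := hemb.injective
  obtain ⟨v, lam, h, hlam⟩ := hf.exists_isAdaptedFrame (he.of_le (by simp)) hinj himm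
  obtain ⟨κ, hκ0, hκ1, hκ⟩ := h.exists_lam_zero_le hlam
  obtain ⟨C, hC0, hC⟩ := h.exists_norm_differential_le
  obtain ⟨ρ, hρ, Γ, hΓ, hbox⟩ := h.exists_localLeaves hκ hκ1.le hC0 hC
  have hTc := hT.isCompact
  have hTS : IsSurfaceTangentTo (fun x => ![Es, Ec, Eu] 1 x ⊔ ![Es, Ec, Eu] 2 x) T := hT.2
  obtain ⟨ε, hε, hsep⟩ := h.exists_separation_surface hκ hκ1.le hTc.isClosed hTS
  -- `exists_attractor` needs separation at four times the scale of the stable arcs.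
  have hl : 0 < ε / 4 := by positivity
  obtain ⟨ε', hε', hits⟩ := h.exists_uniform_hits hl
  have hpres : PreservesField (fun x => ![Es, Ec, Eu] 1 x ⊔ ![Es, Ec, Eu] 2 x) f :=
    .of_isInvariantField f (hf.center_invariant.sup hf.unstable_invariant)
  have hfc : Continuous f := f.continuous
  -- Leaves are available up to size `ρ`, and fibres of length `δ` must have constant `C * δ ≤ ε /
  -- 4`; then two fibres together stay below the separation scale.
  refine ⟨min ρ (ε / 4 / C), lt_min hρ (by positivity), fun δ hδ0 hδ => ?_⟩
  have hδρ := hδ.trans_le (min_le_left _ _)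
  have hCδ : C * δ ≤ ε / 4 := by
    rw [mul_comm]
    exact ((le_div_iff₀ hC0).1 (hδ.trans_le (min_le_right _ _)).le)
  obtain ⟨U, π, hU, hUo, hTU, hπT, hπ, hπc⟩ := h.exists_isStableTubularNhd hC0 hΓ hbox
    hTc.isClosed hTS hsep hδ0 hδρ (by linarith)
  refine ⟨U, hU, ?_⟩
  -- Every preimage of `T` is again a closed surface tangent to the center-unstable field, so the
  -- same `ε'` serves all `k`.
  have hhits : ∀ (k : ℕ) (y z : M), f^[k] z ∈ T → ‖e y - e z‖ < ε' →
      ∃ q, f^[k] q ∈ T ∧ StableRel e f (lam 0) (ε / 4) y q := fun k y z hz hyz =>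
    hits _ (hTc.isClosed.preimage (hfc.iterate k)) (hTS.preimage (hpres.iterate k)) y z hz hyz
  obtain ⟨n, hn, hnU, T₀, hT₀, ⟨φ⟩, hinv, hT₀c, hsep₀, happrox⟩ :=
    exists_attractor hemb.continuous hinj f.toHomeomorph (h.lam_pos 0) hκ hκ1 hTc hT.nonempty hl
      (by positivity) hCδ (by rwa [mul_div_cancel₀ ε four_ne_zero]) hε' hhits hUo hTU hπT hπ hπc
  refine ⟨n, hn, hnU, T₀, hT₀, ⟨hT.1.map φ.trans, ?_⟩, hinv⟩
  have hpre : ∀ k, f^[k * n] '' T = f.symm^[k * n] ⁻¹' T := fun k =>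
    congrFun (image_eq_preimage_of_inverse
      (Function.LeftInverse.iterate f.symm_apply_apply (k * n))
      (Function.LeftInverse.iterate f.apply_symm_apply (k * n))) T
  -- Each image of `T` is a preimage under an iterate of the inverse, hence a tangent surface.
  -- Points of `T₀` are limits of points of these images with error at most `C * δ * κ ^ k`, and
  -- conversely their limits lie in the nested intersection.
  refine h.isSurfaceTangentTo_limit (S := fun k => f^[k * n] '' T)
    (fun k => (hTc.image (hfc.iterate _)).isClosed)
    (fun k => ?_) hT₀c.isClosed (fun y hy => ?_) ?_ hl hsep₀
  · rw [hpre k]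
    exact hTS.preimage (hpres.symm.iterate _)
  · choose x hxT hx using happrox y hy
    refine ⟨fun k => f^[k * n] (x k), fun k => mem_image_of_mem _ (hxT k), ?_⟩
    rw [hemb.isEmbedding.tendsto_nhds_iff, tendsto_iff_norm_sub_tendsto_zero]
    refine squeeze_zero (fun _ => norm_nonneg _) hx ?_
    simpa using (tendsto_pow_atTop_nhds_zero_of_lt_one hκ0.le hκ1).const_mul (C * δ)
  · rw [hT₀]
    exact mem_iInter_image_of_tendsto hfc hTU hnU
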